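/- Let $M$ be a smooth manifold (Hausdorff, second countable, without boundary) of dimension $n$, let $\varepsilon_0>0$, and let $g_\rho$, $\rho\in(-\varepsilon_0,\varepsilon_0)$, be a one-parameter family of pseudo-Riemannian metrics on $M$, of arbitrary signature, depending smoothly on $(\rho,x)$. Set $g:=g_0$ and $$\widetilde{\mathcal G}:=\mathbb R_+\times M\times(-\varepsilon_0,\varepsilon_0)\ni(t,x,\rho),\qquad \widetilde g:=2\rho\,dt^2+2t\,dt\,d\rho+t^2g_\rho .$$ (For example, $(\widetilde{\mathcal G},\widetilde g)$ may be the straight and normal Fefferman--Graham ambient space determined by the representative $g$ of a conformal class on $M$; the formal Ricci flatness of $\widetilde g$ is not needed.) Let $\widetilde\Delta=\operatorname{div}\operatorname{grad}$ be the Laplacian of $\widetilde g$, and for $w\in\mathbb R$ let $\widetilde{\mathcal E}[w]$ be the space of all $\widetilde u\in C^\infty(\widetilde{\mathcal G})$ with $\widetilde u(\lambda t,x,\rho)=\lambda^w\widetilde u(t,x,\rho)$ for all $\lambda>0$. Let $w'\in\mathbb R$, $\widetilde f\in\widetilde{\mathcal E}[w']$ and $k\in\mathbb N=\{0,1,2,\dots\}$,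 and set $w:=-\frac{n+w'-2k}{2}$. For $\widetilde u\in\widetilde{\mathcal E}[w]$ put $$\widetilde D_{2k,w,\widetilde f}(\widetilde u):=\sum_{j=0}^k a_j\,\widetilde\Delta^{k-j}\bigl(\widetilde f\,\widetilde\Delta^j\widetilde u\bigr),\qquad a_j:=\binom kj\frac{\Gamma\bigl(j+k-w-w'-\frac n2\bigr)\,\Gamma\bigl(\frac n2+w-j\bigr)}{\Gamma\bigl(k-w-w'-\frac n2\bigr)\,\Gamma\bigl(\frac n2+w-k\bigr)},$$ where a quotient $\Gamma(z+m)/\Gamma(z)$ with $m\in\mathbb N$ is understood as $z(z+1)\cdots(z+m-1)$, also at poles of $\Gamma$. For $u\in C^\infty(M)$ define $$D_{2k,w,\widetilde f}(u):=\widetilde D_{2k,w,\widetilde f}\bigl(t^w u(x)\bigr)\big|_{t=1,\ \rho=0}.$$ Then $D_{2k,w,\widetilde f}$ maps $C^\infty(M)$ to $C^\infty(M)$, and for all compactly supported $u,v\in C^\infty(M)$ the functions $v\,D_{2k,w,\widetilde f}(u)$ and $u\,D_{2k,w,\widetilde f}(v)$ are integrable with respect to $\operatorname{dvol}_g$ and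 $$\int_M v\,D_{2k,w,\widetilde f}(u)\,\operatorname{dvol}_g=\int_M u\,D_{2k,w,\widetilde f}(v)\,\operatorname{dvol}_g .$$ -/

import Mathlib

open scoped Manifold ContDiff
open MeasureTheory Set

noncomputable section

namespace AmbientFSA

section PseudoRiemannian

variable {E : Type*} [NormedAddCommGroup E] [NormedSpace ℝ E]
  {H : Type*} [TopologicalSpace H] (I : ModelWithCorners ℝ E H)
  {M : Type*} [TopologicalSpace M] [ChartedSpace H M]

/-- A field of bilinear forms on the tangent spaces of `M` (no regularity required). -/
abbrev BilinField : Type _ :=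
  ∀ x : M, TangentSpace I x →L[ℝ] TangentSpace I x →L[ℝ] ℝ

variable {I}

/-- The matrix of components `g_{ij}(y) = g(∂_i, ∂_j)` of `g` at the point of `M` with
coordinates `y` in the chart `e`, where `∂_i` is the image of the `i`-th vector of the basis `b`
of the model space `E` under the differential of the inverse chart. -/
def gram {ι : Type*} (b : Module.Basis ι ℝ E) (g : BilinField I (M := M))
    (e : OpenPartialHomeomorph M H) (y : E) : Matrix ι ι ℝ :=
  Matrix.of fun i j =>
    g ((e.extend I).symm y)
      (mfderiv 𝓘(ℝ, E) I (e.extend I).symm y (b i))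
      (mfderiv 𝓘(ℝ, E) I (e.extend I).symm y (b j))

/-- The Laplace--Beltrami operator `Δ_g u = div_g (grad_g u)` (nonpositive for Riemannian `g`) of a
pseudo-Riemannian metric on a manifold without boundary: at the point `p`,
`Δ_g u = |det g|^{-1/2} ∑_{i,j} ∂_i (|det g|^{1/2} g^{ij} ∂_j u)`
in the linear coordinates, given by the basis `b` of `E`, of the preferred chart at `p`. -/
def laplacian {ι : Type*} [Fintype ι] [DecidableEq ι] (b : Module.Basis ι ℝ E)
    (g : BilinField I (M := M)) (u : M → ℝ) (p : M) : ℝ :=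
  (Real.sqrt |(gram b g (chartAt H p) (extChartAt I p p)).det|)⁻¹ *
    ∑ i, ∑ j,
      fderiv ℝ (fun y : E =>
        Real.sqrt |(gram b g (chartAt H p) y).det| * (gram b g (chartAt H p) y)⁻¹ i j *
          fderiv ℝ (u ∘ (extChartAt I p).symm) y (b j))
        (extChartAt I p p) (b i)

end PseudoRiemannian

variable {n : ℕ} {M : Type*} [TopologicalSpace M] [ChartedSpace (EuclideanSpace ℝ (Fin n)) M]

/-- The standard basis of `ℝⁿ`. -/
abbrev stdBasis (n : ℕ) : Module.Basis (Fin n) ℝ (EuclideanSpace ℝ (Fin n)) :=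
  (EuclideanSpace.basisFun (Fin n) ℝ).toBasis

/-- The measure `|det g_{ij}|^{1/2} dy` of the chart `e`, transported to (the source of `e` in)
the manifold `M`. -/
def chartVolume [MeasurableSpace M] (g : BilinField (𝓡 n) (M := M))
    (e : OpenPartialHomeomorph M (EuclideanSpace ℝ (Fin n))) : Measure M :=
  Measure.map e.symm
    ((volume.restrict e.target).withDensity
      fun y => ENNReal.ofReal (Real.sqrt |(gram (stdBasis n) g e y).det|))

/-- The volume measure `dvol_g` of a pseudo-Riemannian metric. By the change of variables formula
the measures `chartVolume g e` of any two charts agree on the overlap of their sources, so that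
the least measure dominating all of them is the measure on `M` which restricts to
`|det g_{ij}|^{1/2} dy` on each coordinate neighbourhood. -/
def volumeMeasure [MeasurableSpace M] (g : BilinField (𝓡 n) (M := M)) : Measure M :=
  ⨆ e ∈ atlas (EuclideanSpace ℝ (Fin n)) M, chartVolume g e

variable (n M) in
/-- A smooth one-parameter family `g_ρ`, `ρ ∈ (-ε, ε)`, of pseudo-Riemannian metrics (of arbitrary
signature) on `M`. The values of `metric ρ` for other `ρ` are irrelevant. -/
structure MetricFamily [IsManifold (𝓡 n) ∞ M] where
  /-- the half-length of the parameter interval -/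
  ε : ℝ
  ε_pos : 0 < ε
  /-- the metric `g_ρ` -/
  metric : ℝ → BilinField (𝓡 n) (M := M)
  symm : ∀ ρ ∈ Ioo (-ε) ε, ∀ (x : M) (v w : TangentSpace (𝓡 n) x),
    metric ρ x v w = metric ρ x w v
  nondegenerate : ∀ ρ ∈ Ioo (-ε) ε, ∀ (x : M) (v : TangentSpace (𝓡 n) x),
    (∀ w : TangentSpace (𝓡 n) x, metric ρ x v w = 0) → v = 0
  /-- joint smoothness in `(ρ, x)` -/
  smooth : ContMDiffOn (𝓘(ℝ, ℝ).prod (𝓡 n))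
    ((𝓡 n).prod 𝓘(ℝ, EuclideanSpace ℝ (Fin n) →L[ℝ] EuclideanSpace ℝ (Fin n) →L[ℝ] ℝ)) ∞
    (fun q : ℝ × M => Bundle.TotalSpace.mk'
      (EuclideanSpace ℝ (Fin n) →L[ℝ] EuclideanSpace ℝ (Fin n) →L[ℝ] ℝ)
      (E := fun x : M => TangentSpace (𝓡 n) x →L[ℝ] TangentSpace (𝓡 n) x →L[ℝ] ℝ)
      q.2 (metric q.1 q.2))
    (Ioo (-ε) ε ×ˢ (univ : Set M))

/-- The model with corners of `ℝ × M × ℝ`, with coordinates `(t, x, ρ)`. -/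
abbrev ambientModel (n : ℕ) :=
  (𝓘(ℝ, ℝ)).prod ((𝓡 n).prod 𝓘(ℝ, ℝ))

/-- The coordinate basis `(∂_t, ∂_1, …, ∂_n, ∂_ρ)` of `ℝ × ℝⁿ × ℝ`. -/
abbrev ambientBasis (n : ℕ) :
    Module.Basis (Unit ⊕ (Fin n ⊕ Unit)) ℝ (ℝ × EuclideanSpace ℝ (Fin n) × ℝ) :=
  (Module.Basis.singleton Unit ℝ).prod ((stdBasis n).prod (Module.Basis.singleton Unit ℝ))

/-- The bilinear form `2ρ dt² + 2t dt dρ + t² h` on `ℝ × ℝⁿ × ℝ`, where `dt`, `dρ` are the first and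
last coordinates, `2 dt dρ = dt ⊗ dρ + dρ ⊗ dt`, and `h` is a bilinear form on `ℝⁿ`. -/
def straightForm (t ρ : ℝ)
    (h : EuclideanSpace ℝ (Fin n) →L[ℝ] EuclideanSpace ℝ (Fin n) →L[ℝ] ℝ) :
    (ℝ × EuclideanSpace ℝ (Fin n) × ℝ) →L[ℝ] (ℝ × EuclideanSpace ℝ (Fin n) × ℝ) →L[ℝ] ℝ :=
  let dt : ℝ × EuclideanSpace ℝ (Fin n) × ℝ →L[ℝ] ℝ := ContinuousLinearMap.fst ℝ _ _
  let dx : ℝ × EuclideanSpace ℝ (Fin n) × ℝ →L[ℝ] EuclideanSpace ℝ (Fin n) :=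
    (ContinuousLinearMap.fst ℝ _ _).comp (ContinuousLinearMap.snd ℝ _ _)
  let dρ : ℝ × EuclideanSpace ℝ (Fin n) × ℝ →L[ℝ] ℝ :=
    (ContinuousLinearMap.snd ℝ _ _).comp (ContinuousLinearMap.snd ℝ _ _)
  (2 * ρ) • dt.smulRight dt + t • (dt.smulRight dρ + dρ.smulRight dt) +
    t ^ 2 • h.bilinearComp dx dx

theorem straightForm_apply (t ρ : ℝ)
    (h : EuclideanSpace ℝ (Fin n) →L[ℝ] EuclideanSpace ℝ (Fin n) →L[ℝ] ℝ)
    (a a' α α' : ℝ) (v v' : EuclideanSpace ℝ (Fin n)) :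
    straightForm t ρ h (a, v, α) (a', v', α') =
      2 * ρ * (a * a') + t * (a * α' + α * a') + t ^ 2 * h v v' := by
  simp only [straightForm, add_apply, smul_apply,
    ContinuousLinearMap.smulRight_apply, ContinuousLinearMap.bilinearComp_apply,
    ContinuousLinearMap.comp_apply, ContinuousLinearMap.coe_fst', ContinuousLinearMap.coe_snd',
    smul_eq_mul]

namespace MetricFamily

variable [IsManifold (𝓡 n) ∞ M] (g : MetricFamily n M)

/-- The ambient space `ℝ₊ × M × (-ε, ε)` as an open subset of `ℝ × M × ℝ`. -/
def ambientSpace : Set (ℝ × M × ℝ) :=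
  {p | 0 < p.1 ∧ p.2.2 ∈ Ioo (-g.ε) g.ε}

/-- The metric `2ρ dt² + 2t dt dρ + t² g_ρ` in straight and normal form. -/
def ambientMetric : BilinField (ambientModel n) (M := ℝ × M × ℝ) := fun p =>
  straightForm p.1 p.2.2 (g.metric p.2.2 p.2.1)

/-- The Laplacian of the ambient metric, acting on functions of `(t, x, ρ)`. -/
def ambientLaplacian : (ℝ × M × ℝ → ℝ) → ℝ × M × ℝ → ℝ :=
  laplacian (ambientBasis n) g.ambientMetric

/-- Smooth functions on the ambient space which are homogeneous of weight `w` with respect to the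
dilations `(t, x, ρ) ↦ (λ t, x, ρ)`. -/
structure IsHomogeneous (w : ℝ) (f : ℝ × M × ℝ → ℝ) : Prop where
  smooth : ContMDiffOn (ambientModel n) 𝓘(ℝ, ℝ) ∞ f g.ambientSpace
  dilation : ∀ p ∈ g.ambientSpace, ∀ c : ℝ, 0 < c → f (c * p.1, p.2) = c ^ w * f p

end MetricFamily

/-- The coefficient
`a_j = (k choose j) (Γ(z + j) / Γ(z)) (Γ(z' + k - j) / Γ(z'))`, where `z = k - w - w' - n/2` and
`z' = n/2 + w - k`. The ratio `Γ(z + m) / Γ(z)`, `m ∈ ℕ`, is the rising factorial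
`z (z + 1) ⋯ (z + m - 1)`, also where `Γ` has a pole. -/
def coeff (n k : ℕ) (w w' : ℝ) (j : ℕ) : ℝ :=
  (k.choose j : ℝ) * (ascPochhammer ℝ j).eval ((k : ℝ) - w - w' - n / 2) *
    (ascPochhammer ℝ (k - j)).eval ((n : ℝ) / 2 + w - k)

/-- Away from the poles `coeff` is the quotient of Gamma functions. -/
theorem coeff_eq_gamma (n k : ℕ) (w w' : ℝ) (j : ℕ) (hj : j ≤ k)
    (h : ∀ m : ℕ, (k : ℝ) - w - w' - n / 2 ≠ -m) (h' : ∀ m : ℕ, (n : ℝ) / 2 + w - k ≠ -m) :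
    coeff n k w w' j = (k.choose j : ℝ) *
      (Real.Gamma (j + k - w - w' - n / 2) * Real.Gamma (n / 2 + w - j)) /
      (Real.Gamma (k - w - w' - n / 2) * Real.Gamma (n / 2 + w - k)) := by
  have key : ∀ (z : ℝ), (∀ m : ℕ, z ≠ -m) → ∀ m : ℕ,
      Real.Gamma (z + m) = (ascPochhammer ℝ m).eval z * Real.Gamma z := by
    intro z hz m
    induction m with
    | zero => simp
    | succ m ih =>
      have hne : z + m ≠ 0 := fun h0 => hz m (by linarith)
      rw [ascPochhammer_succ_eval, Nat.cast_succ, ← add_assoc, Real.Gamma_add_one hne, ih]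
      ring
  have h1 := key _ h j
  have h2 := key _ h' (k - j)
  rw [Nat.cast_sub hj] at h2
  have e1 : (j : ℝ) + k - w - w' - n / 2 = (k : ℝ) - w - w' - n / 2 + j := by ring
  have e2 : (n : ℝ) / 2 + w - j = (n : ℝ) / 2 + w - k + (k - j) := by ring
  rw [e1, e2, h1, h2, coeff, eq_div_iff
    (mul_ne_zero (Real.Gamma_ne_zero h) (Real.Gamma_ne_zero h'))]
  ring

namespace MetricFamily

variable [IsManifold (𝓡 n) ∞ M] (g : MetricFamily n M)

/-- The ambient operator `u ↦ ∑_{j=0}^k a_j Δ^{k-j} (f Δ^j u)`, where `f` has weight `w'` and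
`u` has weight `w`. -/
def ambientOp (k : ℕ) (w w' : ℝ) (f u : ℝ × M × ℝ → ℝ) : ℝ × M × ℝ → ℝ := fun p =>
  ∑ j ∈ Finset.range (k + 1),
    coeff n k w w' j * (g.ambientLaplacian^[k - j] (f * g.ambientLaplacian^[j] u)) p

/-- The induced operator on `M`: apply `ambientOp` to the extension `t^w u(x)` of `u` and restrict
the result to `t = 1`, `ρ = 0`. -/
def inducedOp (k : ℕ) (w w' : ℝ) (f : ℝ × M × ℝ → ℝ) (u : M → ℝ) : M → ℝ := fun x =>
  g.ambientOp k w w' f (fun p => p.1 ^ w * u p.2.1) (1, x, 0)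

end MetricFamily

end AmbientFSA

end

open scoped Manifold ContDiff
open MeasureTheory Set

noncomputable section

namespace AmbientFSA

/-! ### The algebra of the ambient Laplacian on homogeneous functions. -/

section DifferentialAlgebra

/-! On functions `t^w U(x, ρ)` the ambient Laplacian acts as `U ↦ t^(w-2) op w U`, where `op w` is a
second order operator in `(x, ρ)` alone. In a chart of `M` the operator of the theorem thus becomes
`D = sumOp k w w w' F`, followed by restriction to `ρ = 0`.

Two structural facts carry the proof. First, `op` commutes with multiplication by `ρ` up to a
constant depending on the weight (`op_ρ_mul`). This is the `sl₂` relation between the Laplacian and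
multiplication by `2ρt²`, the squared length of the Euler field. The coefficients `a_j` satisfy
exactly the recursion that cancels all the commutators, so `D (ρ U) = ρ D' U`, where `D'` has the
same coefficients but acts on weight `w - 2` (`sumOp_ρ_mul`). Secondly, with respect to `m dx dρ`
the formal adjoint of `op w` is `op (-n - w)` (`Stable.green`). For the weight `w` of the theorem
`a_(k-j) = a_j`, and therefore the formal adjoint of `D` is `D'` (`Stable.green_sumOp`).

Now pair `D U` with `V / ρ`. Modulo divergences, `(V / ρ) D U ≡ U D' (V / ρ) = U (D V) / ρ`, so `m
(V D U - U D V) / ρ` is a divergence in `(x, ρ)` whose components have poles of finite order at `ρ =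
0`. Taking the residue at `ρ = 0` kills the `∂_ρ` term and commutes with each `∂_i`. Hence `m (V D U
- U D V)` restricted to `ρ = 0` is a divergence in `x` (`sumOp_symm_mod_divergence`). An ideal `K`
of functions vanishing outside a closed set records the supports throughout.

It remains to see that the Laplacian, defined through preferred charts, may be computed in any chart
(`laplacian_eq_coordLaplacian`), that it is `op w` there (`coordLaplacian_homFun`), and that
integrals over `M` are chart integrals when the support permits (`integral_volumeMeasure`). The
divergence then integrates to zero if `v` is supported in one chart, and a partition of unity
applied to `v` gives the general case. -/

/-- The data entering the Laplacian of the ambient metric, over a commutative differential algebra: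
the derivations `∂_ρ` and `∂_i`, the coordinate `ρ`, the volume density `m` of `g_ρ` with inverse
`m'`, and the components `h` of the inverse metric. -/
structure AmbientData (n : ℕ) (A : Type*) [CommRing A] [Algebra ℝ A] where
  /-- the derivation `∂_ρ` -/
  dρ : Derivation ℝ A A
  /-- the derivations `∂_i` -/
  d : Fin n → Derivation ℝ A A
  /-- the coordinate `ρ` -/
  ρ : A
  /-- the volume density -/
  m : A
  /-- the inverse of the volume density -/
  m' : A
  /-- the inverse metric -/
  h : Fin n → Fin n → A
  m_mul : m * m' = 1
  dρ_ρ : dρ ρ = 1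
  d_ρ : ∀ i, d i ρ = 0
  h_symm : ∀ i j, h i j = h j i

namespace AmbientData

variable {n : ℕ} {A : Type*} [CommRing A] [Algebra ℝ A] (𝒟 : AmbientData n A)

/-- The `i`-th component of the gradient density. -/
def flux (U : A) (i : Fin n) : A := ∑ j, 𝒟.m * 𝒟.h i j * 𝒟.d j U

/-- The operator induced by the ambient Laplacian on functions of weight `w`. -/
def op (w : ℝ) : Module.End ℝ A where
  toFun U := -(2 : ℝ) • (𝒟.ρ * 𝒟.dρ (𝒟.dρ U)) + (n + 2 * w - 2) • 𝒟.dρ U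
    - (2 : ℝ) • (𝒟.ρ * 𝒟.m' * 𝒟.dρ 𝒟.m * 𝒟.dρ U) + w • (𝒟.m' * 𝒟.dρ 𝒟.m * U)
    + 𝒟.m' * ∑ i, 𝒟.d i (𝒟.flux U i)
  map_add' U V := by
    simp only [flux, map_add, mul_add, smul_add, Finset.sum_add_distrib]
    abel
  map_smul' c U := by
    simp only [flux, Derivation.map_smul, mul_smul_comm, ← Finset.smul_sum, smul_add, smul_sub,
      RingHom.id_apply, smul_comm c]

theorem op_apply (w : ℝ) (U : A) :
    𝒟.op w U = -(2 : ℝ) • (𝒟.ρ * 𝒟.dρ (𝒟.dρ U)) + (n + 2 * w - 2) • 𝒟.dρ U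
    - (2 : ℝ) • (𝒟.ρ * 𝒟.m' * 𝒟.dρ 𝒟.m * 𝒟.dρ U) + w • (𝒟.m' * 𝒟.dρ 𝒟.m * U)
    + 𝒟.m' * ∑ i, 𝒟.d i (𝒟.flux U i) := rfl

theorem flux_ρ_mul (U : A) (i : Fin n) : 𝒟.flux (𝒟.ρ * U) i = 𝒟.ρ * 𝒟.flux U i := by
  simp only [flux, Derivation.leibniz, 𝒟.d_ρ, smul_eq_mul, mul_zero, add_zero, Finset.mul_sum]
  exact Finset.sum_congr rfl fun j _ => by ring

/-- Since `∂_i ρ = 0`, only the `∂_ρ` terms fail to commute with `ρ`. The terms containing `∂_ρ m`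
cancel because the weight rises by 2, which leaves a constant. -/
theorem op_ρ_mul (w : ℝ) (U : A) :
    𝒟.op (w + 2) (𝒟.ρ * U) = 𝒟.ρ * 𝒟.op w U + (n + 2 * w + 2) • U := by
  have h1 : ∑ i, 𝒟.d i (𝒟.flux (𝒟.ρ * U) i) = 𝒟.ρ * ∑ i, 𝒟.d i (𝒟.flux U i) := by
    simp only [flux_ρ_mul, Derivation.leibniz, 𝒟.d_ρ, smul_eq_mul, mul_zero, add_zero,
      Finset.mul_sum]
  simp only [op_apply, h1, Derivation.leibniz, 𝒟.dρ_ρ, smul_eq_mul, map_add, Derivation.map_one_eq_zero,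
    Algebra.smul_def, map_add, map_sub, map_mul, map_neg, map_natCast, map_ofNat]
  ring

/-- The iterates of the ambient Laplacian on functions of weight `w`. -/
def iter (w : ℝ) : ℕ → Module.End ℝ A
  | 0 => 1
  | j + 1 => 𝒟.op (w - 2 * j) * iter w j

theorem iter_zero (w : ℝ) (U : A) : 𝒟.iter w 0 U = U := rfl

theorem iter_succ (w : ℝ) (j : ℕ) (U : A) :
    𝒟.iter w (j + 1) U = 𝒟.op (w - 2 * j) (𝒟.iter w j U) := rfl

/-- Splits off the innermost factor instead of the outermost one; passing to adjoints exchanges the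
two. -/
theorem iter_succ' (w : ℝ) (j : ℕ) (U : A) :
    𝒟.iter w (j + 1) U = 𝒟.iter (w - 2) j (𝒟.op w U) := by
  induction j with
  | zero => simp [iter_succ, iter_zero]
  | succ j ih =>
    rw [iter_succ, ih, iter_succ]
    congr 2
    push_cast
    ring

/-- Commuting `ρ` past the `i`-th Laplacian costs `n + 2(w - 2i) + 2`; the constant is the sum of
these over `i = 0, …, j`. -/
theorem iter_succ_ρ_mul (w : ℝ) (j : ℕ) (U : A) :
    𝒟.iter (w + 2) (j + 1) (𝒟.ρ * U) =
      𝒟.ρ * 𝒟.iter w (j + 1) U + ((j + 1) * (n + 2 * w + 2 - 2 * j)) • 𝒟.iter w j U := by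
  induction j with
  | zero =>
    simp only [iter_succ, iter_zero, Nat.cast_zero, mul_zero, sub_zero, op_ρ_mul]
    norm_num
  | succ j ih =>
    have e : w + 2 - 2 * ((j + 1 : ℕ) : ℝ) = w - 2 * ((j + 1 : ℕ) : ℝ) + 2 := by ring
    have e' : w - 2 * ((j + 1 : ℕ) : ℝ) + 2 = w - 2 * j := by push_cast; ring
    rw [iter_succ, ih, map_add, map_smul, e, op_ρ_mul, ← iter_succ, e', ← iter_succ, add_assoc,
      ← add_smul]
    congr 2
    push_cast
    ring

/-- Uniform in `j`: at `j = 0` the truncated exponent `j - 1` is harmless because of the factor `j`.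
-/
theorem iter_ρ_mul (w : ℝ) (j : ℕ) (U : A) :
    𝒟.iter (w + 2) j (𝒟.ρ * U) =
      𝒟.ρ * 𝒟.iter w j U + (j * (n + 2 * w + 4 - 2 * j)) • 𝒟.iter w (j - 1) U := by
  cases j with
  | zero => simp [iter_zero]
  | succ j =>
    rw [iter_succ_ρ_mul, Nat.add_sub_cancel]
    congr 2
    push_cast
    ring

end AmbientData

/-- The recursion behind the choice of the `a_j`: the commutator of `ρ` with the inner `Δ^(j+1)`
cancels that with the outer `Δ^(k-j)` of the preceding term. It holds for every `w`, and in product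
form it is also valid where the Gamma quotients degenerate. -/
theorem coeff_succ_mul (n k : ℕ) (w w' : ℝ) {j : ℕ} (hj : j < k) :
    coeff n k w w' (j + 1) * ((j + 1) * (n + 2 * w - 2 * (j + 1))) +
      coeff n k w w' j * ((k - j) * (n + 2 * w + 2 * w' - 2 * j - 2 * k)) = 0 := by
  obtain ⟨i, rfl⟩ : ∃ i, k = j + 1 + i := ⟨k - (j + 1), by omega⟩
  have h1 : j + 1 + i - (j + 1) = i := by omega
  have h2 : j + 1 + i - j = i + 1 := by omega
  have h3 : ((j + 1 + i).choose (j + 1) : ℝ) * (j + 1) = (j + 1 + i).choose j * (i + 1) := by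
    have := Nat.choose_succ_right_eq (j + 1 + i) j
    rw [h2] at this
    exact_mod_cast this
  simp only [coeff, h1, h2, ascPochhammer_succ_eval]
  push_cast
  set a := (ascPochhammer ℝ j).eval ((j : ℝ) + 1 + i - w - w' - n / 2)
  set b := (ascPochhammer ℝ i).eval ((n : ℝ) / 2 + w - (j + 1 + i))
  linear_combination (a * b * ((j : ℝ) + 1 + i - w - w' - n / 2 + j) *
    (n + 2 * w - 2 * (j + 1))) * h3

/-- At this weight both rising factorials have the same base `-w'/2`. This is where the special
value of `w` makes the operator symmetric. -/
theorem coeff_symm (n k : ℕ) (w w' : ℝ) (hw : w = -((n + w' - 2 * k) / 2)) {j : ℕ} (hj : j ≤ k) :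
    coeff n k w w' (k - j) = coeff n k w w' j := by
  have e1 : (k : ℝ) - w - w' - n / 2 = -w' / 2 := by rw [hw]; ring
  have e2 : (n : ℝ) / 2 + w - k = -w' / 2 := by rw [hw]; ring
  rw [coeff, coeff, e1, e2, Nat.choose_symm hj, Nat.sub_sub_self hj]
  ring

namespace AmbientData

variable {n : ℕ} {A : Type*} [CommRing A] [Algebra ℝ A] (𝒟 : AmbientData n A)

/-- The operator `∑ a_j Δ^{k-j} f Δ^j` on functions of weight `w`, with the coefficients `a_j`
belonging to the weight `w₀`. -/
def sumOp (k : ℕ) (w₀ w w' : ℝ) (F U : A) : A :=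
  ∑ j ∈ Finset.range (k + 1),
    coeff n k w₀ w' j • 𝒟.iter (w + w' - 2 * j) (k - j) (F * 𝒟.iter w j U)

/-- Tangentiality: the value of the operator at `ρ = 0` depends only on the argument at `ρ = 0`. The
coefficients stay those of `w` on the right, although the argument now has weight `w - 2`. -/
theorem sumOp_ρ_mul (k : ℕ) (w w' : ℝ) (F U : A) :
    𝒟.sumOp k w w w' F (𝒟.ρ * U) = 𝒟.ρ * 𝒟.sumOp k w (w - 2) w' F U := by
  -- Each commutator removes one Laplacian. From the `j`-th summand the outer one yields `T j` and
  -- the inner one `T (j - 1)`.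
  set T : ℕ → A := fun j => 𝒟.iter (w - 2 + w' - 2 * j) (k - j - 1) (F * 𝒟.iter (w - 2) j U)
    with hT
  have hterm : ∀ j ≤ k,
      𝒟.iter (w + w' - 2 * j) (k - j) (F * 𝒟.iter w j (𝒟.ρ * U)) =
        𝒟.ρ * 𝒟.iter (w - 2 + w' - 2 * j) (k - j) (F * 𝒟.iter (w - 2) j U) +
        ((k - j : ℝ) * (n + 2 * w + 2 * w' - 2 * j - 2 * k)) • T j +
        (j * (n + 2 * w - 2 * j)) • T (j - 1) := by
    intro j hj
    have e : w = w - 2 + 2 := by ring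
    have e1 : w + w' - 2 * j = (w - 2 + w' - 2 * j) + 2 := by ring
    have h1 := 𝒟.iter_ρ_mul (w - 2) j U
    rw [← e] at h1
    rw [h1, mul_add, mul_left_comm, mul_smul_comm, map_add, map_smul]
    conv_lhs => rw [e1]
    rw [iter_ρ_mul, Nat.cast_sub hj]
    congr 1
    · congr 2
      ring
    · rcases Nat.eq_zero_or_pos j with rfl | hj0
      · simp
      · obtain ⟨i, rfl⟩ : ∃ i, j = i + 1 := ⟨j - 1, by omega⟩
        have e2 : w - 2 + w' - 2 * ((i + 1 : ℕ) : ℝ) + 2 = w - 2 + w' - 2 * (i : ℝ) := by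
          push_cast; ring
        have e3 : k - i - 1 = k - (i + 1) := by omega
        simp only [hT, Nat.add_sub_cancel, e2, e3]
        congr 1
        push_cast
        ring
  have hS : 𝒟.sumOp k w w w' F (𝒟.ρ * U) = 𝒟.ρ * 𝒟.sumOp k w (w - 2) w' F U +
      (∑ j ∈ Finset.range (k + 1),
        (coeff n k w w' j * ((k - j : ℝ) * (n + 2 * w + 2 * w' - 2 * j - 2 * k))) • T j +
      ∑ j ∈ Finset.range (k + 1), (coeff n k w w' j * (j * (n + 2 * w - 2 * j))) • T (j - 1)) := by
    simp only [sumOp, Finset.mul_sum, ← Finset.sum_add_distrib]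
    refine Finset.sum_congr rfl fun j hj => ?_
    rw [hterm j (Nat.lt_succ_iff.mp (Finset.mem_range.mp hj)), smul_add, smul_add, mul_smul_comm,
      smul_smul, smul_smul, add_assoc]
  -- The term `j = k` of the first sum and the term `j = 0` of the second have coefficient zero.
  -- After an index shift the rest cancels by `coeff_succ_mul`.
  rw [hS, Finset.sum_range_succ, Finset.sum_range_succ']
  simp only [sub_self, zero_mul, mul_zero, zero_smul, add_zero, Nat.cast_zero,
    ← Finset.sum_add_distrib, Nat.add_sub_cancel, ← add_smul]
  rw [add_eq_left]
  refine Finset.sum_eq_zero fun j hj => ?_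
  have := coeff_succ_mul n k w w' (Finset.mem_range.mp hj)
  rw [add_comm] at this
  push_cast
  rw [this, zero_smul]

/-! ### Green's formula and formal adjoints modulo divergences. -/

/-- Divergences of vector densities with components in the ideal `K`. -/
def exact (K : Ideal A) : Submodule ℝ A where
  carrier := {W | ∃ α ∈ K, ∃ β : Fin n → A, (∀ i, β i ∈ K) ∧ W = 𝒟.dρ α + ∑ i, 𝒟.d i (β i)}
  zero_mem' := ⟨0, K.zero_mem, 0, fun _ => K.zero_mem, by simp⟩
  add_mem' := by
    rintro _ _ ⟨α, hα, β, hβ, rfl⟩ ⟨α', hα', β', hβ', rfl⟩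
    refine ⟨α + α', K.add_mem hα hα', β + β', fun i => K.add_mem (hβ i) (hβ' i), ?_⟩
    simp only [map_add, Pi.add_apply, Finset.sum_add_distrib]
    abel
  smul_mem' := by
    rintro c _ ⟨α, hα, β, hβ, rfl⟩
    refine ⟨c • α, ?_, c • β, fun i => ?_, ?_⟩
    · rw [Algebra.smul_def]; exact K.mul_mem_left _ hα
    · rw [Pi.smul_apply, Algebra.smul_def]; exact K.mul_mem_left _ (hβ i)
    · simp only [Pi.smul_apply, Derivation.map_smul, smul_add, Finset.smul_sum]

/-- The ideal `K` is stable under the derivations. -/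
def Stable (K : Ideal A) : Prop :=
  (∀ a ∈ K, 𝒟.dρ a ∈ K) ∧ ∀ i, ∀ a ∈ K, 𝒟.d i a ∈ K

variable {𝒟} {K : Ideal A}

theorem Stable.flux_mem (hK : 𝒟.Stable K) {U : A} (hU : U ∈ K) (i : Fin n) : 𝒟.flux U i ∈ K :=
  K.sum_mem fun j _ => K.mul_mem_left _ (hK.2 j _ hU)

theorem smul_mem_ideal (c : ℝ) {U : A} (hU : U ∈ K) : c • U ∈ K := by
  rw [Algebra.smul_def]; exact K.mul_mem_left _ hU

theorem Stable.op_mem (hK : 𝒟.Stable K) (w : ℝ) {U : A} (hU : U ∈ K) : 𝒟.op w U ∈ K := by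
  have h1 := hK.1 _ hU
  refine K.add_mem (K.add_mem (K.sub_mem (K.add_mem ?_ ?_) ?_) ?_) ?_
  · exact smul_mem_ideal _ (K.mul_mem_left _ (hK.1 _ h1))
  · exact smul_mem_ideal _ h1
  · exact smul_mem_ideal _ (K.mul_mem_left _ h1)
  · exact smul_mem_ideal _ (K.mul_mem_left _ hU)
  · exact K.mul_mem_left _ (K.sum_mem fun i _ => hK.2 i _ (hK.flux_mem hU i))

theorem Stable.iter_mem (hK : 𝒟.Stable K) (w : ℝ) (j : ℕ) {U : A} (hU : U ∈ K) :
    𝒟.iter w j U ∈ K := by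
  induction j with
  | zero => exact hU
  | succ j ih => exact hK.op_mem _ ih

theorem Stable.sumOp_mem (hK : 𝒟.Stable K) (k : ℕ) (w₀ w w' : ℝ) (F : A) {U : A} (hU : U ∈ K) :
    𝒟.sumOp k w₀ w w' F U ∈ K :=
  K.sum_mem fun _ _ => smul_mem_ideal _
    (hK.iter_mem _ _ (K.mul_mem_left _ (hK.iter_mem _ _ hU)))

/-- Green's formula for the ambient Laplacian on homogeneous functions. -/
theorem Stable.green (hK : 𝒟.Stable K) (w : ℝ) (U : A) {V : A} (hV : V ∈ K) :
    𝒟.m * (V * 𝒟.op w U) - 𝒟.m * (𝒟.op (-n - w) V * U) ∈ 𝒟.exact K := by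
  -- These are the `ρ`- and `x`-components of the density `V grad U - U grad V` of the ambient
  -- metric, for `U` of weight `w` and `V` of weight `-n - w`. With these weights the `t`-component
  -- of the density has degree 0 in `t`, so `∂_t` kills it.
  refine ⟨𝒟.m * (((n : ℝ) + 2 * w) • (U * V) - (2 : ℝ) • (𝒟.ρ * (V * 𝒟.dρ U - U * 𝒟.dρ V))),
    ?_, fun i => V * 𝒟.flux U i - U * 𝒟.flux V i, fun i => ?_, ?_⟩
  · refine K.mul_mem_left _ (K.sub_mem (smul_mem_ideal _ (K.mul_mem_left _ hV))
      (smul_mem_ideal _ (K.mul_mem_left _ (K.sub_mem (K.mul_mem_right _ hV)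
        (K.mul_mem_left _ (hK.1 _ hV))))))
  · exact K.sub_mem (K.mul_mem_right _ hV) (K.mul_mem_left _ (hK.flux_mem hV i))
  · have h1 : ∑ i, 𝒟.d i V * 𝒟.flux U i = ∑ i, 𝒟.d i U * 𝒟.flux V i := by
      simp only [flux, Finset.mul_sum]
      rw [Finset.sum_comm]
      exact Finset.sum_congr rfl fun i _ => Finset.sum_congr rfl fun j _ => by
        rw [𝒟.h_symm j i]; ring
    have h2 : ∑ i, 𝒟.d i (V * 𝒟.flux U i - U * 𝒟.flux V i) =
        V * ∑ i, 𝒟.d i (𝒟.flux U i) - U * ∑ i, 𝒟.d i (𝒟.flux V i) := by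
      simp only [map_sub, Derivation.leibniz, smul_eq_mul, Finset.sum_sub_distrib,
        Finset.sum_add_distrib, ← Finset.mul_sum, mul_comm (𝒟.flux _ _)]
      linear_combination h1
    have hm := 𝒟.m_mul
    rw [h2]
    simp only [op_apply, Derivation.leibniz, 𝒟.dρ_ρ, Derivation.map_smul, smul_eq_mul, map_sub]
    simp only [Algebra.smul_def, map_mul, map_neg, map_natCast, map_ofNat, map_add, map_sub]
    set s := ∑ i, 𝒟.d i (𝒟.flux U i)
    set t := ∑ i, 𝒟.d i (𝒟.flux V i)
    linear_combination (V * s - U * t + (2 * algebraMap ℝ A w + n) * 𝒟.dρ 𝒟.m * U * V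
      - 2 * 𝒟.ρ * 𝒟.dρ 𝒟.m * (V * 𝒟.dρ U - U * 𝒟.dρ V)) * hm

/-- The outermost Laplacian on `U` becomes the innermost one on `V`. The weight on the right is such
that the chain of adjoint operators ends in `op (-n - w)`. -/
theorem Stable.green_iter (hK : 𝒟.Stable K) (w : ℝ) (j : ℕ) (U : A) {V : A} (hV : V ∈ K) :
    𝒟.m * (V * 𝒟.iter w j U) - 𝒟.m * (𝒟.iter (-n - w + 2 * j - 2) j V * U) ∈ 𝒟.exact K := by
  induction j generalizing V with
  | zero => simp [iter_zero]
  | succ j ih =>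
    have h1 := hK.green (w - 2 * j) (𝒟.iter w j U) hV
    have h2 := ih (hK.op_mem (-n - (w - 2 * j)) hV)
    have h3 := (𝒟.exact K).add_mem h1 h2
    rw [sub_add_sub_cancel] at h3
    rw [iter_succ, iter_succ']
    convert h3 using 7 <;> push_cast <;> ring

/-- The adjoint of `Δ^(k-j) F Δ^j` is `Δ^j F Δ^(k-j)`, acting on weight `w - 2` by the choice of
`w`. Reversing the sum and using the symmetry of the coefficients gives the same operator on the
shifted weight. -/
theorem Stable.green_sumOp (hK : 𝒟.Stable K) (k : ℕ) (w w' : ℝ)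
    (hw : w = -((n + w' - 2 * k) / 2)) (F U : A) {V : A} (hV : V ∈ K) :
    𝒟.m * (V * 𝒟.sumOp k w w w' F U) - 𝒟.m * (𝒟.sumOp k w (w - 2) w' F V * U) ∈ 𝒟.exact K := by
  have e : 𝒟.sumOp k w (w - 2) w' F V = ∑ j ∈ Finset.range (k + 1),
      coeff n k w w' j • 𝒟.iter (w - 2 + w' - 2 * (k - j : ℕ)) j
        (F * 𝒟.iter (w - 2) (k - j) V) := by
    rw [sumOp, ← Finset.sum_range_reflect]
    refine Finset.sum_congr rfl fun j hj => ?_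
    have hj' : j ≤ k := Nat.lt_succ_iff.mp (Finset.mem_range.mp hj)
    have e1 : k + 1 - 1 - j = k - j := by omega
    rw [e1, coeff_symm n k w w' hw hj', Nat.sub_sub_self hj']
  rw [e, sumOp, Finset.mul_sum, Finset.sum_mul, Finset.mul_sum, Finset.mul_sum,
    ← Finset.sum_sub_distrib]
  refine Submodule.sum_mem _ fun j hj => ?_
  have hj' : j ≤ k := Nat.lt_succ_iff.mp (Finset.mem_range.mp hj)
  simp only [mul_smul_comm, smul_mul_assoc, ← smul_sub]
  refine Submodule.smul_mem _ _ ?_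
  -- First the outer Laplacians are moved onto `V`, then the inner ones onto `F Δ^(k-j) V`, which
  -- still lies in `K`.
  have h1 := hK.green_iter (w + w' - 2 * j) (k - j) (F * 𝒟.iter w j U) hV
  have h2 := hK.green_iter w j U (K.mul_mem_left F (hK.iter_mem (w - 2) (k - j) hV))
  have e1 : -(n : ℝ) - (w + w' - 2 * j) + 2 * ((k - j : ℕ) : ℝ) - 2 = w - 2 := by
    rw [Nat.cast_sub hj', hw]; ring
  have e2 : -(n : ℝ) - w + 2 * j - 2 = w - 2 + w' - 2 * ((k - j : ℕ) : ℝ) := by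
    rw [Nat.cast_sub hj', hw]; ring
  rw [e1] at h1
  rw [e2] at h2
  have h3 := (𝒟.exact K).add_mem h1 h2
  have e3 : 𝒟.iter (w - 2) (k - j) V * (F * 𝒟.iter w j U) =
      F * 𝒟.iter (w - 2) (k - j) V * 𝒟.iter w j U := by ring
  rwa [e3, sub_add_sub_cancel] at h3

/-- The operator `sumOp` is formally self-adjoint in the sense of residues at `ρ = 0`. -/
theorem Stable.residue_sumOp (hK : 𝒟.Stable K) (k : ℕ) (w w' : ℝ)
    (hw : w = -((n + w' - 2 * k) / 2)) (F U : A) {V σ : A} (hV : V ∈ K) (hσ : 𝒟.ρ * σ = 1) :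
    σ * (𝒟.m * (V * 𝒟.sumOp k w w w' F U - U * 𝒟.sumOp k w w w' F V)) ∈ 𝒟.exact K := by
  -- With `V / ρ` in place of `V`, the adjoint acts on weight `w - 2`, and tangentiality turns `D'
  -- (V / ρ)` into `(D V) / ρ`.
  have h1 := hK.green_sumOp k w w' hw F U (K.mul_mem_left σ hV)
  have h2 := 𝒟.sumOp_ρ_mul k w w' F (σ * V)
  rw [← mul_assoc, hσ, one_mul] at h2
  convert h1 using 1
  linear_combination (-(σ * 𝒟.m * U)) * h2 +
    (-(𝒟.m * U * 𝒟.sumOp k w (w - 2) w' F (σ * V))) * hσ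

variable {B : Type*} [CommRing B] [Algebra ℝ B]

/-- A homomorphism of algebras which is compatible with the data. -/
structure Hom (𝒟 : AmbientData n A) (ℰ : AmbientData n B) where
  /-- the homomorphism -/
  φ : A →ₐ[ℝ] B
  dρ : ∀ a, φ (𝒟.dρ a) = ℰ.dρ (φ a)
  d : ∀ i a, φ (𝒟.d i a) = ℰ.d i (φ a)
  ρ : φ 𝒟.ρ = ℰ.ρ
  m : φ 𝒟.m = ℰ.m
  m' : φ 𝒟.m' = ℰ.m'
  h : ∀ i j, φ (𝒟.h i j) = ℰ.h i j

namespace Hom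

variable {ℰ : AmbientData n B} (η : Hom 𝒟 ℰ)

theorem map_op (w : ℝ) (U : A) : η.φ (𝒟.op w U) = ℰ.op w (η.φ U) := by
  simp only [op_apply, flux, map_add, map_sub, map_smul, map_mul, map_sum, η.dρ, η.d, η.ρ, η.m,
    η.m', η.h]

theorem map_iter (w : ℝ) (j : ℕ) (U : A) : η.φ (𝒟.iter w j U) = ℰ.iter w j (η.φ U) := by
  induction j with
  | zero => rfl
  | succ j ih => rw [iter_succ, iter_succ, map_op, ih]

theorem map_sumOp (k : ℕ) (w₀ w w' : ℝ) (F U : A) :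
    η.φ (𝒟.sumOp k w₀ w w' F U) = ℰ.sumOp k w₀ w w' (η.φ F) (η.φ U) := by
  simp only [sumOp, map_sum, map_smul, map_iter, map_mul]

end Hom

end AmbientData

end DifferentialAlgebra

/-! ### Invariance of the Laplacian under changes of coordinates. -/

section CoordinateLaplacian

set_option linter.unusedSectionVars false

open Filter Topology

variable {F : Type*} [NormedAddCommGroup F] [NormedSpace ℝ F]
  {ι : Type*} [Fintype ι] [DecidableEq ι]

theorem contDiffAt_det {k : WithTop ℕ∞} {A : F → Matrix ι ι ℝ} {y : F}
    (hA : ∀ i j, ContDiffAt ℝ k (fun z => A z i j) y) : ContDiffAt ℝ k (fun z => (A z).det) y := by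
  simp only [Matrix.det_apply]
  exact ContDiffAt.sum fun σ _ => (contDiffAt_prod fun i _ => hA _ _).const_smul _

theorem contDiffAt_adjugate {k : WithTop ℕ∞} {A : F → Matrix ι ι ℝ} {y : F}
    (hA : ∀ i j, ContDiffAt ℝ k (fun z => A z i j) y) (i j : ι) :
    ContDiffAt ℝ k (fun z => (A z).adjugate i j) y := by
  simp only [Matrix.adjugate_apply]
  refine contDiffAt_det fun a c => ?_
  by_cases h : a = j
  · subst h
    simp only [Matrix.updateRow_self]
    exact contDiffAt_const
  · simp only [Matrix.updateRow_ne h]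
    exact hA a c

theorem contDiffAt_inv_apply {k : WithTop ℕ∞} {A : F → Matrix ι ι ℝ} {y : F}
    (hA : ∀ i j, ContDiffAt ℝ k (fun z => A z i j) y) (hy : (A y).det ≠ 0) (i j : ι) :
    ContDiffAt ℝ k (fun z => (A z)⁻¹ i j) y := by
  simp only [Matrix.inv_def, Matrix.smul_apply, smul_eq_mul, Ring.inverse_eq_inv']
  exact ((contDiffAt_det hA).inv hy).mul (contDiffAt_adjugate hA i j)

theorem contDiffAt_sqrt_abs_det {A : F → Matrix ι ι ℝ} {y : F}
    (hA : ∀ i j, ContDiffAt ℝ ∞ (fun z => A z i j) y) (hy : (A y).det ≠ 0) :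
    ContDiffAt ℝ ∞ (fun z => Real.sqrt |(A z).det|) y := by
  have h : ContDiffAt ℝ ∞ (fun z => |(A z).det|) y :=
    ContDiffAt.comp y (g := fun t : ℝ => |t|) (contDiffAt_abs hy) (contDiffAt_det hA)
  exact h.sqrt (abs_ne_zero.mpr hy)

/-- Jacobi's formula for the derivative of a determinant. -/
theorem hasFDerivAt_det {A : F → Matrix ι ι ℝ} {y : F} {A' : ι → ι → F →L[ℝ] ℝ}
    (hA : ∀ i j, HasFDerivAt (fun z => A z i j) (A' i j) y) :
    HasFDerivAt (fun z => (A z).det) (∑ j, ∑ i, (A y).adjugate j i • A' i j) y := by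
  have h1 : HasFDerivAt (fun z => (A z).det)
      (∑ σ : Equiv.Perm ι, Equiv.Perm.sign σ •
        ∑ j, (∏ l ∈ Finset.univ.erase j, A y (σ l) l) • A' (σ j) j) y := by
    simp only [Matrix.det_apply]
    exact HasFDerivAt.fun_sum fun σ _ =>
      (HasFDerivAt.finsetProd (g := fun i z => A z (σ i) i) fun i _ => hA (σ i) i).const_smul _
  convert h1 using 1
  ext v
  -- By Cramer's rule each summand is the determinant with its `j`-th column differentiated, which
  -- is what the product rule in the Leibniz formula yields.
  have h2 : ∀ j, ∑ i, (A y).adjugate j i * A' i j v =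
      ((A y).updateCol j fun i => A' i j v).det := by
    intro j
    rw [← Matrix.cramer_apply, Matrix.cramer_eq_adjugate_mulVec]
    rfl
  simp only [sum_apply, smul_apply, smul_eq_mul, h2,
    Matrix.det_apply, Finset.smul_sum]
  rw [Finset.sum_comm]
  refine Finset.sum_congr rfl fun σ _ => Finset.sum_congr rfl fun j _ => ?_
  rw [← Finset.mul_prod_erase Finset.univ _ (Finset.mem_univ j), Matrix.updateCol_self, mul_comm]
  congr 2
  exact Finset.prod_congr rfl fun l hl => by
    rw [Matrix.updateCol_ne (Finset.ne_of_mem_erase hl)]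

variable (b : Module.Basis ι ℝ F)

/-- The Jacobian matrix of `ψ` in the basis `b`. -/
def jacobianMatrix (ψ : F → F) (y : F) : Matrix ι ι ℝ :=
  Matrix.of fun i j => b.repr (fderiv ℝ ψ y (b j)) i

variable {b}

theorem fderiv_comp_basis {ψ : F → F} {f : F → ℝ} {y : F} (hψ : DifferentiableAt ℝ ψ y)
    (hf : DifferentiableAt ℝ f (ψ y)) (i : ι) :
    fderiv ℝ (f ∘ ψ) y (b i) = ∑ l, fderiv ℝ f (ψ y) (b l) * jacobianMatrix b ψ y l i := by
  rw [fderiv_comp y hf hψ, ContinuousLinearMap.comp_apply]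
  conv_lhs => rw [← b.sum_repr (fderiv ℝ ψ y (b i))]
  simp only [map_sum, map_smul, smul_eq_mul, jacobianMatrix, Matrix.of_apply]
  exact Finset.sum_congr rfl fun l _ => mul_comm _ _

variable [FiniteDimensional ℝ F]

theorem contDiffAt_jacobianMatrix {ψ : F → F} {y : F} (hψ : ContDiffAt ℝ ∞ ψ y) (i j : ι) :
    ContDiffAt ℝ ∞ (fun z => jacobianMatrix b ψ z i j) y := by
  have h1 : ContDiffAt ℝ ∞ (fun z => fderiv ℝ ψ z (b j)) y :=
    (hψ.fderiv_right (m := ∞) (by simp)).clm_apply contDiffAt_const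
  exact ((LinearMap.toContinuousLinearMap (b.coord i)).contDiff.contDiffAt).comp y h1

theorem fderiv_jacobianMatrix_symm {ψ : F → F} {y : F} (hψ : ContDiffAt ℝ ∞ ψ y) (a i c : ι) :
    fderiv ℝ (fun z => jacobianMatrix b ψ z a c) y (b i) =
      fderiv ℝ (fun z => jacobianMatrix b ψ z a i) y (b c) := by
  have h1 : ∀ i c, fderiv ℝ (fun z => jacobianMatrix b ψ z a c) y (b i) =
      b.coord a (fderiv ℝ (fderiv ℝ ψ) y (b i) (b c)) := by
    intro i c
    have h2 : DifferentiableAt ℝ (fderiv ℝ ψ) y :=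
      (hψ.fderiv_right (m := ∞) (by simp)).differentiableAt (by simp)
    have h3 : HasFDerivAt (fun z => fderiv ℝ ψ z (b c))
        ((fderiv ℝ (fderiv ℝ ψ) y).flip (b c)) y := by
      simpa using h2.hasFDerivAt.clm_apply (hasFDerivAt_const (b c) y)
    have h4 := ((LinearMap.toContinuousLinearMap (b.coord a)).hasFDerivAt).comp y h3
    have h5 : fderiv ℝ (fun z => jacobianMatrix b ψ z a c) y = _ := h4.fderiv
    rw [h5]
    rfl
  rw [h1, h1]
  congr 1
  exact (hψ.isSymmSndFDerivAt (by
    rw [minSmoothness_of_isRCLikeNormedField]; exact WithTop.coe_le_coe.mpr le_top)) _ _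

/-- The Piola identity: the divergence of the pull-back of a vector density. -/
theorem sum_fderiv_adjugate_mul {ψ : F → F} {y : F} (hψ : ContDiffAt ℝ ∞ ψ y)
    (hJ : (jacobianMatrix b ψ y).det ≠ 0) {W : ι → F → ℝ}
    (hW : ∀ j, DifferentiableAt ℝ (W j) (ψ y)) :
    ∑ i, fderiv ℝ (fun z => ∑ j, (jacobianMatrix b ψ z).adjugate i j * W j (ψ z)) y (b i) =
      (jacobianMatrix b ψ y).det * ∑ j, fderiv ℝ (W j) (ψ y) (b j) := by
  set J := jacobianMatrix b ψ with hJdef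
  have hJs : ∀ i j, DifferentiableAt ℝ (fun z => J z i j) y := fun i j =>
    (contDiffAt_jacobianMatrix hψ i j).differentiableAt (by simp)
  have hadj : ∀ i j, DifferentiableAt ℝ (fun z => (J z).adjugate i j) y := fun i j =>
    (contDiffAt_adjugate (contDiffAt_jacobianMatrix hψ) i j).differentiableAt (by simp)
  have hψd : DifferentiableAt ℝ ψ y := hψ.differentiableAt (by simp)
  have hWψ : ∀ j, DifferentiableAt ℝ (fun z => W j (ψ z)) y := fun j => (hW j).comp y hψd
  have hdet := hasFDerivAt_det fun i j => (hJs i j).hasFDerivAt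
  -- the divergence of the rows of the adjugate matrix vanishes
  have hq : ∀ j, ∑ i, fderiv ℝ (fun z => (J z).adjugate i j) y (b i) = 0 := by
    set q : ι → ℝ := fun j => ∑ i, fderiv ℝ (fun z => (J z).adjugate i j) y (b i) with hqdef
    suffices h : Matrix.vecMul q (J y) = 0 from
      -- Since `J` is invertible, it is enough that the row vector `q` of divergences satisfies `q J
      -- = 0`; this comes from differentiating `adj(J) J = det J · 1`.
      fun j => congrFun (Matrix.eq_zero_of_vecMul_eq_zero hJ h) j
    funext c
    have h1 : ∀ i, ∑ j, (fderiv ℝ (fun z => (J z).adjugate i j) y (b i) * J y j c +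
        (J y).adjugate i j * fderiv ℝ (fun z => J z j c) y (b i)) =
        if i = c then fderiv ℝ (fun z => (J z).det) y (b i) else 0 := by
      intro i
      have h2 : HasFDerivAt (fun z => ∑ j, (J z).adjugate i j * J z j c)
          (∑ j, ((J y).adjugate i j • fderiv ℝ (fun z => J z j c) y +
            J y j c • fderiv ℝ (fun z => (J z).adjugate i j) y)) y :=
        HasFDerivAt.fun_sum fun j _ => (hadj i j).hasFDerivAt.mul (hJs j c).hasFDerivAt
      have h3 : (fun z => ∑ j, (J z).adjugate i j * J z j c) =
          fun z => if i = c then (J z).det else 0 := by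
        funext z
        have := congrFun (congrFun (Matrix.adjugate_mul (J z)) i) c
        rw [Matrix.mul_apply] at this
        rw [this, Matrix.smul_apply, Matrix.one_apply]
        simp
      have h4 := congrArg (fun T : F →L[ℝ] ℝ => T (b i)) h2.fderiv
      rw [h3] at h4
      have h5 : (fderiv ℝ (fun z => if i = c then (J z).det else 0) y) (b i) =
          if i = c then fderiv ℝ (fun z => (J z).det) y (b i) else 0 := by
        split_ifs <;> simp
      rw [← h5, h4]
      simp only [sum_apply, add_apply,
        smul_apply, smul_eq_mul]
      exact Finset.sum_congr rfl fun j _ => by ring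
    have h6 := Finset.sum_congr (rfl : (Finset.univ : Finset ι) = _) fun i _ => h1 i
    simp only [Finset.sum_ite_eq', Finset.mem_univ, if_true, hdet.fderiv,
      sum_apply, smul_apply, smul_eq_mul,
      Finset.sum_add_distrib] at h6
    -- By the symmetry of second derivatives this sum is Jacobi's expression for `∂_c det J`, which
    -- cancels the right-hand side of `h6`.
    have h7 : ∑ i, ∑ j, (J y).adjugate i j * fderiv ℝ (fun z => J z j c) y (b i) =
        ∑ i, ∑ j, (J y).adjugate i j * fderiv ℝ (fun z => J z j i) y (b c) :=
      Finset.sum_congr rfl fun i _ => Finset.sum_congr rfl fun j _ => by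
        rw [hJdef, fderiv_jacobianMatrix_symm hψ]
    rw [h7, add_eq_right, Finset.sum_comm] at h6
    simpa only [Matrix.vecMul, dotProduct, hqdef, Finset.sum_mul, Pi.zero_apply] using h6
  have h8 : ∀ i, fderiv ℝ (fun z => ∑ j, (J z).adjugate i j * W j (ψ z)) y (b i) =
      ∑ j, (fderiv ℝ (fun z => (J z).adjugate i j) y (b i) * W j (ψ y) +
        ∑ l, fderiv ℝ (W j) (ψ y) (b l) * (J y l i * (J y).adjugate i j)) := by
    intro i
    have h2 : HasFDerivAt (fun z => ∑ j, (J z).adjugate i j * W j (ψ z))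
          (∑ j, ((J y).adjugate i j • fderiv ℝ (fun z => W j (ψ z)) y +
            W j (ψ y) • fderiv ℝ (fun z => (J z).adjugate i j) y)) y :=
        HasFDerivAt.fun_sum fun j _ => (hadj i j).hasFDerivAt.mul (hWψ j).hasFDerivAt
    rw [h2.fderiv]
    simp only [sum_apply, add_apply,
        smul_apply, smul_eq_mul]
    refine Finset.sum_congr rfl fun j _ => ?_
    have h9 := fderiv_comp_basis (b := b) hψd (hW j) i
    rw [Function.comp_def] at h9
    rw [h9, Finset.mul_sum, add_comm, mul_comm]
    congr 1
    exact Finset.sum_congr rfl fun l _ => by ring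
  have h10 : ∀ l j, ∑ i, J y l i * (J y).adjugate i j = if l = j then (J y).det else 0 := by
    intro l j
    have := congrFun (congrFun (Matrix.mul_adjugate (J y)) l) j
    rw [Matrix.mul_apply] at this
    rw [this, Matrix.smul_apply, Matrix.one_apply]
    simp
  simp only [h8, Finset.sum_add_distrib]
  rw [Finset.sum_comm]
  simp only [← Finset.sum_mul, hq, zero_mul, Finset.sum_const_zero, zero_add]
  rw [Finset.sum_comm, Finset.mul_sum]
  refine Finset.sum_congr rfl fun j _ => ?_
  rw [Finset.sum_comm]
  simp only [← Finset.mul_sum, h10]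
  simp [mul_comm]

variable (b) in
/-- The Laplacian of the metric with components `G` in linear coordinates. -/
def coordLaplacian (G : F → Matrix ι ι ℝ) (u : F → ℝ) (y : F) : ℝ :=
  (Real.sqrt |(G y).det|)⁻¹ * ∑ i, ∑ j,
    fderiv ℝ (fun y => Real.sqrt |(G y).det| * (G y)⁻¹ i j * fderiv ℝ u y (b j)) y (b i)

theorem coordLaplacian_congr {G G' : F → Matrix ι ι ℝ} {u u' : F → ℝ} {y : F}
    (hG : G =ᶠ[𝓝 y] G') (hu : u =ᶠ[𝓝 y] u') :
    coordLaplacian b G u y = coordLaplacian b G' u' y := by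
  have h : ∀ i j, fderiv ℝ (fun y => Real.sqrt |(G y).det| * (G y)⁻¹ i j * fderiv ℝ u y (b j)) y =
      fderiv ℝ (fun y => Real.sqrt |(G' y).det| * (G' y)⁻¹ i j * fderiv ℝ u' y (b j)) y := by
    intro i j
    refine Filter.EventuallyEq.fderiv_eq ?_
    filter_upwards [hG, hu.fderiv (𝕜 := ℝ)] with z hz hz'
    rw [hz, hz']
  simp only [coordLaplacian, h, hG.eq_of_nhds]

theorem contDiffAt_gradient {G : F → Matrix ι ι ℝ} {u : F → ℝ} {y : F}
    (hG : ∀ i j, ContDiffAt ℝ ∞ (fun z => G z i j) y) (hdet : (G y).det ≠ 0)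
    (hu : ContDiffAt ℝ ∞ u y) (i j : ι) :
    ContDiffAt ℝ ∞ (fun z => Real.sqrt |(G z).det| * (G z)⁻¹ i j * fderiv ℝ u z (b j)) y :=
  ((contDiffAt_sqrt_abs_det hG hdet).mul (contDiffAt_inv_apply hG hdet i j)).mul
    ((hu.fderiv_right (m := ∞) (by simp)).clm_apply contDiffAt_const)

/-- Exhibits the Laplacian as the divergence of a single vector density, the form to which the Piola
identity applies. -/
theorem coordLaplacian_eq {G : F → Matrix ι ι ℝ} {u : F → ℝ} {y : F}
    (hG : ∀ i j, ContDiffAt ℝ ∞ (fun z => G z i j) y) (hdet : (G y).det ≠ 0)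
    (hu : ContDiffAt ℝ ∞ u y) :
    coordLaplacian b G u y = (Real.sqrt |(G y).det|)⁻¹ * ∑ i,
      fderiv ℝ (fun z => ∑ j, Real.sqrt |(G z).det| * (G z)⁻¹ i j * fderiv ℝ u z (b j)) y (b i) := by
  have h : ∀ i, fderiv ℝ
      (fun z => ∑ j, Real.sqrt |(G z).det| * (G z)⁻¹ i j * fderiv ℝ u z (b j)) y =
      ∑ j, fderiv ℝ (fun z => Real.sqrt |(G z).det| * (G z)⁻¹ i j * fderiv ℝ u z (b j)) y :=
    fun i => fderiv_fun_sum fun j _ =>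
      (contDiffAt_gradient hG hdet hu i j).differentiableAt (by simp)
  simp only [h, coordLaplacian, sum_apply]

/-- The Laplacian does not depend on the coordinates. -/
theorem coordLaplacian_comp {ψ : F → F} {y : F} (hψ : ContDiffAt ℝ ∞ ψ y)
    (hJ : (jacobianMatrix b ψ y).det ≠ 0) {G G' : F → Matrix ι ι ℝ} {u u' : F → ℝ}
    (hG' : ∀ i j, ContDiffAt ℝ ∞ (fun z => G' z i j) (ψ y)) (hdet : (G' (ψ y)).det ≠ 0)
    (hu' : ContDiffAt ℝ ∞ u' (ψ y))
    (hG : ∀ᶠ z in 𝓝 y, G z = (jacobianMatrix b ψ z).transpose * G' (ψ z) * jacobianMatrix b ψ z)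
    (hu : u =ᶠ[𝓝 y] u' ∘ ψ) :
    coordLaplacian b G u y = coordLaplacian b G' u' (ψ y) := by
  set J := jacobianMatrix b ψ with hJdef
  have hJc : ContinuousAt (fun z => (J z).det) y :=
    (contDiffAt_det (contDiffAt_jacobianMatrix hψ)).continuousAt
  have hJne : ∀ᶠ z in 𝓝 y, (J z).det ≠ 0 := hJc.eventually_ne hJ
  have hdetG : (G y).det ≠ 0 := by
    rw [hG.self_of_nhds, Matrix.det_mul, Matrix.det_mul, Matrix.det_transpose]
    exact mul_ne_zero (mul_ne_zero hJ hdet) hJ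
  have hψd : ∀ᶠ z in 𝓝 y, DifferentiableAt ℝ ψ z := by
    filter_upwards [(hψ.of_le (m := 1) (by simp)).eventually (by simp)] with z hz
    exact hz.differentiableAt (by simp)
  have hu'd : ∀ᶠ z in 𝓝 y, DifferentiableAt ℝ u' (ψ z) := by
    have : ∀ᶠ z in 𝓝 (ψ y), DifferentiableAt ℝ u' z := by
      filter_upwards [(hu'.of_le (m := 1) (by simp)).eventually (by simp)] with z hz
      exact hz.differentiableAt (by simp)
    exact hψ.continuousAt.eventually this
  have hG'd : ∀ᶠ z in 𝓝 y, (G' (ψ z)).det ≠ 0 :=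
    (hψ.continuousAt.eventually ((contDiffAt_det hG').continuousAt.eventually_ne hdet))
  have hGs : ∀ i j, ContDiffAt ℝ ∞ (fun z => G z i j) y := by
    intro i j
    have : ContDiffAt ℝ ∞ (fun z => ((J z).transpose * G' (ψ z) * J z) i j) y := by
      simp only [Matrix.mul_apply, Matrix.transpose_apply]
      refine ContDiffAt.sum fun a _ => ContDiffAt.mul (ContDiffAt.sum fun c _ => ContDiffAt.mul ?_ ?_) ?_
      · exact contDiffAt_jacobianMatrix hψ _ _
      · exact (hG' c a).comp y hψ
      · exact contDiffAt_jacobianMatrix hψ _ _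
    refine this.congr_of_eventuallyEq ?_
    filter_upwards [hG] with z hz
    rw [hz]
  have hus : ContDiffAt ℝ ∞ u y := (hu'.comp y hψ).congr_of_eventuallyEq hu
  set W : ι → F → ℝ := fun j z =>
    ∑ l, Real.sqrt |(G' z).det| * (G' z)⁻¹ j l * fderiv ℝ u' z (b l) with hW
  have hWd : ∀ j, DifferentiableAt ℝ (W j) (ψ y) := fun j =>
    DifferentiableAt.fun_sum fun l _ =>
      (contDiffAt_gradient hG' hdet hu' j l).differentiableAt (by simp)
  -- The sign of `det J` is locally constant, so the absolute value can be taken out of the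
  -- derivative as the constant `s`.
  obtain ⟨s, hs, hs1⟩ : ∃ s : ℝ, (∀ᶠ z in 𝓝 y, |(J z).det| = s * (J z).det) ∧ s * s = 1 := by
    rcases lt_or_gt_of_ne hJ with h | h
    · refine ⟨-1, ?_, by norm_num⟩
      filter_upwards [hJc.eventually_lt continuousAt_const h] with z hz
      rw [abs_of_neg hz, neg_one_mul]
    · refine ⟨1, ?_, by norm_num⟩
      filter_upwards [(continuousAt_const (y := (0 : ℝ))).eventually_lt hJc h] with z hz
      rw [abs_of_pos hz, one_mul]
  have hsqrt : ∀ᶠ z in 𝓝 y,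
      Real.sqrt |(G z).det| = |(J z).det| * Real.sqrt |(G' (ψ z)).det| := by
    filter_upwards [hG] with z hz
    rw [hz, Matrix.det_mul, Matrix.det_mul, Matrix.det_transpose, abs_mul, abs_mul,
      mul_right_comm, Real.sqrt_mul (by positivity), Real.sqrt_mul_self (abs_nonneg _)]
  -- The gradient density transforms by `adj(J)`: the factor `|det J|` from the volume combines with
  -- `J⁻¹` from the inverse metric.
  have hflux : ∀ i, (fun z => ∑ j, Real.sqrt |(G z).det| * (G z)⁻¹ i j * fderiv ℝ u z (b j))
      =ᶠ[𝓝 y] fun z => s * ∑ j, (J z).adjugate i j * W j (ψ z) := by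
    intro i
    filter_upwards [hsqrt, hG, hs, hJne, hψd, hu'd, hu.fderiv (𝕜 := ℝ), hG'd] with z z1 z2 z3 z4 z5 z6 z7 z8
    have d1 : (fun j => fderiv ℝ u z (b j)) =
        (J z).transpose.mulVec fun l => fderiv ℝ u' (ψ z) (b l) := by
      funext j
      rw [z7, fderiv_comp_basis z5 z6]
      exact Finset.sum_congr rfl fun l _ => mul_comm _ _
    have d2 : (G z)⁻¹.mulVec (fun j => fderiv ℝ u z (b j)) =
        (J z)⁻¹.mulVec ((G' (ψ z))⁻¹.mulVec fun l => fderiv ℝ u' (ψ z) (b l)) := by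
      rw [d1, z2, Matrix.mul_inv_rev, Matrix.mul_inv_rev, Matrix.mulVec_mulVec,
        Matrix.mulVec_mulVec, Matrix.mul_assoc, Matrix.mul_assoc, Matrix.nonsing_inv_mul _ (by
          rw [Matrix.det_transpose]; exact isUnit_iff_ne_zero.mpr z4), Matrix.mul_one]
    have d3 : ∑ j, Real.sqrt |(G z).det| * (G z)⁻¹ i j * fderiv ℝ u z (b j) =
        Real.sqrt |(G z).det| * (G z)⁻¹.mulVec (fun j => fderiv ℝ u z (b j)) i := by
      simp only [Matrix.mulVec, dotProduct, Finset.mul_sum, mul_assoc]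
    have d4 : ∀ j, W j (ψ z) = Real.sqrt |(G' (ψ z)).det| *
        (G' (ψ z))⁻¹.mulVec (fun l => fderiv ℝ u' (ψ z) (b l)) j := by
      intro j
      simp only [hW, Matrix.mulVec, dotProduct, Finset.mul_sum, mul_assoc]
    rw [d3, d2, z1, z3, Matrix.inv_def, Ring.inverse_eq_inv', Matrix.smul_mulVec]
    simp only [d4, Pi.smul_apply, smul_eq_mul]
    have d5 : ∀ X : ι → ℝ, ∑ j, (J z).adjugate i j * (Real.sqrt |(G' (ψ z)).det| * X j) =
        Real.sqrt |(G' (ψ z)).det| * (J z).adjugate.mulVec X i := by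
      intro X
      simp only [Matrix.mulVec, dotProduct, Finset.mul_sum]
      exact Finset.sum_congr rfl fun j _ => by ring
    rw [d5]
    field_simp
  rw [coordLaplacian_eq hGs hdetG hus, coordLaplacian_eq hG' hdet hu', hsqrt.self_of_nhds]
  have h1 : ∀ i, fderiv ℝ
      (fun z => ∑ j, Real.sqrt |(G z).det| * (G z)⁻¹ i j * fderiv ℝ u z (b j)) y (b i) =
      s * fderiv ℝ (fun z => ∑ j, (J z).adjugate i j * W j (ψ z)) y (b i) := by
    intro i
    rw [(hflux i).fderiv_eq, fderiv_const_mul]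
    · rfl
    · exact DifferentiableAt.fun_sum fun j _ =>
        ((contDiffAt_adjugate (contDiffAt_jacobianMatrix hψ) i j).differentiableAt (by simp)).mul
          ((hWd j).comp y hψd.self_of_nhds)
  simp only [h1, ← Finset.mul_sum]
  rw [sum_fderiv_adjugate_mul hψ hJ hWd, ← mul_assoc s, ← hs.self_of_nhds, mul_inv]
  have h2 : |(J y).det| ≠ 0 := abs_ne_zero.mpr hJ
  field_simp
  rfl

end CoordinateLaplacian

/-! ### Components of a metric under changes of charts. -/

section Charts

open Filter Topology

variable {E : Type*} [NormedAddCommGroup E] [NormedSpace ℝ E]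
  {H : Type*} [TopologicalSpace H] {I : ModelWithCorners ℝ E H}
  {M : Type*} [TopologicalSpace M] [ChartedSpace H M]

/-- Every tangent space unfolds to `E`, so stating this for vectors of `E` allows the base point to
be changed without transport between fibres. -/
theorem BilinField.apply_congr (g : BilinField I (M := M)) {p q : M} (h : p = q) {v w v' w' : E}
    (hv : v = v') (hw : w = w') :
    (g p : E →L[ℝ] E →L[ℝ] ℝ) v w = (g q : E →L[ℝ] E →L[ℝ] ℝ) v' w' := by
  subst h hv hw; rfl

variable [I.Boundaryless]

theorem contMDiffAt_extend_symm {e : OpenPartialHomeomorph M H}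
    (he : e ∈ IsManifold.maximalAtlas I ∞ M) {y : E} (hy : y ∈ (e.extend I).target) :
    ContMDiffAt 𝓘(ℝ, E) I ∞ (e.extend I).symm y := by
  have h := contMDiffOn_extend_symm (I := I) he
  rw [← OpenPartialHomeomorph.extend_target'] at h
  exact h.contMDiffAt ((e.isOpen_extend_target).mem_nhds hy)

theorem contDiffAt_transition {e e' : OpenPartialHomeomorph M H}
    (he : e ∈ IsManifold.maximalAtlas I ∞ M) (he' : e' ∈ IsManifold.maximalAtlas I ∞ M) {y : E}
    (hy : y ∈ (e.extend I).target) (hy' : (e.extend I).symm y ∈ e'.source) :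
    ContDiffAt ℝ ∞ (e'.extend I ∘ (e.extend I).symm) y :=
  ((e'.contMDiffAt_extend he' hy').comp y (contMDiffAt_extend_symm he hy)).contDiffAt

/-- The chain rule for `e⁻¹ = e'⁻¹ ∘ ψ` near `y`, with `ψ` the transition map. -/
theorem mfderiv_extend_symm {e e' : OpenPartialHomeomorph M H}
    (he : e ∈ IsManifold.maximalAtlas I ∞ M) (he' : e' ∈ IsManifold.maximalAtlas I ∞ M) {y : E}
    (hy : y ∈ (e.extend I).target) (hy' : (e.extend I).symm y ∈ e'.source) (v : E) :
    (mfderiv 𝓘(ℝ, E) I (e.extend I).symm y v : E) =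
      mfderiv 𝓘(ℝ, E) I (e'.extend I).symm ((e'.extend I ∘ (e.extend I).symm) y)
        (fderiv ℝ (e'.extend I ∘ (e.extend I).symm) y v) := by
  have hψ := contDiffAt_transition he he' hy hy'
  have hψy : (e'.extend I ∘ (e.extend I).symm) y ∈ (e'.extend I).target :=
    (e'.extend I).map_source (by rwa [e'.extend_source])
  have hev : (e.extend I).symm =ᶠ[𝓝 y] (e'.extend I).symm ∘ (e'.extend I ∘ (e.extend I).symm) := by
    have h1 : ∀ᶠ z in 𝓝 y, (e.extend I).symm z ∈ e'.source :=
      (contMDiffAt_extend_symm he hy).continuousAt.eventually (e'.open_source.mem_nhds hy')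
    filter_upwards [h1] with z hz
    exact ((e'.extend I).left_inv (by rwa [e'.extend_source])).symm
  have h2 := mfderiv_comp (I := 𝓘(ℝ, E)) (I' := 𝓘(ℝ, E)) (I'' := I) y
    ((contMDiffAt_extend_symm he' hψy).mdifferentiableAt (by simp))
    (hψ.differentiableAt (by simp)).mdifferentiableAt
  have h3 : (mfderiv 𝓘(ℝ, E) I (e.extend I).symm y : E →L[ℝ] E) =
      mfderiv 𝓘(ℝ, E) I ((e'.extend I).symm ∘ (e'.extend I ∘ (e.extend I).symm)) y :=
    hev.mfderiv_eq
  rw [mfderiv_eq_fderiv] at h2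
  exact (congrArg (fun T : E →L[ℝ] E => T v) h3).trans
    (congrArg (fun T : E →L[ℝ] E => T v) h2)

variable {ι : Type*} [Fintype ι] [DecidableEq ι] {b : Module.Basis ι ℝ E}

set_option linter.unusedSectionVars false in
/-- The transformation of the components of a bilinear form under a change of charts. -/
theorem gram_transform (g : BilinField I (M := M)) {e e' : OpenPartialHomeomorph M H}
    (he : e ∈ IsManifold.maximalAtlas I ∞ M) (he' : e' ∈ IsManifold.maximalAtlas I ∞ M) {y : E}
    (hy : y ∈ (e.extend I).target) (hy' : (e.extend I).symm y ∈ e'.source) :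
    gram b g e y =
      (jacobianMatrix b (e'.extend I ∘ (e.extend I).symm) y).transpose *
        gram b g e' ((e'.extend I ∘ (e.extend I).symm) y) *
        jacobianMatrix b (e'.extend I ∘ (e.extend I).symm) y := by
  set ψ := e'.extend I ∘ (e.extend I).symm with hψ
  have hp : (e.extend I).symm y = (e'.extend I).symm (ψ y) :=
    ((e'.extend I).left_inv (by rwa [e'.extend_source])).symm
  set T : E →L[ℝ] E := mfderiv 𝓘(ℝ, E) I (e'.extend I).symm (ψ y) with hT
  set B : E →L[ℝ] E →L[ℝ] ℝ := g ((e'.extend I).symm (ψ y)) with hB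
  have h1 : ∀ v w : E, (g ((e.extend I).symm y) : E →L[ℝ] E →L[ℝ] ℝ)
      (mfderiv 𝓘(ℝ, E) I (e.extend I).symm y v) (mfderiv 𝓘(ℝ, E) I (e.extend I).symm y w) =
      B (T (fderiv ℝ ψ y v)) (T (fderiv ℝ ψ y w)) := fun v w =>
    g.apply_congr hp (mfderiv_extend_symm he he' hy hy' v) (mfderiv_extend_symm he he' hy hy' w)
  have h2 : ∀ i, fderiv ℝ ψ y (b i) = ∑ a, jacobianMatrix b ψ y a i • b a := fun i =>
    (b.sum_repr (fderiv ℝ ψ y (b i))).symm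
  ext i j
  have h3 : gram b g e y i j = B (T (fderiv ℝ ψ y (b i))) (T (fderiv ℝ ψ y (b j))) := h1 _ _
  have h4 : ∀ a c, gram b g e' (ψ y) a c = B (T (b a)) (T (b c)) := fun a c => rfl
  rw [h3, h2, h2]
  simp only [map_sum, map_smul, sum_apply, smul_apply, smul_eq_mul, Matrix.mul_apply,
    Matrix.transpose_apply, h4, Finset.sum_mul, Finset.mul_sum]
  exact Finset.sum_congr rfl fun a _ => Finset.sum_congr rfl fun c _ => by ring

theorem jacobianMatrix_eq_toMatrix (ψ : E → E) (y : E) :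
    jacobianMatrix b ψ y = LinearMap.toMatrix b b (fderiv ℝ ψ y : E →ₗ[ℝ] E) := by
  ext i j
  rw [LinearMap.toMatrix_apply]
  rfl

theorem det_jacobianMatrix (ψ : E → E) (y : E) :
    (jacobianMatrix b ψ y).det = (fderiv ℝ ψ y).det := by
  rw [jacobianMatrix_eq_toMatrix, LinearMap.det_toMatrix]

set_option linter.unusedSectionVars false in
theorem det_jacobianMatrix_transition_ne_zero {e e' : OpenPartialHomeomorph M H}
    (he : e ∈ IsManifold.maximalAtlas I ∞ M) (he' : e' ∈ IsManifold.maximalAtlas I ∞ M) {y : E}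
    (hy : y ∈ (e.extend I).target) (hy' : (e.extend I).symm y ∈ e'.source) :
    (jacobianMatrix b (e'.extend I ∘ (e.extend I).symm) y).det ≠ 0 := by
  set ψ := e'.extend I ∘ (e.extend I).symm with hψdef
  set φ := e.extend I ∘ (e'.extend I).symm with hφdef
  have hψ := contDiffAt_transition he he' hy hy'
  have hψy : ψ y ∈ (e'.extend I).target :=
    (e'.extend I).map_source (by rwa [e'.extend_source])
  have hsymm : (e'.extend I).symm (ψ y) = (e.extend I).symm y :=
    (e'.extend I).left_inv (by rwa [e'.extend_source])
  have hye : (e.extend I).symm y ∈ e.source := by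
    rw [← e.extend_source (I := I)]; exact (e.extend I).map_target hy
  have hφ : ContDiffAt ℝ ∞ φ (ψ y) :=
    contDiffAt_transition he' he hψy (by rw [hsymm]; exact hye)
  have hev : φ ∘ ψ =ᶠ[𝓝 y] id := by
    have h1 : ∀ᶠ z in 𝓝 y, (e.extend I).symm z ∈ e'.source :=
      (contMDiffAt_extend_symm he hy).continuousAt.eventually (e'.open_source.mem_nhds hy')
    filter_upwards [h1, (e.isOpen_extend_target (I := I)).mem_nhds hy] with z hz hz'
    have h2 : (e'.extend I).symm (ψ z) = (e.extend I).symm z :=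
      (e'.extend I).left_inv (by rwa [e'.extend_source])
    simp only [Function.comp_apply, hφdef, h2, id]
    exact (e.extend I).right_inv hz'
  have h3 := hev.fderiv_eq (𝕜 := ℝ)
  rw [fderiv_comp y (hφ.differentiableAt (by simp)) (hψ.differentiableAt (by simp)), fderiv_id] at h3
  rw [det_jacobianMatrix]
  intro h0
  have h4 := congrArg ContinuousLinearMap.det h3
  have h5 : ((fderiv ℝ φ (ψ y)).comp (fderiv ℝ ψ y)).det =
      (fderiv ℝ φ (ψ y)).det * (fderiv ℝ ψ y).det := LinearMap.det_comp _ _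
  rw [h5, h0, mul_zero] at h4
  have h6 : (ContinuousLinearMap.id ℝ E).det = 1 := LinearMap.det_id
  rw [h6] at h4
  exact zero_ne_one h4

/-- The Laplacian can be computed in any chart. -/
theorem laplacian_eq_coordLaplacian [FiniteDimensional ℝ E] [IsManifold I ∞ M]
    (g : BilinField I (M := M)) {e : OpenPartialHomeomorph M H}
    (he : e ∈ IsManifold.maximalAtlas I ∞ M) {p : M} (hp : p ∈ e.source)
    (hG : ∀ i j, ContDiffAt ℝ ∞ (fun y => gram b g (chartAt H p) y i j) (extChartAt I p p))
    (hdet : (gram b g (chartAt H p) (extChartAt I p p)).det ≠ 0)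
    {u : M → ℝ} (hu : ContMDiffAt I 𝓘(ℝ, ℝ) ∞ u p) :
    laplacian b g u p =
      coordLaplacian b (gram b g e) (u ∘ (e.extend I).symm) (e.extend I p) := by
  have he' : chartAt H p ∈ IsManifold.maximalAtlas I ∞ M :=
    IsManifold.chart_mem_maximalAtlas p
  set e' := chartAt H p
  set y := e.extend I p with hy
  have hps : p ∈ (e.extend I).source := by rwa [e.extend_source]
  have hyt : y ∈ (e.extend I).target := (e.extend I).map_source hps
  have hyp : (e.extend I).symm y = p := (e.extend I).left_inv hps
  have hpe' : p ∈ e'.source := mem_chart_source H p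
  have hy' : (e.extend I).symm y ∈ e'.source := by rw [hyp]; exact hpe'
  set ψ := e'.extend I ∘ (e.extend I).symm with hψdef
  have hψy : ψ y = extChartAt I p p := by
    simp only [hψdef, Function.comp_apply, hyp]; rfl
  have hnear : ∀ᶠ z in 𝓝 y, z ∈ (e.extend I).target ∧ (e.extend I).symm z ∈ e'.source :=
    Filter.Eventually.and ((e.isOpen_extend_target (I := I)).mem_nhds hyt)
      ((contMDiffAt_extend_symm he hyt).continuousAt.eventually (e'.open_source.mem_nhds hy'))
  have hpt : extChartAt I p p ∈ (e'.extend I).target := mem_extChartAt_target p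
  have hu' : ContDiffAt ℝ ∞ (u ∘ (e'.extend I).symm) (extChartAt I p p) := by
    have h1 : ContMDiffAt I 𝓘(ℝ, ℝ) ∞ u ((e'.extend I).symm (extChartAt I p p)) := by
      have : (e'.extend I).symm (extChartAt I p p) = p := extChartAt_to_inv p
      rwa [this]
    exact (h1.comp _ (contMDiffAt_extend_symm he' hpt)).contDiffAt
  -- `laplacian` is by definition `coordLaplacian` in the preferred chart `e'`, so regularity of the
  -- metric is needed only there.
  have h := coordLaplacian_comp (b := b) (contDiffAt_transition he he' hyt hy')
    (det_jacobianMatrix_transition_ne_zero he he' hyt hy') (G := gram b g e) (G' := gram b g e')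
    (u := u ∘ (e.extend I).symm) (u' := u ∘ (e'.extend I).symm)
    (by rw [← hψdef, hψy]; exact hG) (by rw [← hψdef, hψy]; exact hdet)
    (by rw [← hψdef, hψy]; exact hu')
    (hnear.mono fun z hz => gram_transform g he he' hz.1 hz.2)
    (hnear.mono fun z hz => by
      have h2 : (e'.extend I).symm (e'.extend I ((e.extend I).symm z)) = (e.extend I).symm z :=
        (e'.extend I).left_inv (by rw [e'.extend_source]; exact hz.2)
      simp only [Function.comp_apply, h2])
  rw [h, ← hψdef, hψy]
  rfl

end Charts

/-! ### The metrics `g_ρ` and the ambient metric in charts. -/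

section MetricFamilyCharts

set_option linter.unusedSectionVars false

open Filter Topology

variable {n : ℕ} {M : Type*} [TopologicalSpace M] [ChartedSpace (EuclideanSpace ℝ (Fin n)) M]

theorem extend_target_eq (e : OpenPartialHomeomorph M (EuclideanSpace ℝ (Fin n))) :
    (e.extend (𝓡 n)).target = e.target := by
  simp

variable [IsManifold (𝓡 n) ∞ M]

/-- Coordinate fields are images of constant fields under the tangent map of the inverse chart.
Smoothness of the components of `g_ρ` rests on this. -/
theorem contMDiffAt_coordVector {e : OpenPartialHomeomorph M (EuclideanSpace ℝ (Fin n))}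
    (he : e ∈ IsManifold.maximalAtlas (𝓡 n) ∞ M) {y : EuclideanSpace ℝ (Fin n)}
    (hy : y ∈ e.target) (v : EuclideanSpace ℝ (Fin n)) :
    ContMDiffAt 𝓘(ℝ, EuclideanSpace ℝ (Fin n)) ((𝓡 n).prod 𝓘(ℝ, EuclideanSpace ℝ (Fin n))) ∞
      (fun z => Bundle.TotalSpace.mk' (EuclideanSpace ℝ (Fin n)) (E := TangentSpace (𝓡 n))
        ((e.extend (𝓡 n)).symm z)
        (mfderiv 𝓘(ℝ, EuclideanSpace ℝ (Fin n)) (𝓡 n) (e.extend (𝓡 n)).symm z v)) y := by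
  have h1 : ContMDiffOn 𝓘(ℝ, EuclideanSpace ℝ (Fin n)) (𝓡 n) ∞ (e.extend (𝓡 n)).symm e.target := by
    have := contMDiffOn_extend_symm (I := 𝓡 n) he
    rwa [← OpenPartialHomeomorph.extend_target', extend_target_eq] at this
  have h2 := h1.contMDiffOn_tangentMapWithin (m := ∞) (by simp) e.open_target.uniqueMDiffOn
  have h3 : ContMDiff 𝓘(ℝ, EuclideanSpace ℝ (Fin n)) 𝓘(ℝ, EuclideanSpace ℝ (Fin n)).tangent ∞
      (fun z => (⟨z, v⟩ : TangentBundle 𝓘(ℝ, EuclideanSpace ℝ (Fin n))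
        (EuclideanSpace ℝ (Fin n)))) := fun z =>
    (contMDiffAt_vectorSpace_iff_contDiffAt
      (V := fun _ : EuclideanSpace ℝ (Fin n) => v)).mpr contDiffAt_const
  have h4 := h2.comp (h3.contMDiffOn (s := e.target)) fun z hz => hz
  refine (h4.contMDiffAt (e.open_target.mem_nhds hy)).congr_of_eventuallyEq ?_
  filter_upwards [e.open_target.mem_nhds hy] with z hz
  simp only [Function.comp_apply, tangentMapWithin, mfderivWithin_of_isOpen e.open_target hz]

namespace MetricFamily

variable (g : MetricFamily n M)

/-- The components of the metrics in a chart depend smoothly on the point and the parameter. -/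
theorem contDiffAt_gram {e : OpenPartialHomeomorph M (EuclideanSpace ℝ (Fin n))}
    (he : e ∈ IsManifold.maximalAtlas (𝓡 n) ∞ M) {q : EuclideanSpace ℝ (Fin n) × ℝ}
    (hy : q.1 ∈ e.target) (hρ : q.2 ∈ Ioo (-g.ε) g.ε) (i j : Fin n) :
    ContDiffAt ℝ ∞ (fun q : EuclideanSpace ℝ (Fin n) × ℝ =>
      gram (stdBasis n) (g.metric q.2) e q.1 i j) q := by
  set s := fun q : EuclideanSpace ℝ (Fin n) × ℝ => (e.extend (𝓡 n)).symm q.1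
  have hy' : q.1 ∈ (e.extend (𝓡 n)).target := by rwa [extend_target_eq]
  have hs : ContMDiffAt 𝓘(ℝ, EuclideanSpace ℝ (Fin n) × ℝ) (𝓡 n) ∞ s q :=
    (contMDiffAt_extend_symm he hy').comp q contDiff_fst.contMDiff.contMDiffAt
  have hv : ∀ v : EuclideanSpace ℝ (Fin n), ContMDiffAt 𝓘(ℝ, EuclideanSpace ℝ (Fin n) × ℝ)
      ((𝓡 n).prod 𝓘(ℝ, EuclideanSpace ℝ (Fin n))) ∞
      (fun q => Bundle.TotalSpace.mk' (EuclideanSpace ℝ (Fin n)) (E := TangentSpace (𝓡 n)) (s q)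
        (mfderiv 𝓘(ℝ, EuclideanSpace ℝ (Fin n)) (𝓡 n) (e.extend (𝓡 n)).symm q.1 v)) q := fun v =>
    (contMDiffAt_coordVector he hy v).comp q contDiff_fst.contMDiff.contMDiffAt
  have hm : ContMDiffAt (𝓘(ℝ, ℝ).prod (𝓡 n))
      ((𝓡 n).prod 𝓘(ℝ, EuclideanSpace ℝ (Fin n) →L[ℝ] EuclideanSpace ℝ (Fin n) →L[ℝ] ℝ)) ∞
      (fun q : ℝ × M => Bundle.TotalSpace.mk'
        (EuclideanSpace ℝ (Fin n) →L[ℝ] EuclideanSpace ℝ (Fin n) →L[ℝ] ℝ)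
        (E := fun x : M => TangentSpace (𝓡 n) x →L[ℝ] TangentSpace (𝓡 n) x →L[ℝ] ℝ)
        q.2 (g.metric q.1 q.2)) (q.2, s q) :=
    g.smooth.contMDiffAt ((isOpen_Ioo.prod isOpen_univ).mem_nhds ⟨hρ, mem_univ _⟩)
  have hm' := hm.comp q ((contDiff_snd.contMDiff.contMDiffAt
    (I := 𝓘(ℝ, EuclideanSpace ℝ (Fin n) × ℝ)) (n := ∞)).prodMk hs)
  have h : ContMDiffAt 𝓘(ℝ, EuclideanSpace ℝ (Fin n) × ℝ) ((𝓡 n).prod 𝓘(ℝ)) ∞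
      (fun q => Bundle.TotalSpace.mk' ℝ (E := Bundle.Trivial M ℝ) (s q)
        (g.metric q.2 (s q)
          (mfderiv 𝓘(ℝ, EuclideanSpace ℝ (Fin n)) (𝓡 n) (e.extend (𝓡 n)).symm q.1 (stdBasis n i))
          (mfderiv 𝓘(ℝ, EuclideanSpace ℝ (Fin n)) (𝓡 n) (e.extend (𝓡 n)).symm q.1
            (stdBasis n j)))) q := by
    apply ContMDiffAt.clm_bundle_apply₂ (F₁ := EuclideanSpace ℝ (Fin n))
      (F₂ := EuclideanSpace ℝ (Fin n))
    · exact hm'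
    · exact hv _
    · exact hv _
  rw [Bundle.contMDiffAt_totalSpace] at h
  exact h.2.contDiffAt

/-- A kernel vector of the component matrix would give a nonzero tangent vector orthogonal to all
others, because the differential of the inverse chart is bijective. -/
theorem gram_det_ne_zero {e : OpenPartialHomeomorph M (EuclideanSpace ℝ (Fin n))}
    (he : e ∈ IsManifold.maximalAtlas (𝓡 n) ∞ M) {y : EuclideanSpace ℝ (Fin n)}
    (hy : y ∈ e.target) {ρ : ℝ} (hρ : ρ ∈ Ioo (-g.ε) g.ε) :
    (gram (stdBasis n) (g.metric ρ) e y).det ≠ 0 := by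
  intro h0
  obtain ⟨v, hv, hv0⟩ := Matrix.exists_mulVec_eq_zero_iff.mpr h0
  set T : EuclideanSpace ℝ (Fin n) →L[ℝ] EuclideanSpace ℝ (Fin n) :=
    mfderiv 𝓘(ℝ, EuclideanSpace ℝ (Fin n)) (𝓡 n) (e.extend (𝓡 n)).symm y with hT
  have hy' : y ∈ (e.extend (𝓡 n)).target := by rwa [extend_target_eq]
  have hys : (e.extend (𝓡 n)).symm y ∈ e.source := by
    rw [← e.extend_source (I := 𝓡 n)]; exact (e.extend (𝓡 n)).map_target hy'
  have hinj : Function.Injective T := by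
    have hev : e.extend (𝓡 n) ∘ (e.extend (𝓡 n)).symm =ᶠ[𝓝 y] id := by
      filter_upwards [(e.isOpen_extend_target (I := 𝓡 n)).mem_nhds hy'] with z hz
      exact (e.extend (𝓡 n)).right_inv hz
    have h1 := mfderiv_comp (I := 𝓘(ℝ, EuclideanSpace ℝ (Fin n))) (I' := 𝓡 n)
      (I'' := 𝓘(ℝ, EuclideanSpace ℝ (Fin n))) y
      ((e.contMDiffAt_extend he hys).mdifferentiableAt (by simp))
      ((contMDiffAt_extend_symm he hy').mdifferentiableAt (by simp))
    rw [hev.mfderiv_eq, mfderiv_id] at h1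
    intro a c hac
    have h2 : ∀ a : EuclideanSpace ℝ (Fin n), a =
        mfderiv (𝓡 n) 𝓘(ℝ, EuclideanSpace ℝ (Fin n)) (e.extend (𝓡 n))
          ((e.extend (𝓡 n)).symm y) (T a) := fun a =>
      congrArg (fun S : EuclideanSpace ℝ (Fin n) →L[ℝ] EuclideanSpace ℝ (Fin n) => S a) h1
    rw [h2 a, h2 c, hac]
  have hsurj : Function.Surjective T := LinearMap.injective_iff_surjective.mp hinj
  set B : EuclideanSpace ℝ (Fin n) →L[ℝ] EuclideanSpace ℝ (Fin n) →L[ℝ] ℝ :=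
    g.metric ρ ((e.extend (𝓡 n)).symm y) with hB
  set V := ∑ j, v j • stdBasis n j with hVdef
  have h1 : ∀ i, B (T V) (T (stdBasis n i)) = 0 := by
    intro i
    have h2 := congrFun hv0 i
    have h3 : ∀ j, gram (stdBasis n) (g.metric ρ) e y i j =
        B (T (stdBasis n j)) (T (stdBasis n i)) := fun j => g.symm ρ hρ _ _ _
    simp only [Matrix.mulVec, dotProduct, h3, Pi.zero_apply] at h2
    rw [hVdef]
    simp only [map_sum, map_smul, sum_apply, smul_apply, smul_eq_mul]
    rw [← h2]
    exact Finset.sum_congr rfl fun j _ => mul_comm _ _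
  have h2 : T V = 0 := by
    refine g.nondegenerate ρ hρ ((e.extend (𝓡 n)).symm y) (T V) fun w => ?_
    obtain ⟨a, rfl⟩ := hsurj w
    change B (T V) (T a) = 0
    rw [← (stdBasis n).sum_repr a]
    simp only [map_sum, map_smul, h1, smul_zero, Finset.sum_const_zero]
  have h3 : V = 0 := hinj (h2.trans (map_zero T).symm)
  exact hv (funext fun j => linearIndependent_iff'.mp (stdBasis n).linearIndependent
    Finset.univ v h3 j (Finset.mem_univ j))

theorem gram_symm (e : OpenPartialHomeomorph M (EuclideanSpace ℝ (Fin n)))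
    (y : EuclideanSpace ℝ (Fin n)) {ρ : ℝ} (hρ : ρ ∈ Ioo (-g.ε) g.ε) (i j : Fin n) :
    gram (stdBasis n) (g.metric ρ) e y i j = gram (stdBasis n) (g.metric ρ) e y j i :=
  g.symm ρ hρ _ _ _

/-- The chart of the ambient space given by a chart of `M`. -/
abbrev ambientChart (e : OpenPartialHomeomorph M (EuclideanSpace ℝ (Fin n))) :
    OpenPartialHomeomorph (ℝ × M × ℝ) (ModelProd ℝ (ModelProd (EuclideanSpace ℝ (Fin n)) ℝ)) :=
  (OpenPartialHomeomorph.refl ℝ).prod (e.prod (OpenPartialHomeomorph.refl ℝ))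

omit [IsManifold (𝓡 n) ∞ M] in
theorem ambientChart_extend_symm (e : OpenPartialHomeomorph M (EuclideanSpace ℝ (Fin n))) :
    ⇑((ambientChart e).extend (ambientModel n)).symm =
      Prod.map id (Prod.map (e.extend (𝓡 n)).symm id) := by
  rfl

omit [IsManifold (𝓡 n) ∞ M] in
theorem ambientChart_extend (e : OpenPartialHomeomorph M (EuclideanSpace ℝ (Fin n))) (p : ℝ × M × ℝ) :
    (ambientChart e).extend (ambientModel n) p = (p.1, e p.2.1, p.2.2) := by
  simp

theorem ambientChart_mem {e : OpenPartialHomeomorph M (EuclideanSpace ℝ (Fin n))}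
    (he : e ∈ IsManifold.maximalAtlas (𝓡 n) ∞ M) :
    ambientChart e ∈ IsManifold.maximalAtlas (ambientModel n) ∞ (ℝ × M × ℝ) := by
  have h : OpenPartialHomeomorph.refl ℝ ∈ IsManifold.maximalAtlas 𝓘(ℝ, ℝ) ∞ ℝ :=
    IsManifold.chart_mem_maximalAtlas (H := ℝ) (0 : ℝ)
  exact IsManifold.mem_maximalAtlas_prod h (IsManifold.mem_maximalAtlas_prod he h)

theorem chartAt_ambient (p : ℝ × M × ℝ) :
    chartAt (ModelProd ℝ (ModelProd (EuclideanSpace ℝ (Fin n)) ℝ)) p =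
      ambientChart (chartAt (EuclideanSpace ℝ (Fin n)) p.2.1) := rfl

/-- The matrix of `2ρ dt² + 2t dt dρ + t² h`. -/
def straightMatrix (t ρ : ℝ) (h : Matrix (Fin n) (Fin n) ℝ) :
    Matrix (Unit ⊕ (Fin n ⊕ Unit)) (Unit ⊕ (Fin n ⊕ Unit)) ℝ :=
  Matrix.of fun a b => match a, b with
    | .inl _, .inl _ => 2 * ρ
    | .inl _, .inr (.inr _) => t
    | .inr (.inr _), .inl _ => t
    | .inr (.inl i), .inr (.inl j) => t ^ 2 * h i j
    | _, _ => 0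

/-- The chart is the identity in `t` and `ρ`, so its differential is block diagonal and only the
`x`-block sees `g_ρ`. -/
theorem gram_ambientMetric {e : OpenPartialHomeomorph M (EuclideanSpace ℝ (Fin n))}
    (he : e ∈ IsManifold.maximalAtlas (𝓡 n) ∞ M) {q : ℝ × EuclideanSpace ℝ (Fin n) × ℝ}
    (hy : q.2.1 ∈ e.target) :
    gram (ambientBasis n) g.ambientMetric (ambientChart e) q =
      straightMatrix q.1 q.2.2 (gram (stdBasis n) (g.metric q.2.2) e q.2.1) := by
  have hy' : q.2.1 ∈ (e.extend (𝓡 n)).target := by rwa [extend_target_eq]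
  set T : EuclideanSpace ℝ (Fin n) →L[ℝ] EuclideanSpace ℝ (Fin n) :=
    mfderiv 𝓘(ℝ, EuclideanSpace ℝ (Fin n)) (𝓡 n) (e.extend (𝓡 n)).symm q.2.1 with hT
  have h1 : HasMFDerivAt 𝓘(ℝ, EuclideanSpace ℝ (Fin n)) (𝓡 n) (e.extend (𝓡 n)).symm q.2.1 T :=
    ((contMDiffAt_extend_symm he hy').mdifferentiableAt (by simp)).hasMFDerivAt
  have h2 : (mfderiv 𝓘(ℝ, ℝ × EuclideanSpace ℝ (Fin n) × ℝ) (ambientModel n)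
      ((ambientChart e).extend (ambientModel n)).symm q :
      ℝ × EuclideanSpace ℝ (Fin n) × ℝ →L[ℝ] ℝ × EuclideanSpace ℝ (Fin n) × ℝ) =
      (ContinuousLinearMap.id ℝ ℝ).prodMap (T.prodMap (ContinuousLinearMap.id ℝ ℝ)) := by
    rw [ambientChart_extend_symm]
    have := (hasMFDerivAt_id (I := 𝓘(ℝ, ℝ)) q.1).prodMap (p := q)
      ((h1.prodMap (p := q.2) (hasMFDerivAt_id (I := 𝓘(ℝ, ℝ)) q.2.2)))
    rw [modelWithCornersSelf_prod, modelWithCornersSelf_prod, ← chartedSpaceSelf_prod,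
      ← chartedSpaceSelf_prod]
    refine this.mfderiv.trans (congrArg₂ (fun (S : ℝ →L[ℝ] ℝ) (S' : EuclideanSpace ℝ (Fin n) × ℝ →L[ℝ]
      EuclideanSpace ℝ (Fin n) × ℝ) => S.prodMap S') mfderiv_id ?_)
    exact (h1.prodMap (p := q.2) (hasMFDerivAt_id (I := 𝓘(ℝ, ℝ)) q.2.2)).mfderiv.trans
      (congrArg (fun S : ℝ →L[ℝ] ℝ => T.prodMap S) mfderiv_id)
  obtain ⟨B, hB⟩ : ∃ B : EuclideanSpace ℝ (Fin n) →L[ℝ] EuclideanSpace ℝ (Fin n) →L[ℝ] ℝ,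
      B = g.metric q.2.2 ((e.extend (𝓡 n)).symm q.2.1) := ⟨_, rfl⟩
  have h3 : ∀ v w : ℝ × EuclideanSpace ℝ (Fin n) × ℝ,
      (g.ambientMetric (((ambientChart e).extend (ambientModel n)).symm q) :
        ℝ × EuclideanSpace ℝ (Fin n) × ℝ →L[ℝ] ℝ × EuclideanSpace ℝ (Fin n) × ℝ →L[ℝ] ℝ)
      (mfderiv 𝓘(ℝ, ℝ × EuclideanSpace ℝ (Fin n) × ℝ) (ambientModel n)
      ((ambientChart e).extend (ambientModel n)).symm q v)
      (mfderiv 𝓘(ℝ, ℝ × EuclideanSpace ℝ (Fin n) × ℝ) (ambientModel n)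
      ((ambientChart e).extend (ambientModel n)).symm q w) =
      2 * q.2.2 * (v.1 * w.1) + q.1 * (v.1 * w.2.2 + v.2.2 * w.1) + q.1 ^ 2 *
        B (T v.2.1) (T w.2.1) := by
    intro v w
    rw [hB]
    refine (g.ambientMetric.apply_congr (congrFun (ambientChart_extend_symm e) q)
      (congrArg (fun S : ℝ × EuclideanSpace ℝ (Fin n) × ℝ →L[ℝ]
        ℝ × EuclideanSpace ℝ (Fin n) × ℝ => S v) h2)
      (congrArg (fun S : ℝ × EuclideanSpace ℝ (Fin n) × ℝ →L[ℝ]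
        ℝ × EuclideanSpace ℝ (Fin n) × ℝ => S w) h2)).trans ?_
    exact straightForm_apply _ _ _ _ _ _ _ _ _
  ext a c
  refine (h3 (ambientBasis n a) (ambientBasis n c)).trans ?_
  have h4 : ∀ i j, gram (stdBasis n) (g.metric q.2.2) e q.2.1 i j =
      B (T (stdBasis n i)) (T (stdBasis n j)) := fun i j => by rw [hB]; rfl
  clear_value T
  rcases a with a | a | a <;> rcases c with c | c | c <;>
    simp [straightMatrix, Module.Basis.prod_apply, h4]

end MetricFamily

end MetricFamilyCharts

/-! ### Poles along `ρ = 0` and residues. -/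

section Localization

namespace AmbientData

variable {n : ℕ} {A A' : Type*} [CommRing A] [Algebra ℝ A] [CommRing A'] [Algebra ℝ A']

/-- The restriction of a derivation to a subalgebra. -/
def restrictDerivation (D : Derivation ℝ A A) (B : Subalgebra ℝ A) (h : ∀ a ∈ B, D a ∈ B) :
    Derivation ℝ B B :=
  Derivation.mk' (((D : A →ₗ[ℝ] A).comp B.val.toLinearMap).codRestrict
    (Subalgebra.toSubmodule B) fun a => h a a.2) fun a b => by
      apply Subtype.ext
      exact D.leibniz a b

variable {𝒟 : AmbientData n A} {𝒟' : AmbientData n A'} (η : Hom 𝒟 𝒟')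

namespace Hom

/-- The fractions `a / ρ ^ N`. -/
def fractions : Subalgebra ℝ A' where
  carrier := {W | ∃ (N : ℕ) (a : A), W * 𝒟'.ρ ^ N = η.φ a}
  mul_mem' := by
    rintro V W ⟨N, a, h⟩ ⟨N', a', h'⟩
    exact ⟨N + N', a * a', by rw [map_mul, ← h, ← h']; ring⟩
  add_mem' := by
    rintro V W ⟨N, a, h⟩ ⟨N', a', h'⟩
    refine ⟨N + N', a * 𝒟.ρ ^ N' + a' * 𝒟.ρ ^ N, ?_⟩
    rw [map_add, map_mul, map_mul, map_pow, map_pow, η.ρ, ← h, ← h']; ring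
  algebraMap_mem' r := ⟨0, algebraMap ℝ A r, by simp⟩

theorem map_mem_fractions (a : A) : η.φ a ∈ η.fractions := ⟨0, a, by simp⟩

/-- The quotient rule for `W = a / ρ^N`, cleared of denominators; a derivation raises the pole order
by at most one. -/
theorem derivation_mul_pow {D : Derivation ℝ A A} {D' : Derivation ℝ A' A'}
    (hD : ∀ a, η.φ (D a) = D' (η.φ a)) {W : A'} {N : ℕ} {a : A} (h : W * 𝒟'.ρ ^ N = η.φ a) :
    D' W * 𝒟'.ρ ^ (N + 1) = η.φ (D a * 𝒟.ρ - N * a * D 𝒟.ρ) := by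
  have h1 : D' (W * 𝒟'.ρ ^ N) = D' (η.φ a) := by rw [h]
  rw [Derivation.leibniz, Derivation.leibniz_pow, ← hD] at h1
  rw [map_sub, map_mul, map_mul, map_mul, map_natCast, η.ρ, ← h1, ← h, hD, η.ρ]
  simp only [smul_eq_mul, nsmul_eq_mul]
  cases N with
  | zero => simp
  | succ N => rw [Nat.add_sub_cancel]; push_cast; ring

/-- The data on the algebra of fractions. -/
def fractionData : AmbientData n η.fractions where
  dρ := restrictDerivation 𝒟'.dρ _ fun _ ⟨N, _, h⟩ =>
    ⟨N + 1, _, η.derivation_mul_pow η.dρ h⟩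
  d i := restrictDerivation (𝒟'.d i) _ fun _ ⟨N, _, h⟩ =>
    ⟨N + 1, _, η.derivation_mul_pow (η.d i) h⟩
  ρ := ⟨𝒟'.ρ, η.ρ ▸ η.map_mem_fractions _⟩
  m := ⟨𝒟'.m, η.m ▸ η.map_mem_fractions _⟩
  m' := ⟨𝒟'.m', η.m' ▸ η.map_mem_fractions _⟩
  h i j := ⟨𝒟'.h i j, η.h i j ▸ η.map_mem_fractions _⟩
  m_mul := Subtype.ext 𝒟'.m_mul
  dρ_ρ := Subtype.ext 𝒟'.dρ_ρ
  d_ρ i := Subtype.ext (𝒟'.d_ρ i)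
  h_symm i j := Subtype.ext (𝒟'.h_symm i j)

/-- The canonical map to the algebra of fractions. -/
def toFractions : Hom 𝒟 η.fractionData where
  φ := η.φ.codRestrict _ η.map_mem_fractions
  dρ a := Subtype.ext (η.dρ a)
  d i a := Subtype.ext (η.d i a)
  ρ := Subtype.ext η.ρ
  m := Subtype.ext η.m
  m' := Subtype.ext η.m'
  h i j := Subtype.ext (η.h i j)

/-- The fractions with numerator in the ideal `K`. -/
def fractionIdeal (K : Ideal A) : Ideal η.fractions where
  carrier := {W | ∃ N : ℕ, ∃ a ∈ K, (W : A') * 𝒟'.ρ ^ N = η.φ a}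
  zero_mem' := ⟨0, 0, K.zero_mem, by simp⟩
  add_mem' := by
    rintro V W ⟨N, a, ha, h⟩ ⟨N', a', ha', h'⟩
    refine ⟨N + N', a * 𝒟.ρ ^ N' + a' * 𝒟.ρ ^ N,
      K.add_mem (K.mul_mem_right _ ha) (K.mul_mem_right _ ha'), ?_⟩
    rw [map_add, map_mul, map_mul, map_pow, map_pow, η.ρ, ← h, ← h', Subalgebra.coe_add]; ring
  smul_mem' := by
    rintro ⟨V, N, a, h⟩ W ⟨N', a', ha', h'⟩
    refine ⟨N + N', a * a', K.mul_mem_left _ ha', ?_⟩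
    rw [map_mul, ← h, ← h', smul_eq_mul, Subalgebra.coe_mul]; ring

theorem stable_fractionIdeal {K : Ideal A} (hK : 𝒟.Stable K) :
    η.fractionData.Stable (η.fractionIdeal K) := by
  constructor
  · rintro W ⟨N, a, ha, h⟩
    exact ⟨N + 1, _, K.sub_mem (K.mul_mem_right _ (hK.1 a ha)) (K.mul_mem_right _
      (K.mul_mem_left _ ha)), η.derivation_mul_pow η.dρ h⟩
  · rintro i W ⟨N, a, ha, h⟩
    exact ⟨N + 1, _, K.sub_mem (K.mul_mem_right _ (hK.2 i a ha)) (K.mul_mem_right _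
      (K.mul_mem_left _ ha)), η.derivation_mul_pow (η.d i) h⟩

/-- Denominators may be enlarged, so finitely many fractions have a common one with numerators still
in `K`. -/
theorem exists_pow_of_mem_fractionIdeal {K : Ideal A} {W : η.fractions}
    (hW : W ∈ η.fractionIdeal K) :
    ∃ N : ℕ, ∀ N', N ≤ N' → ∃ a ∈ K, (W : A') * 𝒟'.ρ ^ N' = η.φ a := by
  obtain ⟨N, a, ha, h⟩ := hW
  refine ⟨N, fun N' hN' => ⟨a * 𝒟.ρ ^ (N' - N), K.mul_mem_right _ ha, ?_⟩⟩
  rw [map_mul, ← h, map_pow, η.ρ, mul_assoc, ← pow_add, Nat.add_sub_cancel' hN']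

end Hom

theorem iterate_dρ_ρ_mul (𝒟 : AmbientData n A) (N : ℕ) (a : A) :
    𝒟.dρ^[N + 1] (𝒟.ρ * a) = 𝒟.ρ * 𝒟.dρ^[N + 1] a + (N + 1 : ℕ) * 𝒟.dρ^[N] a := by
  induction N with
  | zero => simp [Derivation.leibniz, 𝒟.dρ_ρ]
  | succ N ih =>
    rw [Function.iterate_succ_apply', ih, map_add, Derivation.leibniz, Derivation.leibniz,
      𝒟.dρ_ρ, ← Function.iterate_succ_apply' (⇑𝒟.dρ), ← Function.iterate_succ_apply' (⇑𝒟.dρ)]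
    simp only [Derivation.map_natCast, smul_eq_mul]
    push_cast
    ring

theorem iterate_dρ_add (𝒟 : AmbientData n A) (N : ℕ) (a b : A) :
    𝒟.dρ^[N] (a + b) = 𝒟.dρ^[N] a + 𝒟.dρ^[N] b :=
  iterate_map_add 𝒟.dρ N a b

/-- `∂_ρ^N` at `ρ = 0` extracts a Taylor coefficient; this is how residues are taken without power
series. -/
theorem iterate_dρ_mul_ρ_pow (𝒟 : AmbientData n A) (N : ℕ) (a : A) :
    ∃ r, 𝒟.dρ^[N] (𝒟.ρ ^ N * a) = (N.factorial : A) * a + 𝒟.ρ * r := by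
  induction N generalizing a with
  | zero => exact ⟨0, by simp⟩
  | succ N ih =>
    obtain ⟨r, hr⟩ := ih a
    have e : 𝒟.ρ ^ (N + 1) * a = 𝒟.ρ * (𝒟.ρ ^ N * a) := by ring
    rw [e, iterate_dρ_ρ_mul, hr]
    refine ⟨𝒟.dρ^[N + 1] (𝒟.ρ ^ N * a) + (N + 1 : ℕ) * r, ?_⟩
    rw [Nat.factorial_succ]
    push_cast
    ring

theorem Stable.iterate_mem {K : Ideal A} (hK : 𝒟.Stable K) (N : ℕ) {a : A} (ha : a ∈ K) :
    𝒟.dρ^[N] a ∈ K := by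
  induction N with
  | zero => exact ha
  | succ N ih => rw [Function.iterate_succ_apply']; exact hK.1 _ ih

/-- The residue of a divergence is a divergence. -/
theorem residue_divergence (hcomm : ∀ i a, 𝒟.dρ (𝒟.d i a) = 𝒟.d i (𝒟.dρ a)) {K : Ideal A}
    (hK : 𝒟.Stable K) {κ a : A} {b : Fin n → A} (hb : ∀ i, b i ∈ K) {N : ℕ}
    (h : 𝒟.ρ ^ (N + 1) * κ = 𝒟.ρ * 𝒟.dρ a - (N + 1 : ℕ) * a + 𝒟.ρ * ∑ i, 𝒟.d i (b i)) :
    ∃ c : Fin n → A, (∀ i, c i ∈ K) ∧ ∃ r, κ = ∑ i, 𝒟.d i (c i) + 𝒟.ρ * r := by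
  have hcomm' : ∀ (k : ℕ) i a, 𝒟.dρ^[k] (𝒟.d i a) = 𝒟.d i (𝒟.dρ^[k] a) := fun k i a =>
    (Function.Commute.iterate_left (f := 𝒟.dρ) (g := 𝒟.d i) (hcomm i) k) a
  -- The hypothesis is `κ/ρ = ∂_ρ(a/ρ^(N+1)) + ∑ ∂_i(b_i/ρ^(N+1))` multiplied by `ρ^(N+2)`. Applying
  -- `∂_ρ^(N+1)` modulo `ρ` takes the residue: the two contributions `±(N+1) ∂_ρ^(N+1) a` cancel.
  have h1 := congrArg (𝒟.dρ^[N + 1]) h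
  obtain ⟨r, hr⟩ := 𝒟.iterate_dρ_mul_ρ_pow (N + 1) κ
  have hneg : ∀ c j : ℕ, 𝒟.dρ^[j] (-(c * a)) = -(c * 𝒟.dρ^[j] a) := by
    intro c j
    induction j with
    | zero => rfl
    | succ j ih =>
      rw [Function.iterate_succ_apply', ih, map_neg, Derivation.leibniz, Derivation.map_natCast,
        smul_zero, add_zero, smul_eq_mul, ← Function.iterate_succ_apply' (⇑𝒟.dρ)]
  have hit : 𝒟.dρ^[N] (𝒟.dρ a) = 𝒟.dρ^[N + 1] a := rfl
  have hsum : 𝒟.dρ^[N] (∑ i, 𝒟.d i (b i)) = ∑ i, 𝒟.d i (𝒟.dρ^[N] (b i)) := by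
    simp only [← hcomm']
    exact map_sum (⟨⟨𝒟.dρ^[N], iterate_map_zero _ _⟩, iterate_map_add _ _⟩ : A →+ A) _ _
  rw [hr, sub_eq_add_neg, iterate_dρ_add, iterate_dρ_add, iterate_dρ_ρ_mul, iterate_dρ_ρ_mul, hneg, hit,
    hsum] at h1
  set f : ℝ := ((N + 1).factorial : ℝ) with hf
  have hf0 : f ≠ 0 := Nat.cast_ne_zero.mpr (Nat.factorial_ne_zero _)
  have hfA : (((N + 1).factorial : ℕ) : A) = algebraMap ℝ A f := by rw [hf, map_natCast]
  have hinv : algebraMap ℝ A f⁻¹ * algebraMap ℝ A f = 1 := by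
    rw [← map_mul, inv_mul_cancel₀ hf0, map_one]
  -- The constant is `(N+1)/(N+1)! = 1/N!`, so the witness is modulo `ρ` the residue of
  -- `b_i/ρ^(N+1)`.
  refine ⟨fun i => ((N + 1 : ℕ) * f⁻¹) • 𝒟.dρ^[N] (b i), fun i => ?_,
    f⁻¹ • (𝒟.dρ^[N + 1] (𝒟.dρ a) + 𝒟.dρ^[N + 1] (∑ i, 𝒟.d i (b i)) - r), ?_⟩
  · exact smul_mem_ideal _ (hK.iterate_mem N (hb i))
  · simp only [Derivation.map_smul, ← Finset.smul_sum]
    simp only [Algebra.smul_def, map_mul, map_natCast]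
    rw [hfA] at h1
    linear_combination algebraMap ℝ A f⁻¹ * h1 - κ * hinv

/-- The operator `sumOp` is formally self-adjoint along `ρ = 0`. -/
theorem sumOp_symm_mod_divergence (η : Hom 𝒟 𝒟') (hη : Function.Injective η.φ) {σ : A'}
    (hσ : 𝒟'.ρ * σ = 1) (hcomm : ∀ i a, 𝒟.dρ (𝒟.d i a) = 𝒟.d i (𝒟.dρ a)) {K : Ideal A}
    (hK : 𝒟.Stable K) (k : ℕ) (w w' : ℝ) (hw : w = -((n + w' - 2 * k) / 2)) (F U : A) {V : A}
    (hV : V ∈ K) :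
    ∃ c : Fin n → A, (∀ i, c i ∈ K) ∧ ∃ r,
      𝒟.m * (V * 𝒟.sumOp k w w w' F U - U * 𝒟.sumOp k w w w' F V) =
        ∑ i, 𝒟.d i (c i) + 𝒟.ρ * r := by
  have hσm : σ ∈ η.fractions := ⟨1, 1, by rw [pow_one, mul_comm, hσ, map_one]⟩
  set τ := η.toFractions with hτ
  have hVK : τ.φ V ∈ η.fractionIdeal K := ⟨0, V, hV, by rw [pow_zero, mul_one]; rfl⟩
  obtain ⟨α, hα, β, hβ, h⟩ := (η.stable_fractionIdeal hK).residue_sumOp k w w' hw (τ.φ F) (τ.φ U)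
    hVK (σ := ⟨σ, hσm⟩) (Subtype.ext hσ)
  rw [← τ.map_sumOp, ← τ.map_sumOp, ← map_mul, ← map_mul, ← map_sub, ← τ.m, ← map_mul] at h
  set κ := 𝒟.m * (V * 𝒟.sumOp k w w w' F U - U * 𝒟.sumOp k w w w' F V) with hκ
  obtain ⟨N₀, hN₀⟩ := η.exists_pow_of_mem_fractionIdeal hα
  choose Nβ hNβ using fun i => η.exists_pow_of_mem_fractionIdeal (hβ i)
  -- A common bound for all pole orders; the exponent `N + 1` used below is never zero.
  set N := N₀ + ∑ i, Nβ i with hN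
  obtain ⟨a, ha, haN⟩ := hN₀ (N + 1) (by omega)
  choose b hb hbN using fun i => hNβ i (N + 1) (by
    have := Finset.single_le_sum (f := Nβ) (fun _ _ => Nat.zero_le _) (Finset.mem_univ i)
    omega)
  refine residue_divergence hcomm hK hb (N := N) (κ := κ) (a := a) (hη ?_)
  have h1 := congrArg (fun W : η.fractions => (W : A') * 𝒟'.ρ ^ (N + 1 + 1)) h
  have h2 : ((η.fractionData.dρ α : η.fractions) : A') * 𝒟'.ρ ^ (N + 1 + 1) = _ :=
    η.derivation_mul_pow η.dρ haN
  have h3 : ∀ i, ((η.fractionData.d i (β i) : η.fractions) : A') * 𝒟'.ρ ^ (N + 1 + 1) = _ :=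
    fun i => η.derivation_mul_pow (η.d i) (hbN i)
  have h4 : ((τ.φ κ : η.fractions) : A') = η.φ κ := rfl
  simp only [Subalgebra.coe_mul, Subalgebra.coe_add, AddSubmonoidClass.coe_finsetSum, add_mul,
    Finset.sum_mul, h2, h3, h4, 𝒟.d_ρ, 𝒟.dρ_ρ, mul_zero, sub_zero, mul_one] at h1
  rw [map_mul, map_pow, η.ρ]
  calc 𝒟'.ρ ^ (N + 1) * η.φ κ = σ * η.φ κ * 𝒟'.ρ ^ (N + 1 + 1) := by
        linear_combination (-(𝒟'.ρ ^ (N + 1) * η.φ κ)) * hσ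
    _ = _ := by
        rw [h1]
        simp only [map_add, map_sub, map_mul, map_sum, Finset.mul_sum, η.ρ]
        simp only [mul_comm]

end AmbientData

end Localization

/-! ### Smooth functions on an open set as a differential algebra. -/

section SmoothFunctions

set_option linter.unusedSectionVars false

open Filter Topology TopologicalSpace

variable {X : Type*} [NormedAddCommGroup X] [NormedSpace ℝ X] {S S' : Opens X}

open Classical in
/-- The extension by zero of a function on an open set. -/
def extendZero (W : S → ℝ) (x : X) : ℝ := if h : x ∈ S then W ⟨x, h⟩ else 0

theorem extendZero_coe (W : S → ℝ) (p : S) : extendZero W p = W p := by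
  simp [extendZero]

theorem extendZero_eqOn {W : S → ℝ} {f : X → ℝ} (h : ∀ p : S, W p = f p) :
    EqOn (extendZero W) f S := fun x hx => by
  rw [← h ⟨x, hx⟩, ← extendZero_coe W ⟨x, hx⟩]

theorem contDiffOn_extendZero {W : S → ℝ} {f : X → ℝ} (h : ∀ p : S, W p = f p)
    (hf : ContDiffOn ℝ ∞ f S) : ContDiffOn ℝ ∞ (extendZero W) S :=
  hf.congr (extendZero_eqOn h)

variable (S) in
/-- The algebra of smooth functions on an open set. -/
def smoothAlg : Subalgebra ℝ (S → ℝ) where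
  carrier := {W | ContDiffOn ℝ ∞ (extendZero W) S}
  mul_mem' {V W} hV hW := contDiffOn_extendZero
    (fun p => by simp only [Pi.mul_apply, ← extendZero_coe V, ← extendZero_coe W]) (hV.mul hW)
  add_mem' {V W} hV hW := contDiffOn_extendZero
    (fun p => by simp only [Pi.add_apply, ← extendZero_coe V, ← extendZero_coe W]) (hV.add hW)
  algebraMap_mem' r := contDiffOn_extendZero (f := fun _ => r) (fun _ => rfl) contDiffOn_const

/-- The function on `X` given by a smooth function on `S`. -/
def smoothAlg.ext (W : smoothAlg S) : X → ℝ := extendZero (W : S → ℝ)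

/-- The restriction to `S` of a function that is smooth on `S`. -/
def smoothAlg.ofFun (f : X → ℝ) (hf : ContDiffOn ℝ ∞ f S) : smoothAlg S :=
  ⟨fun p => f p, contDiffOn_extendZero (fun _ => rfl) hf⟩

namespace smoothAlg

theorem contDiffOn_ext (W : smoothAlg S) : ContDiffOn ℝ ∞ (ext W) (S : Set X) := W.2

theorem contDiffAt_ext (W : smoothAlg S) {x : X} (hx : x ∈ S) : ContDiffAt ℝ ∞ (ext W) x :=
  (contDiffOn_ext W).contDiffAt (S.isOpen.mem_nhds hx)

theorem differentiableAt_ext (W : smoothAlg S) {x : X} (hx : x ∈ S) :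
    DifferentiableAt ℝ (ext W) x := (contDiffAt_ext W hx).differentiableAt (by simp)

theorem ext_coe (W : smoothAlg S) (p : S) : (ext W) p = (W : S → ℝ) p := extendZero_coe _ p

theorem eq_of_ext {V W : smoothAlg S} (h : ∀ x ∈ S, (ext V) x = (ext W) x) : V = W :=
  Subtype.ext (funext fun p => by rw [← ext_coe, ← ext_coe, h p p.2])

theorem ext_ofFun {f : X → ℝ} (hf : ContDiffOn ℝ ∞ f S) : EqOn (ext (ofFun f hf)) f S :=
  extendZero_eqOn fun _ => rfl

theorem ext_mul (V W : smoothAlg S) (x : X) : (ext (V * W)) x = (ext V) x * (ext W) x := by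
  by_cases h : x ∈ S <;> simp [ext, extendZero, h]

theorem ext_add (V W : smoothAlg S) (x : X) : (ext (V + W)) x = (ext V) x + (ext W) x := by
  by_cases h : x ∈ S <;> simp [ext, extendZero, h]

theorem ext_sub (V W : smoothAlg S) (x : X) : (ext (V - W)) x = (ext V) x - (ext W) x := by
  by_cases h : x ∈ S <;> simp [ext, extendZero, h]

theorem ext_smul (c : ℝ) (W : smoothAlg S) (x : X) : (ext (c • W)) x = c * (ext W) x := by
  by_cases h : x ∈ S <;> simp [ext, extendZero, h]

theorem ext_sum {ι : Type*} (s : Finset ι) (W : ι → smoothAlg S) (x : X) :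
    (ext (∑ i ∈ s, W i)) x = ∑ i ∈ s, (ext (W i)) x := by
  by_cases h : x ∈ S <;> simp [ext, extendZero, h]

theorem fderiv_ext_contDiffOn (W : smoothAlg S) (v : X) :
    ContDiffOn ℝ ∞ (fun x => fderiv ℝ (ext W) x v) S := fun _ hx =>
  (((contDiffAt_ext W hx).fderiv_right (m := ∞) (by simp)).clm_apply
    contDiffAt_const).contDiffWithinAt

/-- The derivation in the direction `v`. -/
def deriv (v : X) : Derivation ℝ (smoothAlg S) (smoothAlg S) :=
  Derivation.mk'
    { toFun := fun W => ofFun (fun x => fderiv ℝ (ext W) x v) (fderiv_ext_contDiffOn W v)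
      map_add' := fun V W => eq_of_ext fun x hx => by
        rw [ext_add, ext_ofFun _ hx, ext_ofFun _ hx, ext_ofFun _ hx,
          show (ext (V + W)) = fun x => (ext V) x + (ext W) x from funext (ext_add V W),
          fderiv_fun_add (differentiableAt_ext V hx) (differentiableAt_ext W hx)]
        rfl
      map_smul' := fun c W => eq_of_ext fun x hx => by
        rw [RingHom.id_apply, ext_smul, ext_ofFun _ hx, ext_ofFun _ hx,
          show (ext (c • W)) = fun x => c * (ext W) x from funext (ext_smul c W),
          fderiv_const_mul (differentiableAt_ext W hx)]
        rfl } fun V W => eq_of_ext fun x hx => by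
        change (ext (ofFun _ _)) x = (ext (V * ofFun _ _ + W * ofFun _ _)) x
        rw [ext_add, ext_mul, ext_mul, ext_ofFun _ hx, ext_ofFun _ hx, ext_ofFun _ hx,
          show (ext (V * W)) = fun x => (ext V) x * (ext W) x from funext (ext_mul V W),
          fderiv_fun_mul (differentiableAt_ext V hx) (differentiableAt_ext W hx)]
        rfl

theorem ext_deriv (v : X) (W : smoothAlg S) {x : X} (hx : x ∈ S) :
    (ext (deriv v W)) x = fderiv ℝ (ext W) x v := ext_ofFun (fderiv_ext_contDiffOn W v) hx

theorem eventuallyEq_ext_deriv (v : X) (W : smoothAlg S) {x : X} (hx : x ∈ S) :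
    (ext (deriv v W)) =ᶠ[𝓝 x] fun y => fderiv ℝ (ext W) y v := by
  filter_upwards [S.isOpen.mem_nhds hx] with y hy using ext_deriv v W hy

theorem deriv_comm (v v' : X) (W : smoothAlg S) : deriv v (deriv v' W) = deriv v' (deriv v W) := by
  refine eq_of_ext fun x hx => ?_
  have h : ∀ v v' : X, (ext (deriv v (deriv v' W))) x = fderiv ℝ (fderiv ℝ (ext W)) x v v' := by
    intro v v'
    rw [ext_deriv _ _ hx, (eventuallyEq_ext_deriv v' W hx).fderiv_eq,
      fderiv_clm_apply (((contDiffAt_ext W hx).fderiv_right (m := ∞) (by simp)).differentiableAt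
        (by simp)) (differentiableAt_const _)]
    simp
  rw [h, h]
  exact (contDiffAt_ext W hx).isSymmSndFDerivAt (by
    rw [minSmoothness_of_isRCLikeNormedField]; exact WithTop.coe_le_coe.mpr le_top) _ _

/-- The restriction of smooth functions to a smaller open set. -/
def restrict (h : S' ≤ S) : smoothAlg S →ₐ[ℝ] smoothAlg S' where
  toFun W := ofFun (ext W) ((contDiffOn_ext W).mono h)
  map_one' := eq_of_ext fun x hx => by
    rw [ext_ofFun _ hx, ext_coe _ ⟨x, hx⟩, ext_coe _ ⟨x, h hx⟩]; rfl
  map_mul' V W := eq_of_ext fun x hx => by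
    rw [ext_mul, ext_ofFun _ hx, ext_ofFun _ hx, ext_ofFun _ hx, ext_mul]
  map_zero' := eq_of_ext fun x hx => by
    rw [ext_ofFun _ hx, ext_coe _ ⟨x, hx⟩, ext_coe _ ⟨x, h hx⟩]; rfl
  map_add' V W := eq_of_ext fun x hx => by
    rw [ext_add, ext_ofFun _ hx, ext_ofFun _ hx, ext_ofFun _ hx, ext_add]
  commutes' r := eq_of_ext fun x hx => by
    rw [ext_ofFun _ hx, ext_coe _ ⟨x, hx⟩, ext_coe _ ⟨x, h hx⟩]; rfl

theorem ext_restrict (h : S' ≤ S) (W : smoothAlg S) {x : X} (hx : x ∈ S') :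
    (ext (restrict h W)) x = (ext W) x := ext_ofFun ((contDiffOn_ext W).mono h) hx

theorem restrict_deriv (h : S' ≤ S) (v : X) (W : smoothAlg S) :
    restrict h (deriv v W) = deriv v (restrict h W) := eq_of_ext fun x hx => by
  have h1 : (ext (restrict h W)) =ᶠ[𝓝 x] (ext W) := by
    filter_upwards [S'.isOpen.mem_nhds hx] with y hy using ext_restrict h W hy
  rw [ext_restrict h _ hx, ext_deriv _ _ (h hx), ext_deriv _ _ hx, h1.fderiv_eq]

/-- By continuity, an identity off `ρ = 0` extends across it; identities with denominators cleared
thus return to the full domain. -/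
theorem restrict_injective (h : S' ≤ S) (hd : (S : Set X) ⊆ closure S') :
    Function.Injective (restrict h) := by
  intro V W hVW
  refine eq_of_ext fun x hx => ?_
  have hev : ∀ᶠ y in 𝓝[S'] x, (ext V) y = (ext W) y := by
    filter_upwards [self_mem_nhdsWithin] with y hy
    rw [← ext_restrict h V hy, ← ext_restrict h W hy, hVW]
  have : (𝓝[(S' : Set X)] x).NeBot := mem_closure_iff_nhdsWithin_neBot.mp (hd hx)
  exact tendsto_nhds_unique_of_eventuallyEq
    ((contDiffAt_ext V hx).continuousAt.tendsto.mono_left nhdsWithin_le_nhds)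
    ((contDiffAt_ext W hx).continuousAt.tendsto.mono_left nhdsWithin_le_nhds) hev

variable (S) in
/-- The smooth functions on `S` which vanish outside of the closed set `C`. -/
def vanishing (C : Set X) : Ideal (smoothAlg S) where
  carrier := {W | ∀ x ∈ S, x ∉ C → (ext W) x = 0}
  zero_mem' := fun x hx _ => by rw [ext_coe _ ⟨x, hx⟩]; rfl
  add_mem' := fun {V W} hV hW x hx hC => by rw [ext_add, hV x hx hC, hW x hx hC, add_zero]
  smul_mem' := fun V W hW x hx hC => by rw [smul_eq_mul, ext_mul, hW x hx hC, mul_zero]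

theorem deriv_mem_vanishing {C : Set X} (hC : IsClosed C) (v : X) {W : smoothAlg S}
    (hW : W ∈ vanishing S C) : deriv v W ∈ vanishing S C := by
  intro x hx hxC
  have h1 : (ext W) =ᶠ[𝓝 x] fun _ => 0 := by
    filter_upwards [S.isOpen.mem_nhds hx, hC.isOpen_compl.mem_nhds hxC] with y hy hy'
    exact hW y hy hy'
  rw [ext_deriv _ _ hx, h1.fderiv_eq]
  simp

end smoothAlg

variable {n : ℕ}

theorem smoothAlg.restrict_ofFun (h : S' ≤ S) {f : X → ℝ} (hf : ContDiffOn ℝ ∞ f S) :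
    smoothAlg.restrict h (smoothAlg.ofFun f hf) = smoothAlg.ofFun f (hf.mono h) :=
  smoothAlg.eq_of_ext fun q hq => by
    rw [smoothAlg.ext_restrict h _ hq, smoothAlg.ext_ofFun hf (h hq), smoothAlg.ext_ofFun _ hq]

section CoordData

variable {S S' : Opens (EuclideanSpace ℝ (Fin n) × ℝ)}
  {G : EuclideanSpace ℝ (Fin n) × ℝ → Matrix (Fin n) (Fin n) ℝ}

variable (S G) in
/-- The matrices `G` depend smoothly on the point and are symmetric and invertible. -/
structure IsMetricOn : Prop where
  smooth : ∀ q ∈ S, ∀ i j, ContDiffAt ℝ ∞ (fun q => G q i j) q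
  det_ne_zero : ∀ q ∈ S, (G q).det ≠ 0
  symm : ∀ q ∈ S, ∀ i j, G q i j = G q j i

namespace IsMetricOn

theorem mono (hG : IsMetricOn S G) (h : S' ≤ S) : IsMetricOn S' G :=
  ⟨fun q hq => hG.smooth q (h hq), fun q hq => hG.det_ne_zero q (h hq),
    fun q hq => hG.symm q (h hq)⟩

theorem sqrt_ne_zero (hG : IsMetricOn S G) {q : EuclideanSpace ℝ (Fin n) × ℝ} (hq : q ∈ S) :
    Real.sqrt |(G q).det| ≠ 0 :=
  Real.sqrt_ne_zero'.mpr (abs_pos.mpr (hG.det_ne_zero q hq))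

theorem contDiffOn_sqrt (hG : IsMetricOn S G) :
    ContDiffOn ℝ ∞ (fun q => Real.sqrt |(G q).det|) S := fun q hq =>
  (contDiffAt_sqrt_abs_det (hG.smooth q hq) (hG.det_ne_zero q hq)).contDiffWithinAt

theorem contDiffOn_sqrt_inv (hG : IsMetricOn S G) :
    ContDiffOn ℝ ∞ (fun q => (Real.sqrt |(G q).det|)⁻¹) S :=
  hG.contDiffOn_sqrt.inv fun _ hq => hG.sqrt_ne_zero hq

theorem contDiffOn_inv (hG : IsMetricOn S G) (i j : Fin n) :
    ContDiffOn ℝ ∞ (fun q => (G q)⁻¹ i j) S := fun q hq =>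
  (contDiffAt_inv_apply (hG.smooth q hq) (hG.det_ne_zero q hq) i j).contDiffWithinAt

theorem inv_symm (hG : IsMetricOn S G) {q : EuclideanSpace ℝ (Fin n) × ℝ} (hq : q ∈ S)
    (i j : Fin n) : (G q)⁻¹ i j = (G q)⁻¹ j i := by
  have hT : (G q).transpose = G q := Matrix.ext fun i j => hG.symm q hq j i
  have h := Matrix.transpose_nonsing_inv (G q)
  rw [hT] at h
  exact congrFun (congrFun h j) i

end IsMetricOn

variable (S) in
/-- The coordinate `ρ` on an open subset of `ℝⁿ × ℝ`. -/
def coordρ : smoothAlg S := smoothAlg.ofFun Prod.snd contDiff_snd.contDiffOn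

theorem deriv_coordρ (v : EuclideanSpace ℝ (Fin n) × ℝ) {q : EuclideanSpace ℝ (Fin n) × ℝ}
    (hq : q ∈ S) : smoothAlg.ext (smoothAlg.deriv v (coordρ S)) q = v.2 := by
  have h : smoothAlg.ext (coordρ S) =ᶠ[𝓝 q] Prod.snd := by
    filter_upwards [S.isOpen.mem_nhds hq] with y hy using smoothAlg.ext_ofFun _ hy
  rw [smoothAlg.ext_deriv _ _ hq, h.fderiv_eq, fderiv_snd]
  rfl

/-- The data of a family of metrics with components `G` on an open subset of `ℝⁿ × ℝ`. -/
def coordData (hG : IsMetricOn S G) : AmbientData n (smoothAlg S) where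
  dρ := smoothAlg.deriv (0, 1)
  d i := smoothAlg.deriv (stdBasis n i, 0)
  ρ := coordρ S
  m := smoothAlg.ofFun _ hG.contDiffOn_sqrt
  m' := smoothAlg.ofFun _ hG.contDiffOn_sqrt_inv
  h i j := smoothAlg.ofFun _ (hG.contDiffOn_inv i j)
  m_mul := smoothAlg.eq_of_ext fun q hq => by
    rw [smoothAlg.ext_mul, smoothAlg.ext_ofFun hG.contDiffOn_sqrt hq,
      smoothAlg.ext_ofFun hG.contDiffOn_sqrt_inv hq, smoothAlg.ext_coe _ ⟨q, hq⟩]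
    exact mul_inv_cancel₀ (hG.sqrt_ne_zero hq)
  dρ_ρ := smoothAlg.eq_of_ext fun q hq => by
    rw [deriv_coordρ _ hq, smoothAlg.ext_coe _ ⟨q, hq⟩]
    rfl
  d_ρ i := smoothAlg.eq_of_ext fun q hq => by
    rw [deriv_coordρ _ hq, smoothAlg.ext_coe _ ⟨q, hq⟩]
    rfl
  h_symm i j := smoothAlg.eq_of_ext fun q hq =>
    (smoothAlg.ext_ofFun (hG.contDiffOn_inv i j) hq).trans
      ((hG.inv_symm hq i j).trans (smoothAlg.ext_ofFun (hG.contDiffOn_inv j i) hq).symm)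

/-- The restriction homomorphism for the data `coordData`. -/
def coordDataRestrict (h : S' ≤ S) (hG : IsMetricOn S G) :
    AmbientData.Hom (coordData hG) (coordData (hG.mono h)) where
  φ := smoothAlg.restrict h
  dρ := smoothAlg.restrict_deriv h _
  d _ := smoothAlg.restrict_deriv h _
  ρ := smoothAlg.restrict_ofFun h contDiff_snd.contDiffOn
  m := smoothAlg.restrict_ofFun h _
  m' := smoothAlg.restrict_ofFun h _
  h _ _ := smoothAlg.restrict_ofFun h _

end CoordData

end SmoothFunctions

/-! ### The ambient Laplacian of `t^w U` in coordinates. -/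

section StraightMatrix

open Filter Topology TopologicalSpace MetricFamily

variable {n : ℕ}

theorem abs_det_straightMatrix (t ρ : ℝ) (h : Matrix (Fin n) (Fin n) ℝ) :
    |(straightMatrix t ρ h).det| = (t ^ (n + 1)) ^ 2 * |h.det| := by
  -- Listing `t` and `ρ` together after the `x`-coordinates makes the matrix block diagonal.
  let φ : Fin n ⊕ Fin 2 → Unit ⊕ (Fin n ⊕ Unit) :=
    Sum.elim (fun i => .inr (.inl i)) ![.inl (), .inr (.inr ())]
  have hφ : Function.Bijective φ := by
    constructor
    · rintro (i | i) (j | j) hij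
      · simpa [φ] using hij
      · fin_cases j <;> simp [φ] at hij
      · fin_cases i <;> simp [φ] at hij
      · fin_cases i <;> fin_cases j <;> simp [φ] at hij ⊢
    · rintro (i | i | i)
      · exact ⟨.inr 0, rfl⟩
      · exact ⟨.inl i, rfl⟩
      · exact ⟨.inr 1, rfl⟩
  have h1 : (straightMatrix t ρ h).submatrix φ φ =
      Matrix.fromBlocks (t ^ 2 • h) 0 0 !![2 * ρ, t; t, 0] := by
    ext a c
    rcases a with a | a <;> rcases c with c | c
    · rfl
    · fin_cases c <;> rfl
    · fin_cases a <;> rfl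
    · fin_cases a <;> fin_cases c <;> rfl
  have h2 := Matrix.det_submatrix_equiv_self (Equiv.ofBijective φ hφ) (straightMatrix t ρ h)
  rw [Equiv.coe_ofBijective, h1, Matrix.det_fromBlocks_zero₂₁, Matrix.det_smul,
    Matrix.det_fin_two_of, Fintype.card_fin] at h2
  rw [← h2, mul_zero, zero_sub, mul_neg, abs_neg, abs_mul, abs_mul, abs_mul_self,
    abs_of_nonneg (by positivity : (0 : ℝ) ≤ (t ^ 2) ^ n)]
  ring

theorem sqrt_abs_det_straightMatrix {t : ℝ} (ht : 0 < t) (ρ : ℝ) (h : Matrix (Fin n) (Fin n) ℝ) :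
    Real.sqrt |(straightMatrix t ρ h).det| = t ^ (n + 1) * Real.sqrt |h.det| := by
  rw [abs_det_straightMatrix, Real.sqrt_mul (by positivity), Real.sqrt_sq (by positivity)]

/-- The inverse of `straightMatrix`. -/
def straightInverse (t ρ : ℝ) (h : Matrix (Fin n) (Fin n) ℝ) :
    Matrix (Unit ⊕ (Fin n ⊕ Unit)) (Unit ⊕ (Fin n ⊕ Unit)) ℝ :=
  Matrix.of fun a b => match a, b with
    | .inl _, .inr (.inr _) => t⁻¹
    | .inr (.inr _), .inl _ => t⁻¹
    | .inr (.inr _), .inr (.inr _) => -(2 * ρ) * (t ^ 2)⁻¹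
    | .inr (.inl i), .inr (.inl j) => (t ^ 2)⁻¹ * h i j
    | _, _ => 0

theorem straightMatrix_inv {t : ℝ} (ht : 0 < t) (ρ : ℝ) {h : Matrix (Fin n) (Fin n) ℝ}
    (hh : h.det ≠ 0) : (straightMatrix t ρ h)⁻¹ = straightInverse t ρ h⁻¹ := by
  refine Matrix.inv_eq_right_inv ?_
  have h1 : ∀ i j, ∑ k, h i k * h⁻¹ k j = (1 : Matrix (Fin n) (Fin n) ℝ) i j := fun i j => by
    rw [← Matrix.mul_apply, Matrix.mul_nonsing_inv _ (isUnit_iff_ne_zero.mpr hh)]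
  have ht' := ht.ne'
  ext a c
  rw [Matrix.mul_apply, Fintype.sum_sum_type, Fintype.sum_sum_type]
  rcases a with a | a | a <;> rcases c with c | c | c
  · simp [straightMatrix, straightInverse, ht']
  · simp [straightMatrix, straightInverse]
  · simp [straightMatrix, straightInverse]
    field_simp
    ring
  · simp [straightMatrix, straightInverse]
  · have h2 : ∀ k, t ^ 2 * h a k * ((t ^ 2)⁻¹ * h⁻¹ k c) = h a k * h⁻¹ k c := fun k => by
      field_simp
    simp [straightMatrix, straightInverse, h2, h1, Matrix.one_apply]
  · simp [straightMatrix, straightInverse]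
  · simp [straightMatrix, straightInverse]
  · simp [straightMatrix, straightInverse]
  · simp [straightMatrix, straightInverse, ht']

theorem contDiffAt_straightMatrix {G : EuclideanSpace ℝ (Fin n) × ℝ → Matrix (Fin n) (Fin n) ℝ}
    {q : ℝ × EuclideanSpace ℝ (Fin n) × ℝ}
    (hG : ∀ i j, ContDiffAt ℝ ∞ (fun q => G q i j) q.2) (a c : Unit ⊕ (Fin n ⊕ Unit)) :
    ContDiffAt ℝ ∞ (fun q : ℝ × EuclideanSpace ℝ (Fin n) × ℝ =>
      straightMatrix q.1 q.2.2 (G q.2) a c) q := by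
  rcases a with a | a | a <;> rcases c with c | c | c
  · exact contDiffAt_const.mul (contDiffAt_snd.comp q contDiffAt_snd)
  · exact contDiffAt_const
  · exact contDiffAt_fst
  · exact contDiffAt_const
  · exact (contDiffAt_fst.pow 2).mul ((hG a c).comp q contDiffAt_snd)
  · exact contDiffAt_const
  · exact contDiffAt_fst
  · exact contDiffAt_const
  · exact contDiffAt_const

/-- The summands on the right are the `(t,ρ)`, `(ρ,t)`, `(ρ,ρ)` and `(i,j)` terms of the coordinate
formula for the Laplacian; all other components of the inverse metric vanish. -/
theorem AmbientData.m_mul_op {A : Type*} [CommRing A] [Algebra ℝ A] (𝒟 : AmbientData n A) (w : ℝ)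
    (U : A) :
    𝒟.m * 𝒟.op w U = ((n : ℝ) + w) • (𝒟.m * 𝒟.dρ U) + 𝒟.dρ (w • (𝒟.m * U)) +
      𝒟.dρ ((-2 : ℝ) • (𝒟.ρ * 𝒟.m * 𝒟.dρ U)) +
      ∑ i, ∑ j, 𝒟.d i (𝒟.m * 𝒟.h i j * 𝒟.d j U) := by
  have h1 : ∑ i, ∑ j, 𝒟.d i (𝒟.m * 𝒟.h i j * 𝒟.d j U) = ∑ i, 𝒟.d i (𝒟.flux U i) :=
    Finset.sum_congr rfl fun i _ => by rw [AmbientData.flux, map_sum]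
  rw [h1, AmbientData.op_apply]
  simp only [Derivation.leibniz, 𝒟.dρ_ρ, Derivation.map_smul, smul_eq_mul]
  simp only [Algebra.smul_def, map_mul, map_neg, map_natCast, map_ofNat, map_add, map_sub]
  linear_combination (∑ i, 𝒟.d i (𝒟.flux U i) + algebraMap ℝ A w * 𝒟.dρ 𝒟.m * U
    - 2 * 𝒟.ρ * 𝒟.dρ 𝒟.m * 𝒟.dρ U) * 𝒟.m_mul

variable {S : Opens (EuclideanSpace ℝ (Fin n) × ℝ)}

/-- The homogeneous function `t ^ s * W`. -/
def homFun (s : ℝ) (W : smoothAlg S) (q : ℝ × EuclideanSpace ℝ (Fin n) × ℝ) : ℝ :=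
  q.1 ^ s * smoothAlg.ext W q.2

theorem contDiffAt_homFun (s : ℝ) (W : smoothAlg S) {q : ℝ × EuclideanSpace ℝ (Fin n) × ℝ}
    (ht : 0 < q.1) (hq : q.2 ∈ S) : ContDiffAt ℝ ∞ (homFun s W) q :=
  (contDiffAt_fst.rpow_const_of_ne ht.ne').mul
    ((smoothAlg.contDiffAt_ext W hq).comp q contDiffAt_snd)

theorem fderiv_homFun (s : ℝ) (W : smoothAlg S) {q : ℝ × EuclideanSpace ℝ (Fin n) × ℝ}
    (ht : 0 < q.1) (hq : q.2 ∈ S) (v : ℝ × EuclideanSpace ℝ (Fin n) × ℝ) :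
    fderiv ℝ (homFun s W) q v = v.1 * (s * q.1 ^ (s - 1) * smoothAlg.ext W q.2) +
      q.1 ^ s * smoothAlg.ext (smoothAlg.deriv v.2 W) q.2 := by
  have h1 : HasFDerivAt (fun q : ℝ × EuclideanSpace ℝ (Fin n) × ℝ => q.1 ^ s)
      ((s * q.1 ^ (s - 1)) • ContinuousLinearMap.fst ℝ ℝ (EuclideanSpace ℝ (Fin n) × ℝ)) q :=
    hasFDerivAt_fst.rpow_const (Or.inl ht.ne')
  have h2 : HasFDerivAt (fun q : ℝ × EuclideanSpace ℝ (Fin n) × ℝ => smoothAlg.ext W q.2)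
      ((fderiv ℝ (smoothAlg.ext W) q.2).comp
        (ContinuousLinearMap.snd ℝ ℝ (EuclideanSpace ℝ (Fin n) × ℝ))) q :=
    (smoothAlg.differentiableAt_ext W hq).hasFDerivAt.comp q hasFDerivAt_snd
  rw [show homFun s W = fun q => q.1 ^ s * smoothAlg.ext W q.2 from rfl, (h1.fun_mul h2).fderiv,
    smoothAlg.ext_deriv _ _ hq]
  simp only [add_apply, smul_apply, ContinuousLinearMap.comp_apply, ContinuousLinearMap.coe_fst',
    ContinuousLinearMap.coe_snd', smul_eq_mul]
  ring

theorem ambientBasis_inl (a : Unit) : ambientBasis n (.inl a) = (1, 0, 0) := by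
  simp [Module.Basis.prod_apply]
  rfl

theorem ambientBasis_inr_inl (i : Fin n) :
    ambientBasis n (.inr (.inl i)) = (0, stdBasis n i, 0) := by
  simp [Module.Basis.prod_apply]

theorem ambientBasis_inr_inr (a : Unit) : ambientBasis n (.inr (.inr a)) = (0, 0, 1) := by
  simp [Module.Basis.prod_apply]

theorem smoothAlg.ext_deriv_zero (W : smoothAlg S) {q : EuclideanSpace ℝ (Fin n) × ℝ}
    (hq : q ∈ S) : smoothAlg.ext (smoothAlg.deriv 0 W) q = 0 := by
  rw [smoothAlg.ext_deriv _ _ hq, map_zero]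

variable {G : EuclideanSpace ℝ (Fin n) × ℝ → Matrix (Fin n) (Fin n) ℝ}

/-- The ambient Laplacian of a homogeneous function in coordinates. -/
theorem coordLaplacian_homFun (hG : IsMetricOn S G) (w : ℝ) (U : smoothAlg S)
    {q : ℝ × EuclideanSpace ℝ (Fin n) × ℝ} (ht : 0 < q.1) (hq : q.2 ∈ S) :
    coordLaplacian (ambientBasis n) (fun q => straightMatrix q.1 q.2.2 (G q.2)) (homFun w U) q =
      homFun (w - 2) ((coordData hG).op w U) q := by
  set 𝒟 := coordData hG with h𝒟
  have hnear : ∀ᶠ z : ℝ × EuclideanSpace ℝ (Fin n) × ℝ in 𝓝 q, 0 < z.1 ∧ z.2 ∈ S :=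
    (continuous_fst.continuousAt.eventually (lt_mem_nhds ht)).and
      (continuous_snd.continuousAt.eventually (S.isOpen.mem_nhds hq))
  have hm : ∀ z ∈ S, smoothAlg.ext 𝒟.m z = Real.sqrt |(G z).det| := fun z hz =>
    smoothAlg.ext_ofFun hG.contDiffOn_sqrt hz
  have hh : ∀ i j, ∀ z ∈ S, smoothAlg.ext (𝒟.h i j) z = (G z)⁻¹ i j := fun i j z hz =>
    smoothAlg.ext_ofFun (hG.contDiffOn_inv i j) hz
  have hρ : ∀ z ∈ S, smoothAlg.ext 𝒟.ρ z = z.2 := fun z hz =>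
    smoothAlg.ext_ofFun contDiff_snd.contDiffOn hz
  set T : Unit ⊕ (Fin n ⊕ Unit) → Unit ⊕ (Fin n ⊕ Unit) → ℝ := fun a c =>
    fderiv ℝ (fun z : ℝ × EuclideanSpace ℝ (Fin n) × ℝ =>
      Real.sqrt |(straightMatrix z.1 z.2.2 (G z.2)).det| *
        (straightMatrix z.1 z.2.2 (G z.2))⁻¹ a c *
        fderiv ℝ (homFun w U) z (ambientBasis n c)) q (ambientBasis n a) with hT
  -- Once the differentiated function is recognised near `q` as a homogeneous function `t^s W`, its
  -- derivative is given by `fderiv_homFun`.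
  have key : ∀ a c s (W : smoothAlg S),
      (∀ z : ℝ × EuclideanSpace ℝ (Fin n) × ℝ, 0 < z.1 → z.2 ∈ S →
        z.1 ^ (n + 1) * smoothAlg.ext 𝒟.m z.2 * straightInverse z.1 z.2.2 (G z.2)⁻¹ a c *
          ((ambientBasis n c).1 * (w * z.1 ^ (w - 1) * smoothAlg.ext U z.2) +
          z.1 ^ w * smoothAlg.ext (smoothAlg.deriv (ambientBasis n c).2 U) z.2) = homFun s W z) →
      T a c = (ambientBasis n a).1 * (s * q.1 ^ (s - 1) * smoothAlg.ext W q.2) +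
        q.1 ^ s * smoothAlg.ext (smoothAlg.deriv (ambientBasis n a).2 W) q.2 := by
    intro a c s W h
    rw [hT, ← fderiv_homFun s W ht hq]
    have h1 : (fun z : ℝ × EuclideanSpace ℝ (Fin n) × ℝ =>
      Real.sqrt |(straightMatrix z.1 z.2.2 (G z.2)).det| *
        (straightMatrix z.1 z.2.2 (G z.2))⁻¹ a c *
        fderiv ℝ (homFun w U) z (ambientBasis n c)) =ᶠ[𝓝 q] homFun s W := by
      filter_upwards [hnear] with z hz
      rw [← h z hz.1 hz.2, fderiv_homFun w U hz.1 hz.2, sqrt_abs_det_straightMatrix hz.1,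
        straightMatrix_inv hz.1 _ (hG.det_ne_zero _ hz.2), hm _ hz.2]
    exact congrArg (fun L : (ℝ × EuclideanSpace ℝ (Fin n) × ℝ) →L[ℝ] ℝ => L (ambientBasis n a))
      h1.fderiv_eq
  have pow1 : ∀ t : ℝ, 0 < t → t ^ ((n : ℝ) + w) = t ^ n * t ^ w := fun t ht => by
    rw [Real.rpow_add ht, Real.rpow_natCast]
  have pow2 : ∀ t : ℝ, 0 < t → t ^ ((n : ℝ) + w - 1) = t ^ n * t ^ w * t⁻¹ := fun t ht => by
    rw [Real.rpow_sub_one ht.ne', pow1 t ht, div_eq_mul_inv]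
  have pow3 : ∀ t : ℝ, 0 < t → t ^ (w - 1) = t ^ w * t⁻¹ := fun t ht => by
    rw [Real.rpow_sub_one ht.ne', div_eq_mul_inv]
  have hzero : ∀ a c, (∀ z : ℝ × EuclideanSpace ℝ (Fin n) × ℝ,
      straightInverse z.1 z.2.2 (G z.2)⁻¹ a c = 0) → T a c = 0 := by
    intro a c h
    have h0 : ∀ x : EuclideanSpace ℝ (Fin n) × ℝ, smoothAlg.ext (0 : smoothAlg S) x = 0 := by
      intro x; simp [smoothAlg.ext, extendZero]
    rw [key a c 0 0 fun z _ _ => by rw [h, homFun, h0]; ring, map_zero, h0]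
    ring
  have T_tt : T (.inl ()) (.inl ()) = 0 := hzero _ _ fun _ => rfl
  have T_ti : ∀ i, T (.inl ()) (.inr (.inl i)) = 0 := fun i => hzero _ _ fun _ => rfl
  have T_it : ∀ i, T (.inr (.inl i)) (.inl ()) = 0 := fun i => hzero _ _ fun _ => rfl
  have T_ρi : ∀ i, T (.inr (.inr ())) (.inr (.inl i)) = 0 := fun i => hzero _ _ fun _ => rfl
  have T_iρ : ∀ i, T (.inr (.inl i)) (.inr (.inr ())) = 0 := fun i => hzero _ _ fun _ => rfl
  have T_tρ : T (.inl ()) (.inr (.inr ())) =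
      (n + w) * q.1 ^ ((n : ℝ) + w - 1) * smoothAlg.ext (𝒟.m * 𝒟.dρ U) q.2 := by
    rw [key _ _ ((n : ℝ) + w) (𝒟.m * 𝒟.dρ U)]
    · rw [ambientBasis_inl]
      change 1 * _ + _ * smoothAlg.ext (smoothAlg.deriv 0 _) _ = _
      rw [smoothAlg.ext_deriv_zero _ hq]
      ring
    · intro z hz hzS
      rw [ambientBasis_inr_inr, homFun, pow1 _ hz, smoothAlg.ext_mul]
      change _ * z.1⁻¹ * (0 * _ + _ * smoothAlg.ext (𝒟.dρ U) _) = _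
      field_simp
      ring
  have T_ρt : T (.inr (.inr ())) (.inl ()) =
      q.1 ^ ((n : ℝ) + w - 1) * smoothAlg.ext (𝒟.dρ (w • (𝒟.m * U))) q.2 := by
    rw [key _ _ ((n : ℝ) + w - 1) (w • (𝒟.m * U))]
    · rw [ambientBasis_inr_inr]
      change 0 * _ + _ * smoothAlg.ext (𝒟.dρ _) _ = _
      ring
    · intro z hz hzS
      rw [ambientBasis_inl, homFun, pow2 _ hz, pow3 _ hz, smoothAlg.ext_smul, smoothAlg.ext_mul]
      change _ * z.1⁻¹ * (1 * _ + _ * smoothAlg.ext (smoothAlg.deriv 0 U) _) = _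
      rw [smoothAlg.ext_deriv_zero _ hzS]
      field_simp
      ring
  have T_ρρ : T (.inr (.inr ())) (.inr (.inr ())) =
      q.1 ^ ((n : ℝ) + w - 1) *
        smoothAlg.ext (𝒟.dρ ((-2 : ℝ) • (𝒟.ρ * 𝒟.m * 𝒟.dρ U))) q.2 := by
    rw [key _ _ ((n : ℝ) + w - 1) ((-2 : ℝ) • (𝒟.ρ * 𝒟.m * 𝒟.dρ U))]
    · rw [ambientBasis_inr_inr]
      change 0 * _ + _ * smoothAlg.ext (𝒟.dρ _) _ = _
      ring
    · intro z hz hzS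
      rw [ambientBasis_inr_inr, homFun, pow2 _ hz, smoothAlg.ext_smul, smoothAlg.ext_mul,
        smoothAlg.ext_mul, hρ _ hzS]
      change _ * (-(2 * z.2.2) * (z.1 ^ 2)⁻¹) * (0 * _ + _ * smoothAlg.ext (𝒟.dρ U) _) = _
      field_simp
      ring
  have T_ij : ∀ i j, T (.inr (.inl i)) (.inr (.inl j)) =
      q.1 ^ ((n : ℝ) + w - 1) * smoothAlg.ext (𝒟.d i (𝒟.m * 𝒟.h i j * 𝒟.d j U)) q.2 := by
    intro i j
    rw [key _ _ ((n : ℝ) + w - 1) (𝒟.m * 𝒟.h i j * 𝒟.d j U)]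
    · rw [ambientBasis_inr_inl]
      change 0 * _ + _ * smoothAlg.ext (𝒟.d i _) _ = _
      ring
    · intro z hz hzS
      rw [ambientBasis_inr_inl, homFun, pow2 _ hz, smoothAlg.ext_mul, smoothAlg.ext_mul, hh _ _ _ hzS]
      change _ * ((z.1 ^ 2)⁻¹ * (G z.2)⁻¹ i j) * (0 * _ + _ * smoothAlg.ext (𝒟.d j U) _) = _
      field_simp
      ring
  have hsum : ∑ a, ∑ c, T a c =
      q.1 ^ ((n : ℝ) + w - 1) * (smoothAlg.ext 𝒟.m q.2 * smoothAlg.ext (𝒟.op w U) q.2) := by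
    rw [← smoothAlg.ext_mul, 𝒟.m_mul_op]
    simp only [Fintype.sum_sum_type, Finset.univ_unique, Finset.sum_singleton, PUnit.default_eq_unit,
      T_tt, T_ti, T_it, T_ρi, T_iρ, T_tρ, T_ρt, T_ρρ, T_ij, smoothAlg.ext_add, smoothAlg.ext_sum,
      smoothAlg.ext_smul ((n : ℝ) + w), Finset.sum_const_zero, zero_add, add_zero, ← Finset.mul_sum]
    ring
  have hmne : smoothAlg.ext 𝒟.m q.2 ≠ 0 := by rw [hm _ hq]; exact hG.sqrt_ne_zero hq
  change (Real.sqrt |(straightMatrix q.1 q.2.2 (G q.2)).det|)⁻¹ * ∑ a, ∑ c, T a c = _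
  rw [hsum, sqrt_abs_det_straightMatrix ht, ← hm _ hq, homFun, pow2 _ ht,
    show w - 2 = w - 1 - 1 by ring, Real.rpow_sub_one ht.ne', pow3 _ ht]
  field_simp
  ring

end StraightMatrix

/-! ### From functions on the ambient space to the differential algebra. -/

section Representation

open Filter Topology TopologicalSpace

namespace MetricFamily

variable {n : ℕ} {M : Type*} [TopologicalSpace M] [ChartedSpace (EuclideanSpace ℝ (Fin n)) M]
  [IsManifold (𝓡 n) ∞ M] (g : MetricFamily n M)

/-- The range of the coordinates `(x, ρ)` over the chart `e`. -/
def coordDomain (e : OpenPartialHomeomorph M (EuclideanSpace ℝ (Fin n))) :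
    Opens (EuclideanSpace ℝ (Fin n) × ℝ) :=
  ⟨e.target ×ˢ Ioo (-g.ε) g.ε, e.open_target.prod isOpen_Ioo⟩

/-- The components of the metrics `g_ρ` in the chart `e`. -/
def coordGram (e : OpenPartialHomeomorph M (EuclideanSpace ℝ (Fin n)))
    (q : EuclideanSpace ℝ (Fin n) × ℝ) : Matrix (Fin n) (Fin n) ℝ :=
  gram (stdBasis n) (g.metric q.2) e q.1

variable {g} {e : OpenPartialHomeomorph M (EuclideanSpace ℝ (Fin n))}

theorem isMetricOn_coordGram (he : e ∈ IsManifold.maximalAtlas (𝓡 n) ∞ M) :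
    IsMetricOn (g.coordDomain e) (g.coordGram e) where
  smooth _ hq i j := g.contDiffAt_gram he hq.1 hq.2 i j
  det_ne_zero _ hq := g.gram_det_ne_zero he hq.1 hq.2
  symm _ hq i j := g.gram_symm e _ hq.2 i j

theorem zero_mem_Ioo : (0 : ℝ) ∈ Ioo (-g.ε) g.ε := ⟨by linarith [g.ε_pos], g.ε_pos⟩

variable (g e) in
/-- The function `Ũ` on the ambient space is `t ^ w * U` in the chart `e`. -/
def IsRep (w : ℝ) (Ũ : ℝ × M × ℝ → ℝ) (U : smoothAlg (g.coordDomain e)) : Prop :=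
  ∀ t : ℝ, 0 < t → ∀ q ∈ g.coordDomain e, Ũ (t, e.symm q.1, q.2) = t ^ w * smoothAlg.ext U q

theorem IsRep.contMDiffAt (he : e ∈ IsManifold.maximalAtlas (𝓡 n) ∞ M) {w : ℝ}
    {Ũ : ℝ × M × ℝ → ℝ} {U : smoothAlg (g.coordDomain e)} (h : g.IsRep e w Ũ U) {p : ℝ × M × ℝ}
    (hp : p ∈ g.ambientSpace) (hpe : p.2.1 ∈ e.source) :
    ContMDiffAt (ambientModel n) 𝓘(ℝ, ℝ) ∞ Ũ p := by
  have h0 : e p.2.1 ∈ e.target := e.map_source hpe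
  have hps : p ∈ (ambientChart e).source := ⟨mem_univ _, hpe, mem_univ _⟩
  have h1 : ContMDiffAt (ambientModel n) 𝓘(ℝ, ℝ) ∞
      (homFun w U ∘ (ambientChart e).extend (ambientModel n)) p := by
    refine ContMDiffAt.comp p ?_ ((ambientChart e).contMDiffAt_extend (ambientChart_mem he) hps)
    rw [ambientChart_extend]
    exact (contDiffAt_homFun w U (q := (p.1, e p.2.1, p.2.2)) hp.1 ⟨h0, hp.2⟩).contMDiffAt
  refine h1.congr_of_eventuallyEq ?_
  have hopen : IsOpen {z : ℝ × M × ℝ | (0 < z.1 ∧ z.2.1 ∈ e.source) ∧ z.2.2 ∈ Ioo (-g.ε) g.ε} :=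
    ((isOpen_lt continuous_const continuous_fst).inter
      (e.open_source.preimage (continuous_fst.comp continuous_snd))).inter
      (isOpen_Ioo.preimage (continuous_snd.comp continuous_snd))
  filter_upwards [hopen.mem_nhds ⟨⟨hp.1, hpe⟩, hp.2⟩] with z hz
  have h2 := h z.1 hz.1.1 (e z.2.1, z.2.2) ⟨e.map_source hz.1.2, hz.2⟩
  rw [e.left_inv hz.1.2] at h2
  simp only [Function.comp_apply, ambientChart_extend, homFun]
  exact h2

theorem eventually_gram_ambient (he : e ∈ IsManifold.maximalAtlas (𝓡 n) ∞ M)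
    {q : ℝ × EuclideanSpace ℝ (Fin n) × ℝ} (hq : q.2.1 ∈ e.target) :
    gram (ambientBasis n) g.ambientMetric (ambientChart e) =ᶠ[𝓝 q]
      fun q => straightMatrix q.1 q.2.2 (g.coordGram e q.2) := by
  have hopen : IsOpen {z : ℝ × EuclideanSpace ℝ (Fin n) × ℝ | z.2.1 ∈ e.target} :=
    e.open_target.preimage (continuous_fst.comp continuous_snd)
  filter_upwards [hopen.mem_nhds hq] with z hz using g.gram_ambientMetric he hz

/-- The ambient Laplacian in coordinates. -/
theorem IsRep.ambientLaplacian (he : e ∈ IsManifold.maximalAtlas (𝓡 n) ∞ M) {w : ℝ}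
    {Ũ : ℝ × M × ℝ → ℝ} {U : smoothAlg (g.coordDomain e)} (h : g.IsRep e w Ũ U) :
    g.IsRep e (w - 2) (g.ambientLaplacian Ũ) ((coordData (isMetricOn_coordGram he)).op w U) := by
  intro t ht q hq
  set p : ℝ × M × ℝ := (t, e.symm q.1, q.2) with hp
  have hpa : p ∈ g.ambientSpace := ⟨ht, hq.2⟩
  have hpe : p.2.1 ∈ e.source := e.map_target hq.1
  have hps : p ∈ (ambientChart e).source := ⟨mem_univ _, hpe, mem_univ _⟩
  -- The Laplacian at `p` is defined in the preferred chart `e'`, so the regularity conditions are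
  -- checked there before passing to `e`.
  set e' := chartAt (EuclideanSpace ℝ (Fin n)) p.2.1 with he'def
  have he' : e' ∈ IsManifold.maximalAtlas (𝓡 n) ∞ M := IsManifold.chart_mem_maximalAtlas _
  have hpe' : p.2.1 ∈ e'.source := mem_chart_source _ _
  have hext : extChartAt (ambientModel n) p p = (t, e' p.2.1, q.2) := ambientChart_extend e' p
  have hmem : (e' p.2.1, q.2) ∈ g.coordDomain e' := ⟨e'.map_source hpe', hq.2⟩
  have hgram : gram (ambientBasis n) g.ambientMetric
      (chartAt (ModelProd ℝ (ModelProd (EuclideanSpace ℝ (Fin n)) ℝ)) p)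
      =ᶠ[𝓝 (extChartAt (ambientModel n) p p)]
      fun q => straightMatrix q.1 q.2.2 (g.coordGram e' q.2) := by
    rw [hext, chartAt_ambient]
    exact eventually_gram_ambient he' (e'.map_source hpe')
  have hmetric := isMetricOn_coordGram (g := g) he'
  have h1 := laplacian_eq_coordLaplacian (b := ambientBasis n) g.ambientMetric
    (ambientChart_mem he) hps (fun i j => by
      have h := contDiffAt_straightMatrix (q := (t, e' p.2.1, q.2)) (hmetric.smooth _ hmem) i j
      rw [← hext] at h
      exact h.congr_of_eventuallyEq (hgram.mono fun z hz => congrFun (congrFun hz i) j)) (by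
      rw [hgram.eq_of_nhds, hext, ← abs_ne_zero, abs_det_straightMatrix]
      exact mul_ne_zero (by positivity) (abs_ne_zero.mpr (hmetric.det_ne_zero _ hmem)))
    (h.contMDiffAt he hpa hpe)
  have hpq : (ambientChart e).extend (ambientModel n) p = (t, q) := by
    rw [ambientChart_extend, hp, e.right_inv hq.1]
  have h2 : Ũ ∘ ((ambientChart e).extend (ambientModel n)).symm =ᶠ[𝓝 (t, q)] homFun w U := by
    have hopen : IsOpen {z : ℝ × EuclideanSpace ℝ (Fin n) × ℝ | 0 < z.1 ∧ z.2 ∈ g.coordDomain e} :=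
      (isOpen_lt continuous_const continuous_fst).inter
        ((g.coordDomain e).isOpen.preimage continuous_snd)
    filter_upwards [hopen.mem_nhds ⟨ht, hq⟩] with z hz
    exact h z.1 hz.1 z.2 hz.2
  rw [hpq, coordLaplacian_congr (eventually_gram_ambient he hq.1) h2,
    coordLaplacian_homFun (isMetricOn_coordGram he) w U ht hq] at h1
  exact h1

theorem IsRep.iterate (he : e ∈ IsManifold.maximalAtlas (𝓡 n) ∞ M) {w : ℝ}
    {Ũ : ℝ × M × ℝ → ℝ} {U : smoothAlg (g.coordDomain e)} (h : g.IsRep e w Ũ U) (j : ℕ) :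
    g.IsRep e (w - 2 * j) (g.ambientLaplacian^[j] Ũ)
      ((coordData (isMetricOn_coordGram he)).iter w j U) := by
  induction j with
  | zero =>
    rw [Nat.cast_zero, mul_zero, sub_zero]
    exact h
  | succ j ih =>
    have := ih.ambientLaplacian he
    rw [Function.iterate_succ_apply', AmbientData.iter_succ]
    convert this using 1
    push_cast
    ring

theorem IsRep.mul {w w' : ℝ} {Ũ F : ℝ × M × ℝ → ℝ} {U f : smoothAlg (g.coordDomain e)}
    (hF : g.IsRep e w' F f) (h : g.IsRep e w Ũ U) : g.IsRep e (w + w') (F * Ũ) (f * U) := by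
  intro t ht q hq
  rw [Pi.mul_apply, hF t ht q hq, h t ht q hq, smoothAlg.ext_mul, Real.rpow_add ht]
  ring

variable (g) in
theorem contDiffOn_lift (he : e ∈ IsManifold.maximalAtlas (𝓡 n) ∞ M) {u : M → ℝ}
    (hu : ContMDiff (𝓡 n) 𝓘(ℝ, ℝ) ∞ u) :
    ContDiffOn ℝ ∞ (fun q : EuclideanSpace ℝ (Fin n) × ℝ => u (e.symm q.1)) (g.coordDomain e) := by
  intro q hq
  have h1 : ContMDiffAt 𝓘(ℝ, EuclideanSpace ℝ (Fin n)) 𝓘(ℝ, ℝ) ∞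
      (u ∘ (e.extend (𝓡 n)).symm) q.1 :=
    hu.contMDiffAt.comp q.1 (contMDiffAt_extend_symm he (by rw [extend_target_eq]; exact hq.1))
  exact (h1.contDiffAt.comp q contDiffAt_fst).contDiffWithinAt

variable (g) in
/-- The function `u(x)` as a function of the coordinates `(x, ρ)`. -/
def lift (he : e ∈ IsManifold.maximalAtlas (𝓡 n) ∞ M) {u : M → ℝ}
    (hu : ContMDiff (𝓡 n) 𝓘(ℝ, ℝ) ∞ u) : smoothAlg (g.coordDomain e) :=
  smoothAlg.ofFun _ (g.contDiffOn_lift he hu)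

theorem ext_lift (he : e ∈ IsManifold.maximalAtlas (𝓡 n) ∞ M) {u : M → ℝ}
    (hu : ContMDiff (𝓡 n) 𝓘(ℝ, ℝ) ∞ u) {q : EuclideanSpace ℝ (Fin n) × ℝ}
    (hq : q ∈ g.coordDomain e) : smoothAlg.ext (g.lift he hu) q = u (e.symm q.1) :=
  smoothAlg.ext_ofFun (g.contDiffOn_lift he hu) hq

theorem isRep_lift (he : e ∈ IsManifold.maximalAtlas (𝓡 n) ∞ M) {u : M → ℝ}
    (hu : ContMDiff (𝓡 n) 𝓘(ℝ, ℝ) ∞ u) (w : ℝ) :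
    g.IsRep e w (fun p => p.1 ^ w * u p.2.1) (g.lift he hu) := fun t _ q hq => by
  rw [ext_lift he hu hq]

/-- By homogeneity `f` is determined by its values at `t = 1`. -/
theorem exists_isRep (he : e ∈ IsManifold.maximalAtlas (𝓡 n) ∞ M) {w' : ℝ} {f : ℝ × M × ℝ → ℝ}
    (hf : g.IsHomogeneous w' f) : ∃ F, g.IsRep e w' f F := by
  have hopen : IsOpen g.ambientSpace := (isOpen_lt continuous_const continuous_fst).inter
      (isOpen_Ioo.preimage (continuous_snd.comp continuous_snd))
  have h1 : ContDiffOn ℝ ∞ (fun q : EuclideanSpace ℝ (Fin n) × ℝ => f (1, e.symm q.1, q.2))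
      (g.coordDomain e) := by
    intro q hq
    have h2 : ContMDiffAt (ambientModel n) 𝓘(ℝ, ℝ) ∞ f (1, e.symm q.1, q.2) :=
      hf.smooth.contMDiffAt (hopen.mem_nhds ⟨one_pos, hq.2⟩)
    have h3 : ContMDiffAt 𝓘(ℝ, EuclideanSpace ℝ (Fin n) × ℝ) (𝓡 n) ∞
        (fun q : EuclideanSpace ℝ (Fin n) × ℝ => (e.extend (𝓡 n)).symm q.1) q :=
      (contMDiffAt_extend_symm he (by rw [extend_target_eq]; exact hq.1)).comp q
        contDiff_fst.contMDiff.contMDiffAt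
    have h4 : ContMDiffAt 𝓘(ℝ, EuclideanSpace ℝ (Fin n) × ℝ) (ambientModel n) ∞
        (fun q : EuclideanSpace ℝ (Fin n) × ℝ => ((1 : ℝ), e.symm q.1, q.2)) q :=
      contMDiffAt_const.prodMk (h3.prodMk contDiff_snd.contMDiff.contMDiffAt)
    exact (h2.comp q h4).contDiffAt.contDiffWithinAt
  refine ⟨smoothAlg.ofFun _ h1, fun t ht q hq => ?_⟩
  have h2 := hf.dilation (1, e.symm q.1, q.2) ⟨one_pos, hq.2⟩ t ht
  rw [smoothAlg.ext_ofFun h1 hq, ← h2, mul_one]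

/-- The induced operator in coordinates. -/
theorem inducedOp_eq_sumOp (he : e ∈ IsManifold.maximalAtlas (𝓡 n) ∞ M) {w' : ℝ}
    {f : ℝ × M × ℝ → ℝ} {F : smoothAlg (g.coordDomain e)} (hF : g.IsRep e w' f F) (k : ℕ) (w : ℝ)
    {u : M → ℝ} (hu : ContMDiff (𝓡 n) 𝓘(ℝ, ℝ) ∞ u) {y : EuclideanSpace ℝ (Fin n)}
    (hy : y ∈ e.target) :
    g.inducedOp k w w' f u (e.symm y) =
      smoothAlg.ext ((coordData (isMetricOn_coordGram he)).sumOp k w w w' F (g.lift he hu))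
        (y, 0) := by
  have hq : (y, (0 : ℝ)) ∈ g.coordDomain e := ⟨hy, zero_mem_Ioo⟩
  rw [inducedOp, ambientOp, AmbientData.sumOp, smoothAlg.ext_sum]
  refine Finset.sum_congr rfl fun j _ => ?_
  have h1 := ((hF.mul ((isRep_lift (g := g) he hu w).iterate he j)).iterate he (k - j)) 1 one_pos _ hq
  rw [smoothAlg.ext_smul, h1, Real.one_rpow, one_mul,
    show w - 2 * (j : ℝ) + w' = w + w' - 2 * j by ring]

/-- The induced operator preserves smoothness. -/
theorem contMDiff_inducedOp {w' : ℝ} {f : ℝ × M × ℝ → ℝ} (hf : g.IsHomogeneous w' f) (k : ℕ) (w : ℝ)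
    {u : M → ℝ} (hu : ContMDiff (𝓡 n) 𝓘(ℝ, ℝ) ∞ u) :
    ContMDiff (𝓡 n) 𝓘(ℝ, ℝ) ∞ (g.inducedOp k w w' f u) := by
  intro x
  set e := chartAt (EuclideanSpace ℝ (Fin n)) x with hedef
  have he : e ∈ IsManifold.maximalAtlas (𝓡 n) ∞ M := IsManifold.chart_mem_maximalAtlas x
  have hx : x ∈ e.source := mem_chart_source _ x
  obtain ⟨F, hF⟩ := exists_isRep he hf
  have h1 : ContMDiffAt (𝓡 n) 𝓘(ℝ, ℝ) ∞ ((fun y => smoothAlg.ext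
      ((coordData (isMetricOn_coordGram he)).sumOp k w w w' F (g.lift he hu)) (y, 0)) ∘
        e.extend (𝓡 n)) x := by
    refine ContMDiffAt.comp x (ContDiffAt.contMDiffAt ?_) (e.contMDiffAt_extend he hx)
    exact ContDiffAt.comp (g := smoothAlg.ext _) _ (smoothAlg.contDiffAt_ext _
      (⟨e.map_source hx, zero_mem_Ioo⟩ : (e x, (0 : ℝ)) ∈ g.coordDomain e))
      (contDiffAt_id.prodMk contDiffAt_const)
  refine h1.congr_of_eventuallyEq ?_
  filter_upwards [e.open_source.mem_nhds hx] with z hz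
  have h2 := inducedOp_eq_sumOp he hF k w hu (e.map_source hz)
  rw [e.left_inv hz] at h2
  exact h2

end MetricFamily

end Representation

/-! ### The volume measure in charts. -/

section Volume

set_option linter.unusedSectionVars false

open Filter Topology

variable {n : ℕ} {M : Type*} [TopologicalSpace M] [ChartedSpace (EuclideanSpace ℝ (Fin n)) M]
  [MeasurableSpace M] [BorelSpace M]
  {e e' : OpenPartialHomeomorph M (EuclideanSpace ℝ (Fin n))}

theorem measurableSet_target_inter_preimage_symm
    (e : OpenPartialHomeomorph M (EuclideanSpace ℝ (Fin n))) {A : Set M} (hA : MeasurableSet A) :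
    MeasurableSet (e.target ∩ e.symm ⁻¹' A) := by
  have h1 : Measurable (e.target.domRestrict e.symm) :=
    (continuousOn_iff_continuous_domRestrict.mp e.continuousOn_symm).measurable
  have h2 := e.open_target.measurableSet.subtype_image (h1 hA)
  convert h2 using 1
  ext y
  exact ⟨fun h => ⟨⟨y, h.1⟩, h.2, rfl⟩, fun ⟨z, hz, h⟩ => h ▸ ⟨z.2, hz⟩⟩

theorem aemeasurable_symm_withDensity (e : OpenPartialHomeomorph M (EuclideanSpace ℝ (Fin n)))
    (f : EuclideanSpace ℝ (Fin n) → ENNReal) :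
    AEMeasurable e.symm ((volume.restrict e.target).withDensity f) :=
  (e.continuousOn_symm.aemeasurable e.open_target.measurableSet).mono_ac
    (withDensity_absolutelyContinuous _ _)

theorem chartVolume_apply (g : BilinField (𝓡 n) (M := M))
    (e : OpenPartialHomeomorph M (EuclideanSpace ℝ (Fin n))) {A : Set M} (hA : MeasurableSet A) :
    chartVolume g e A = ∫⁻ y in e.target ∩ e.symm ⁻¹' A,
      ENNReal.ofReal (Real.sqrt |(gram (stdBasis n) g e y).det|) := by
  rw [chartVolume, Measure.map_apply_of_aemeasurable (aemeasurable_symm_withDensity e _) hA,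
    withDensity_apply', Measure.restrict_restrict' e.open_target.measurableSet, inter_comm]

theorem chartVolume_inter_source (g : BilinField (𝓡 n) (M := M))
    (e : OpenPartialHomeomorph M (EuclideanSpace ℝ (Fin n))) {A : Set M} (hA : MeasurableSet A) :
    chartVolume g e (A ∩ e.source) = chartVolume g e A := by
  rw [chartVolume_apply g e (hA.inter e.open_source.measurableSet), chartVolume_apply g e hA]
  congr 2
  ext y
  exact ⟨fun h => ⟨h.1, h.2.1⟩, fun h => ⟨h.1, h.2, e.map_target h.1⟩⟩

/-- The volume measures of two charts agree on the overlap of their sources. -/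
theorem chartVolume_eq_of_subset [IsManifold (𝓡 n) ∞ M] (g : BilinField (𝓡 n) (M := M))
    (he : e ∈ IsManifold.maximalAtlas (𝓡 n) ∞ M) (he' : e' ∈ IsManifold.maximalAtlas (𝓡 n) ∞ M)
    {A : Set M} (hA : MeasurableSet A) (h : A ⊆ e.source) (h' : A ⊆ e'.source) :
    chartVolume g e A = chartVolume g e' A := by
  set ψ := e'.extend (𝓡 n) ∘ (e.extend (𝓡 n)).symm with hψ
  set B := e.target ∩ e.symm ⁻¹' A with hB
  have himage : e'.target ∩ e'.symm ⁻¹' A = ψ '' B := by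
    ext z
    constructor
    · rintro ⟨hz, hzA⟩
      refine ⟨e (e'.symm z), ⟨e.map_source (h hzA), ?_⟩, ?_⟩
      · change e.symm (e (e'.symm z)) ∈ A
        rwa [e.left_inv (h hzA)]
      · change e' (e.symm (e (e'.symm z))) = z
        rw [e.left_inv (h hzA), e'.right_inv hz]
    · rintro ⟨y, ⟨hy, hyA⟩, rfl⟩
      refine ⟨e'.map_source (h' hyA), ?_⟩
      change e'.symm (e' (e.symm y)) ∈ A
      rwa [e'.left_inv (h' hyA)]
  have hinj : InjOn ψ B := by
    intro y hy z hz hyz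
    have h1 : e.symm y = e.symm z := e'.injOn (h' hy.2) (h' hz.2) hyz
    rw [← e.right_inv hy.1, h1, e.right_inv hz.1]
  have hd : ∀ y ∈ B, HasFDerivWithinAt ψ (fderiv ℝ ψ y) B y := fun y hy =>
    ((contDiffAt_transition he he' (by rw [extend_target_eq]; exact hy.1)
      (h' hy.2)).differentiableAt (by simp)).hasFDerivAt.hasFDerivWithinAt
  rw [chartVolume_apply g e hA, chartVolume_apply g e' hA, himage,
    lintegral_image_eq_lintegral_abs_det_fderiv_mul volume
      (measurableSet_target_inter_preimage_symm e hA) hd hinj]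
  refine setLIntegral_congr_fun (measurableSet_target_inter_preimage_symm e hA) fun y hy => ?_
  beta_reduce
  rw [← ENNReal.ofReal_mul (abs_nonneg _),
    gram_transform g he he' (by rw [extend_target_eq]; exact hy.1) (h' hy.2), Matrix.det_mul,
    Matrix.det_mul, Matrix.det_transpose, det_jacobianMatrix, ← hψ,
    show (fderiv ℝ ψ y).det * (gram (stdBasis n) g e' (ψ y)).det * (fderiv ℝ ψ y).det =
      (fderiv ℝ ψ y).det ^ 2 * (gram (stdBasis n) g e' (ψ y)).det by ring, abs_mul, abs_pow,
    Real.sqrt_mul (by positivity), Real.sqrt_sq (abs_nonneg _)]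

theorem volumeMeasure_restrict_source [IsManifold (𝓡 n) ∞ M] (g : BilinField (𝓡 n) (M := M))
    (he : e ∈ atlas (EuclideanSpace ℝ (Fin n)) M) :
    (volumeMeasure g).restrict e.source = chartVolume g e := by
  have hmax : ∀ {e}, e ∈ atlas (EuclideanSpace ℝ (Fin n)) M →
      e ∈ IsManifold.maximalAtlas (𝓡 n) ∞ M := fun h => IsManifold.subset_maximalAtlas h
  have hs : MeasurableSet e.source := e.open_source.measurableSet
  -- A supremum of measures is not computed set by set, so it is bounded by one measure dominating
  -- every chart measure: inside `e.source` these agree with `chartVolume g e` on overlaps.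
  have h1 : volumeMeasure g ≤ chartVolume g e + (volumeMeasure g).restrict e.sourceᶜ := by
    refine iSup₂_le fun e' he' => Measure.le_iff.mpr fun A hA => ?_
    rw [← measure_inter_add_sdiff A hs, Measure.add_apply, Measure.restrict_apply hA]
    refine add_le_add ?_ ?_
    · rw [← chartVolume_inter_source g e' (hA.inter hs), ← chartVolume_eq_of_subset g (hmax he)
        (hmax he') ((hA.inter hs).inter e'.open_source.measurableSet)
        (fun x hx => hx.1.2) inter_subset_right]
      exact measure_mono fun x hx => hx.1.1
    · exact Measure.le_iff'.mp (le_iSup₂ (f := fun e (_ : e ∈ atlas _ M) => chartVolume g e) e' he') _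
  refine Measure.ext fun A hA => le_antisymm ?_ ?_
  · rw [Measure.restrict_apply hA]
    refine (Measure.le_iff'.mp h1 _).trans ?_
    rw [Measure.add_apply, chartVolume_inter_source g e hA, Measure.restrict_apply (hA.inter hs),
      inter_assoc, inter_compl_self, inter_empty, measure_empty, add_zero]
  · rw [Measure.restrict_apply hA, ← chartVolume_inter_source g e hA]
    exact Measure.le_iff'.mp (le_iSup₂ (f := fun e (_ : e ∈ atlas _ M) => chartVolume g e) e he) _

namespace MetricFamily

variable [IsManifold (𝓡 n) ∞ M] (g : MetricFamily n M)

theorem continuousOn_density (he : e ∈ IsManifold.maximalAtlas (𝓡 n) ∞ M) :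
    ContinuousOn (fun y => Real.sqrt |(gram (stdBasis n) (g.metric 0) e y).det|) e.target := by
  intro y hy
  have h1 : ContinuousOn (fun q => Real.sqrt |(g.coordGram e q).det|) (g.coordDomain e) :=
    (isMetricOn_coordGram he).contDiffOn_sqrt.continuousOn
  exact (h1.comp (s := e.target) (Continuous.prodMk_left (0 : ℝ)).continuousOn
    fun z hz => ⟨hz, zero_mem_Ioo⟩) y hy

/-- The density is bounded on compact subsets of a chart. Integrability of continuous compactly
supported functions follows from this instance. -/
instance isLocallyFiniteMeasure_volumeMeasure :
    IsLocallyFiniteMeasure (volumeMeasure (g.metric 0)) := by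
  refine ⟨fun x => ?_⟩
  set e := chartAt (EuclideanSpace ℝ (Fin n)) x with he
  have hea : e ∈ atlas (EuclideanSpace ℝ (Fin n)) M := chart_mem_atlas _ x
  have hx : x ∈ e.source := mem_chart_source _ x
  obtain ⟨K, hK, hKe, hKc⟩ := exists_compact_subset e.open_target (e.map_source hx)
  refine ⟨e.source ∩ e ⁻¹' interior K,
    (e.isOpen_inter_preimage isOpen_interior).mem_nhds ⟨hx, hKe⟩, ?_⟩
  have hms : MeasurableSet (e.source ∩ e ⁻¹' interior K) :=
    (e.isOpen_inter_preimage isOpen_interior).measurableSet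
  have h1 : volumeMeasure (g.metric 0) (e.source ∩ e ⁻¹' interior K) =
      chartVolume (g.metric 0) e (e.source ∩ e ⁻¹' interior K) := by
    rw [← volumeMeasure_restrict_source _ hea, Measure.restrict_apply hms,
      inter_eq_left.mpr inter_subset_left]
  rw [h1, chartVolume_apply _ _ hms]
  refine (lintegral_mono_set (t := K) fun y hy => interior_subset ?_).trans_lt ?_
  · have := hy.2.2
    rwa [mem_preimage, e.right_inv hy.1] at this
  · have h2 := ((g.continuousOn_density (IsManifold.subset_maximalAtlas hea)).mono
      hKc).integrableOn_compact hK (μ := volume)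
    exact h2.lintegral_lt_top

theorem integral_volumeMeasure (he : e ∈ atlas (EuclideanSpace ℝ (Fin n)) M) {F : M → ℝ}
    (hF : Continuous F) (hsupp : ∀ x ∉ e.source, F x = 0) :
    ∫ x, F x ∂(volumeMeasure (g.metric 0)) =
      ∫ y in e.target, Real.sqrt |(gram (stdBasis n) (g.metric 0) e y).det| * F (e.symm y) := by
  rw [← setIntegral_eq_integral_of_forall_compl_eq_zero hsupp, volumeMeasure_restrict_source _ he,
    chartVolume, integral_map (aemeasurable_symm_withDensity e _) hF.aestronglyMeasurable,
    integral_withDensity_eq_integral_toReal_smul₀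
      (((g.continuousOn_density (IsManifold.subset_maximalAtlas he)).aemeasurable
        e.open_target.measurableSet).ennreal_ofReal) (ae_of_all _ fun _ => ENNReal.ofReal_lt_top)]
  refine integral_congr_ae (ae_of_all _ fun y => ?_)
  simp only [ENNReal.toReal_ofReal (Real.sqrt_nonneg _), smul_eq_mul]

end MetricFamily

end Volume

/-! ### Integration in a chart and globalization. -/

section LocalSymmetry

set_option linter.unusedSectionVars false

open Filter Topology TopologicalSpace

theorem stable_vanishing {n : ℕ} {S : Opens (EuclideanSpace ℝ (Fin n) × ℝ)}
    {G : EuclideanSpace ℝ (Fin n) × ℝ → Matrix (Fin n) (Fin n) ℝ} (hG : IsMetricOn S G)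
    {C : Set (EuclideanSpace ℝ (Fin n) × ℝ)} (hC : IsClosed C) :
    (coordData hG).Stable (smoothAlg.vanishing S C) :=
  ⟨fun _ ha => smoothAlg.deriv_mem_vanishing hC _ ha,
    fun _ _ ha => smoothAlg.deriv_mem_vanishing hC _ ha⟩

/-- The integral of a derivative of a smooth function with compact support vanishes. -/
theorem integral_fderiv_eq_zero {n : ℕ} {c : EuclideanSpace ℝ (Fin n) → ℝ} (hc : ContDiff ℝ ∞ c)
    (hs : HasCompactSupport c) (v : EuclideanSpace ℝ (Fin n)) :
    Integrable (fun y => fderiv ℝ c y v) ∧ ∫ y, fderiv ℝ c y v = 0 := by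
  have h1 : Integrable (fun y => fderiv ℝ c y v) :=
    ((hc.continuous_fderiv (by simp)).clm_apply continuous_const).integrable_of_hasCompactSupport
      ((hs.fderiv (𝕜 := ℝ)).comp_left (g := fun L : EuclideanSpace ℝ (Fin n) →L[ℝ] ℝ => L v) rfl)
  refine ⟨h1, ?_⟩
  -- Integration by parts against the constant function 1.
  have h2 := integral_mul_fderiv_eq_neg_fderiv_mul_of_integrable (μ := volume)
    (f := fun _ : EuclideanSpace ℝ (Fin n) => (1 : ℝ)) (g := c) (v := v) (by simp)
    (by simpa using h1) (by simpa using hc.continuous.integrable_of_hasCompactSupport hs)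
    (fun _ _ => differentiableAt_const _) (fun y _ => hc.differentiable (by simp) y)
  simpa using h2

variable {n : ℕ} {M : Type*} [TopologicalSpace M] [ChartedSpace (EuclideanSpace ℝ (Fin n)) M]
  [IsManifold (𝓡 n) ∞ M] {g : MetricFamily n M}
  {e : OpenPartialHomeomorph M (EuclideanSpace ℝ (Fin n))}

namespace MetricFamily

/-- The induced operator does not increase supports. -/
theorem inducedOp_eq_zero {w' : ℝ} {f : ℝ × M × ℝ → ℝ} (hf : g.IsHomogeneous w' f) (k : ℕ) (w : ℝ)
    {u : M → ℝ} (hu : ContMDiff (𝓡 n) 𝓘(ℝ, ℝ) ∞ u) {x : M} (hx : x ∉ tsupport u) :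
    g.inducedOp k w w' f u x = 0 := by
  set e := chartAt (EuclideanSpace ℝ (Fin n)) x
  have he : e ∈ IsManifold.maximalAtlas (𝓡 n) ∞ M := IsManifold.chart_mem_maximalAtlas x
  have hxe : x ∈ e.source := mem_chart_source _ x
  obtain ⟨F, hF⟩ := exists_isRep he hf
  set O : Set (EuclideanSpace ℝ (Fin n)) := e.target ∩ e.symm ⁻¹' (tsupport u)ᶜ
  have hO : IsOpen O := e.isOpen_inter_preimage_symm (isClosed_tsupport u).isOpen_compl
  have hC : IsClosed (Prod.fst ⁻¹' Oᶜ : Set (EuclideanSpace ℝ (Fin n) × ℝ)) :=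
    hO.isClosed_compl.preimage continuous_fst
  -- The lift vanishes wherever `y ∈ O`, and `sumOp` preserves the ideal of such functions.
  have hU : g.lift he hu ∈ smoothAlg.vanishing (g.coordDomain e) (Prod.fst ⁻¹' Oᶜ) := by
    intro q hq hqC
    rw [ext_lift he hu hq]
    exact image_eq_zero_of_notMem_tsupport (not_not.mp hqC).2
  have h1 := (stable_vanishing (isMetricOn_coordGram he) hC).sumOp_mem k w w w' F hU
    (e x, 0) ⟨e.map_source hxe, zero_mem_Ioo⟩ (fun h => h ⟨e.map_source hxe, by
      rw [mem_preimage, e.left_inv hxe]; exact hx⟩)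
  rw [← inducedOp_eq_sumOp he hF k w hu (e.map_source hxe), e.left_inv hxe] at h1
  exact h1

/-- In a chart, the integrand `v D u - u D v` is a divergence. -/
theorem exists_divergence (he : e ∈ IsManifold.maximalAtlas (𝓡 n) ∞ M) {w' : ℝ}
    {f : ℝ × M × ℝ → ℝ} (hf : g.IsHomogeneous w' f) (k : ℕ) {w : ℝ}
    (hw : w = -((n + w' - 2 * k) / 2)) {u v : M → ℝ} (hu : ContMDiff (𝓡 n) 𝓘(ℝ, ℝ) ∞ u)
    (hv : ContMDiff (𝓡 n) 𝓘(ℝ, ℝ) ∞ v) {K : Set (EuclideanSpace ℝ (Fin n))} (hK : IsClosed K)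
    (hKe : K ⊆ e.target) (hvK : ∀ y ∈ e.target, y ∉ K → v (e.symm y) = 0) :
    ∃ c : Fin n → EuclideanSpace ℝ (Fin n) → ℝ, (∀ i, ContDiff ℝ ∞ (c i)) ∧
      (∀ i, ∀ y ∉ K, c i y = 0) ∧ ∀ y ∈ e.target,
        Real.sqrt |(gram (stdBasis n) (g.metric 0) e y).det| *
          (v (e.symm y) * g.inducedOp k w w' f u (e.symm y) -
            u (e.symm y) * g.inducedOp k w w' f v (e.symm y)) =
          ∑ i, fderiv ℝ (c i) y (stdBasis n i) := by
  set S := g.coordDomain e with hS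
  have hG : IsMetricOn S (g.coordGram e) := isMetricOn_coordGram he
  obtain ⟨F, hF⟩ := exists_isRep he hf
  -- The locus `ρ ≠ 0`, where `1/ρ` is smooth; it is dense in `S`.
  set S' : Opens (EuclideanSpace ℝ (Fin n) × ℝ) := S ⊓ ⟨{q | q.2 ≠ 0},
    isOpen_ne_fun continuous_snd continuous_const⟩
  have hSS' : S' ≤ S := inf_le_left
  have hdense : (S : Set (EuclideanSpace ℝ (Fin n) × ℝ)) ⊆ closure S' := by
    have h1 : Dense {q : EuclideanSpace ℝ (Fin n) × ℝ | q.2 ≠ 0} :=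
      (dense_compl_singleton (0 : ℝ)).preimage isOpenMap_snd
    exact h1.open_subset_closure_inter S.isOpen
  have hσ : ContDiffOn ℝ ∞ (fun q : EuclideanSpace ℝ (Fin n) × ℝ => q.2⁻¹) S' :=
    contDiff_snd.contDiffOn.inv fun _ hq => hq.2
  have hV : g.lift he hv ∈ smoothAlg.vanishing S (Prod.fst ⁻¹' K) := fun q hq hqK => by
    rw [ext_lift he hv hq]
    exact hvK q.1 hq.1 hqK
  obtain ⟨c, hc, r, hr⟩ := AmbientData.sumOp_symm_mod_divergence (coordDataRestrict hSS' hG)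
    (smoothAlg.restrict_injective hSS' hdense) (σ := smoothAlg.ofFun _ hσ)
    (smoothAlg.eq_of_ext fun q hq => by
      have h1 : smoothAlg.ext (coordData (hG.mono hSS')).ρ q = q.2 :=
        smoothAlg.ext_ofFun (f := Prod.snd) contDiff_snd.contDiffOn hq
      rw [smoothAlg.ext_mul, h1, smoothAlg.ext_ofFun hσ hq, smoothAlg.ext_coe _ ⟨q, hq⟩]
      exact mul_inv_cancel₀ hq.2)
    (fun i a => smoothAlg.deriv_comm _ _ a)
    (stable_vanishing hG (hK.preimage continuous_fst)) k w w' hw F (g.lift he hu) hV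
  have hc0 : ∀ i, ∀ y ∉ K, smoothAlg.ext (c i) (y, 0) = 0 := fun i y hy => by
    by_cases h : (y, (0 : ℝ)) ∈ S
    · exact hc i _ h hy
    · exact dif_neg h
  have hι : ∀ y : EuclideanSpace ℝ (Fin n), HasFDerivAt (fun y => (y, (0 : ℝ)))
      ((ContinuousLinearMap.id ℝ _).prod 0) y := fun y =>
    (hasFDerivAt_id y).prodMk (hasFDerivAt_const 0 y)
  refine ⟨fun i y => smoothAlg.ext (c i) (y, 0), fun i => contDiff_iff_contDiffAt.mpr fun y => ?_,
    hc0, fun y hy => ?_⟩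
  -- The restriction to `ρ = 0`, extended by zero, is smooth on all of `ℝⁿ`, since it vanishes off
  -- the closed set `K`, which lies inside `e.target`.
  · by_cases hy : y ∈ K
    · exact ContDiffAt.comp (g := smoothAlg.ext (c i)) y (smoothAlg.contDiffAt_ext _
        (⟨hKe hy, zero_mem_Ioo⟩ : (y, (0 : ℝ)) ∈ g.coordDomain e))
        (contDiffAt_id.prodMk contDiffAt_const)
    · refine (contDiffAt_const (c := (0 : ℝ))).congr_of_eventuallyEq ?_
      filter_upwards [hK.isOpen_compl.mem_nhds hy] with z hz using hc0 i z hz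
  · have hq : (y, (0 : ℝ)) ∈ S := ⟨hy, zero_mem_Ioo⟩
    have h1 := congrArg (fun W => smoothAlg.ext W (y, (0 : ℝ))) hr
    simp only [smoothAlg.ext_mul, smoothAlg.ext_sub, smoothAlg.ext_add, smoothAlg.ext_sum,
      ext_lift he hu hq, ext_lift he hv hq] at h1
    rw [inducedOp_eq_sumOp he hF k w hu hy, inducedOp_eq_sumOp he hF k w hv hy]
    have h2 : smoothAlg.ext (coordData hG).m (y, 0) =
        Real.sqrt |(gram (stdBasis n) (g.metric 0) e y).det| :=
      smoothAlg.ext_ofFun hG.contDiffOn_sqrt hq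
    have h3 : smoothAlg.ext (coordData hG).ρ (y, 0) = 0 :=
      smoothAlg.ext_ofFun (f := Prod.snd) contDiff_snd.contDiffOn hq
    rw [h2, h3, zero_mul, add_zero] at h1
    rw [h1]
    refine Finset.sum_congr rfl fun i _ => ?_
    have h4 := ((smoothAlg.differentiableAt_ext (c i) hq).hasFDerivAt.comp y (hι y)).fderiv
    have h5 : smoothAlg.ext ((coordData hG).d i (c i)) (y, 0) = _ := smoothAlg.ext_deriv _ _ hq
    rw [h5]
    exact (congrArg (fun L : EuclideanSpace ℝ (Fin n) →L[ℝ] ℝ => L (stdBasis n i)) h4).symm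

variable [MeasurableSpace M] [BorelSpace M]

theorem integrable_mul_inducedOp {w' : ℝ} {f : ℝ × M × ℝ → ℝ} (hf : g.IsHomogeneous w' f) (k : ℕ)
    (w : ℝ) {u v : M → ℝ} (hu : ContMDiff (𝓡 n) 𝓘(ℝ, ℝ) ∞ u) (hv : ContMDiff (𝓡 n) 𝓘(ℝ, ℝ) ∞ v)
    (hvs : HasCompactSupport v) :
    Integrable (fun x => v x * g.inducedOp k w w' f u x) (volumeMeasure (g.metric 0)) :=
  (hv.continuous.mul (contMDiff_inducedOp hf k w hu).continuous).integrable_of_hasCompactSupport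
    hvs.mul_right

/-- Only `v` has to be supported in the chart: by locality of the operator both integrands vanish
off `tsupport v`. -/
theorem integral_inducedOp_symm_of_chart (he : e ∈ atlas (EuclideanSpace ℝ (Fin n)) M) {w' : ℝ}
    {f : ℝ × M × ℝ → ℝ} (hf : g.IsHomogeneous w' f) (k : ℕ) {w : ℝ}
    (hw : w = -((n + w' - 2 * k) / 2)) {u v : M → ℝ} (hu : ContMDiff (𝓡 n) 𝓘(ℝ, ℝ) ∞ u)
    (hv : ContMDiff (𝓡 n) 𝓘(ℝ, ℝ) ∞ v) (hus : HasCompactSupport u) (hvs : HasCompactSupport v)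
    (hve : tsupport v ⊆ e.source) :
    ∫ x, v x * g.inducedOp k w w' f u x ∂(volumeMeasure (g.metric 0)) =
      ∫ x, u x * g.inducedOp k w w' f v x ∂(volumeMeasure (g.metric 0)) := by
  have hem : e ∈ IsManifold.maximalAtlas (𝓡 n) ∞ M := IsManifold.subset_maximalAtlas he
  have hK : IsCompact (e '' tsupport v) := IsCompact.image_of_continuousOn hvs
    (e.continuousOn.mono hve)
  have hKe : e '' tsupport v ⊆ e.target := by
    rintro _ ⟨x, hx, rfl⟩
    exact e.map_source (hve hx)
  obtain ⟨c, hc, hc0, hdiv⟩ := exists_divergence hem hf k hw hu hv hK.isClosed hKe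
    fun y hy hyK => image_eq_zero_of_notMem_tsupport fun h => hyK ⟨_, h, e.right_inv hy⟩
  have hcs : ∀ i, HasCompactSupport (c i) := fun i => HasCompactSupport.intro hK (hc0 i)
  rw [← sub_eq_zero, ← integral_sub (integrable_mul_inducedOp hf k w hu hv hvs)
    (integrable_mul_inducedOp hf k w hv hu hus),
    g.integral_volumeMeasure he (F := fun x => v x * g.inducedOp k w w' f u x -
      u x * g.inducedOp k w w' f v x) ((hv.continuous.mul (contMDiff_inducedOp hf k w hu).continuous).sub
      (hu.continuous.mul (contMDiff_inducedOp hf k w hv).continuous)) (fun x hx => by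
        have h1 : x ∉ tsupport v := fun h => hx (hve h)
        simp only [image_eq_zero_of_notMem_tsupport h1, inducedOp_eq_zero hf k w hv h1, zero_mul,
          mul_zero, sub_zero]),
    setIntegral_congr_fun e.open_target.measurableSet hdiv,
    setIntegral_eq_integral_of_forall_compl_eq_zero (fun y hy => by
      refine Finset.sum_eq_zero fun i _ => ?_
      have h1 : c i =ᶠ[𝓝 y] fun _ => 0 := by
        filter_upwards [hK.isClosed.isOpen_compl.mem_nhds fun h => hy (hKe h)] with z hz
          using hc0 i z hz
      rw [h1.fderiv_eq]
      simp),
    integral_finsetSum _ fun i _ => (integral_fderiv_eq_zero (hc i) (hcs i) _).1]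
  exact Finset.sum_eq_zero fun i _ => (integral_fderiv_eq_zero (hc i) (hcs i) _).2

/-- Needed to sum over a partition of unity. It is read off in a chart, where `sumOp` is linear on
smooth functions; derivatives with default values are not additive on arbitrary functions. -/
theorem inducedOp_add {w' : ℝ} {f : ℝ × M × ℝ → ℝ} (hf : g.IsHomogeneous w' f) (k : ℕ) (w : ℝ)
    {u v : M → ℝ} (hu : ContMDiff (𝓡 n) 𝓘(ℝ, ℝ) ∞ u) (hv : ContMDiff (𝓡 n) 𝓘(ℝ, ℝ) ∞ v) (x : M) :
    g.inducedOp k w w' f (u + v) x =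
      g.inducedOp k w w' f u x + g.inducedOp k w w' f v x := by
  set e := chartAt (EuclideanSpace ℝ (Fin n)) x
  have he : e ∈ IsManifold.maximalAtlas (𝓡 n) ∞ M := IsManifold.chart_mem_maximalAtlas x
  have hxe : x ∈ e.source := mem_chart_source _ x
  obtain ⟨F, hF⟩ := exists_isRep he hf
  have h1 : g.lift he (hu.add hv) = g.lift he hu + g.lift he hv := by
    refine smoothAlg.eq_of_ext fun q hq => ?_
    rw [smoothAlg.ext_add, ext_lift he _ hq, ext_lift he _ hq, ext_lift he _ hq]
    rfl
  have h2 : ∀ {z : M → ℝ} (hz : ContMDiff (𝓡 n) 𝓘(ℝ, ℝ) ∞ z), g.inducedOp k w w' f z x = _ :=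
    fun hz => (congrArg _ (e.left_inv hxe).symm).trans
      (inducedOp_eq_sumOp he hF k w hz (e.map_source hxe))
  rw [h2 (hu.add hv), h2 hu, h2 hv, h1, ← smoothAlg.ext_add]
  congr 1
  simp only [AmbientData.sumOp, map_add, mul_add, smul_add, Finset.sum_add_distrib]

/-- The induced operator is formally self-adjoint. -/
theorem integral_inducedOp_symm [T2Space M] [SecondCountableTopology M] {w' : ℝ}
    {f : ℝ × M × ℝ → ℝ} (hf : g.IsHomogeneous w' f) (k : ℕ) {w : ℝ}
    (hw : w = -((n + w' - 2 * k) / 2)) {u v : M → ℝ} (hu : ContMDiff (𝓡 n) 𝓘(ℝ, ℝ) ∞ u)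
    (hv : ContMDiff (𝓡 n) 𝓘(ℝ, ℝ) ∞ v) (hus : HasCompactSupport u) (hvs : HasCompactSupport v) :
    ∫ x, v x * g.inducedOp k w w' f u x ∂(volumeMeasure (g.metric 0)) =
      ∫ x, u x * g.inducedOp k w w' f v x ∂(volumeMeasure (g.metric 0)) := by
  have : LocallyCompactSpace M := ChartedSpace.locallyCompactSpace (EuclideanSpace ℝ (Fin n)) M
  -- With `u` fixed, the identity is additive in `v`. Smoothness and compact support are carried
  -- along because splitting the integrals requires them.
  set P : (M → ℝ) → Prop := fun v => ContMDiff (𝓡 n) 𝓘(ℝ, ℝ) ∞ v ∧ HasCompactSupport v ∧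
    ∫ x, v x * g.inducedOp k w w' f u x ∂(volumeMeasure (g.metric 0)) =
      ∫ x, u x * g.inducedOp k w w' f v x ∂(volumeMeasure (g.metric 0)) with hP
  have hP_add : ∀ a b, P a → P b → P (a + b) := by
    rintro a b ⟨ha, has, hai⟩ ⟨hb, hbs, hbi⟩
    refine ⟨ha.add hb, has.add hbs, ?_⟩
    simp only [inducedOp_add hf k w ha hb, Pi.add_apply, add_mul, mul_add]
    rw [integral_add (integrable_mul_inducedOp hf k w hu ha has)
      (integrable_mul_inducedOp hf k w hu hb hbs),
      integral_add (integrable_mul_inducedOp hf k w ha hu hus)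
      (integrable_mul_inducedOp hf k w hb hu hus), hai, hbi]
  have hP_chart : ∀ a, ContMDiff (𝓡 n) 𝓘(ℝ, ℝ) ∞ a → HasCompactSupport a →
      (∃ e ∈ atlas (EuclideanSpace ℝ (Fin n)) M, tsupport a ⊆ e.source) → P a :=
    fun a ha has ⟨e, he, hae⟩ =>
      ⟨ha, has, integral_inducedOp_symm_of_chart he hf k hw hu ha hus has hae⟩
  have hP_zero : P 0 := by
    refine ⟨contMDiff_const, HasCompactSupport.zero, ?_⟩
    have h0 : ∀ x, g.inducedOp k w w' f 0 x = 0 := fun x =>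
      inducedOp_eq_zero (u := 0) hf k w contMDiff_const (by
        rw [tsupport_eq_empty_iff.mpr rfl]; exact notMem_empty x)
    simp [h0]
  -- Finitely many charts cover the support of `v`, so the partition of unity is a finite family and
  -- finite additivity is enough.
  obtain ⟨t, ht⟩ := hvs.elim_finite_subcover
    (fun x : M => (chartAt (EuclideanSpace ℝ (Fin n)) x).source)
    (fun x => (chartAt (EuclideanSpace ℝ (Fin n)) x).open_source)
    (fun x _ => mem_iUnion.mpr ⟨x, mem_chart_source _ x⟩)
  obtain ⟨χ, hχ⟩ := SmoothPartitionOfUnity.exists_isSubordinate (𝓡 n) (isClosed_tsupport v)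
    (fun x : t => (chartAt (EuclideanSpace ℝ (Fin n)) (x : M)).source)
    (fun x => (chartAt (EuclideanSpace ℝ (Fin n)) (x : M)).open_source)
    (by rwa [iUnion_subtype])
  have hsum : v = ∑ i : t, fun x => χ i x * v x := by
    funext x
    rw [Finset.sum_apply, ← Finset.sum_mul]
    by_cases hx : x ∈ tsupport v
    · rw [← finsum_eq_sum_of_fintype, χ.sum_eq_one hx, one_mul]
    · rw [image_eq_zero_of_notMem_tsupport hx, mul_zero]
  have hPv : P (∑ i : t, fun x => χ i x * v x) :=
    Finset.sum_induction _ P hP_add hP_zero fun i _ =>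
      hP_chart _ ((χ i).contMDiff.mul hv) hvs.mul_left
        ⟨_, chart_mem_atlas _ (i : M), (tsupport_mul_subset_left).trans (hχ i)⟩
  rw [← hsum] at hPv
  exact hPv.2.2

end MetricFamily

end LocalSymmetry

end AmbientFSA

end

/-! ### The theorem. -/

theorem proposition4p2 {n : ℕ} {M : Type*} [TopologicalSpace M] [T2Space M]
    [SecondCountableTopology M] [ChartedSpace (EuclideanSpace ℝ (Fin n)) M]
    [IsManifold (𝓡 n) ∞ M] [MeasurableSpace M] [BorelSpace M]
    (g : AmbientFSA.MetricFamily n M) (w' : ℝ) (f : ℝ × M × ℝ → ℝ)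
    (hf : g.IsHomogeneous w' f) (k : ℕ) (w : ℝ) (hw : w = -((n + w' - 2 * k) / 2)) :
    (∀ u : M → ℝ, ContMDiff (𝓡 n) 𝓘(ℝ, ℝ) ∞ u →
      ContMDiff (𝓡 n) 𝓘(ℝ, ℝ) ∞ (g.inducedOp k w w' f u)) ∧
    ∀ u v : M → ℝ, ContMDiff (𝓡 n) 𝓘(ℝ, ℝ) ∞ u → ContMDiff (𝓡 n) 𝓘(ℝ, ℝ) ∞ v →
      HasCompactSupport u → HasCompactSupport v →
      Integrable (fun x => v x * g.inducedOp k w w' f u x)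
          (AmbientFSA.volumeMeasure (g.metric 0)) ∧
        Integrable (fun x => u x * g.inducedOp k w w' f v x)
          (AmbientFSA.volumeMeasure (g.metric 0)) ∧
        ∫ x, v x * g.inducedOp k w w' f u x ∂(AmbientFSA.volumeMeasure (g.metric 0)) =
          ∫ x, u x * g.inducedOp k w w' f v x ∂(AmbientFSA.volumeMeasure (g.metric 0)) :=
  ⟨fun _ hu => AmbientFSA.MetricFamily.contMDiff_inducedOp hf k w hu, fun _ _ hu hv hus hvs =>
    ⟨AmbientFSA.MetricFamily.integrable_mul_inducedOp hf k w hu hv hvs,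
      AmbientFSA.MetricFamily.integrable_mul_inducedOp hf k w hv hu hus,
      AmbientFSA.MetricFamily.integral_inducedOp_symm hf k hw hu hv hus hvs⟩⟩
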